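/- Let $\mathbb T=\mathbb R/2\pi\mathbb Z$. Let $\Gamma\subset\mathbb R^2$ be a compact strictly convex set whose boundary is a simple closed $C^5$ curve of length $2\pi$ with everywhere positive curvature, let $\gamma:\mathbb T\to\partial\Gamma$ be a counterclockwise arclength parametrisation, and let $\rho(\varphi)$ be the radius of curvature of $\partial\Gamma$ at $\gamma(\varphi)$. On the annulus $\mathbb A=\mathbb T\times(0,\pi)$ let $T_1:(\varphi,\theta)\mapsto(\varphi_1,\theta_1)$ be the billiard map in $\Gamma$: a particle leaves $\gamma(\varphi)$ in the direction which makes the angle $\theta$ with $\gamma'(\varphi)$, counted counterclockwise, and meets $\partial\Gamma$ next at $\gamma(\varphi_1)$, where it is reflected so as to make the angle $\theta_1$ with $\gamma'(\varphi_1)$. For $\ell>0$ let $T_2(\varphi,\theta)=(\varphi+\ell\cot\theta,\theta)$, and let $T=T_2\circ T_1:\mathbb A\to\mathbb A$ be the coin map of height $\ell$. An essential invariant curve of $T$ is a simple closed curve $C\subset\mathbb A$ that is not contractible in $\mathbb A$ and satisfies $T(C)=C$. Suppose that $\partial\Gamma$ is not a circle. Then $\rho''$ has a minimum on $\mathbb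 T$, and $$\ell_0:=-\frac{3}{\min_{\varphi\in\mathbb T}\rho''(\varphi)}>0.$$ Moreover, for every $\ell>\ell_0$ there is $\delta>0$ such that no essential invariant curve of $T$ meets $\bigl(\mathbb T\times(0,\delta)\bigr)\cup\bigl(\mathbb T\times(\pi-\delta,\pi)\bigr)$. -/

import Mathlib

namespace Coin

/-- The circle `ℝ / 2πℤ`. -/
abbrev Circ : Type := AddCircle (2 * Real.pi)

/-- The open phase annulus, with coordinates `(φ, θ)`, `0 < θ < π`. -/
abbrev Phase : Type := Circ × Set.Ioo (0 : ℝ) Real.pi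

/-- The derivative of a function on the circle, with respect to the coordinate of `ℝ / 2πℤ`. -/
noncomputable def circDeriv {E : Type*} [NormedAddCommGroup E] [NormedSpace ℝ E]
    (f : Circ → E) (φ : Circ) : E :=
  deriv (fun s : ℝ => f (φ + (s : Circ))) 0

/-- The determinant of two vectors of the Euclidean plane, which is identified with `ℂ`. -/
def cross (z w : ℂ) : ℝ := z.re * w.im - z.im * w.re

/-- The signed curvature `det (γ', γ'')` of a plane curve parametrised by arclength. -/
noncomputable def curvature (γ : Circ → ℂ) (φ : Circ) : ℝ :=
  cross (circDeriv γ φ) (circDeriv (circDeriv γ) φ)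

/-- The radius of curvature. -/
noncomputable def radius (γ : Circ → ℂ) (φ : Circ) : ℝ := (curvature γ φ)⁻¹

/-- A compact strictly convex billiard table in the plane, whose boundary is a closed `C⁵` curve
of length `2π` and of positive curvature, together with a counterclockwise arclength
parametrisation of its boundary. (Since the table is convex, the signed curvature can only be
positive for the counterclockwise orientation.) -/
structure Table where
  /-- the table -/
  Γ : Set ℂ
  /-- the parametrisation of its boundary -/
  γ : Circ → ℂ
  isCompact : IsCompact Γ
  strictConvex : StrictConvex ℝ Γ
  frontier_eq : frontier Γ = Set.range γ
  injective : Function.Injective γ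
  contDiff : ContDiff ℝ 5 (fun s : ℝ => γ (s : Circ))
  unit_speed : ∀ φ, ‖circDeriv γ φ‖ = 1
  curvature_pos : ∀ φ, 0 < curvature γ φ

/-- The billiard law. From `x = (φ, θ)` the particle leaves `γ φ` with the velocity
`v = R(θ) γ'(φ)`; it reaches the boundary again at `γ φ₁`, where `v` is the vector
`R(-θ₁) γ'(φ₁)`, which is reflected to `R(θ₁) γ'(φ₁)`; and `y = (φ₁, θ₁)`. -/
def IsBilliardStep (γ : Circ → ℂ) (x y : Phase) : Prop :=
  (∃ t : ℝ, 0 < t ∧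
    γ y.1 = γ x.1 + t * (Complex.exp ((x.2 : ℝ) * Complex.I) * circDeriv γ x.1)) ∧
  Complex.exp ((x.2 : ℝ) * Complex.I) * circDeriv γ x.1 =
    Complex.exp (-(y.2 : ℝ) * Complex.I) * circDeriv γ y.1

/-! ### The billiard map is well defined -/

namespace Table

variable (B : Table)

theorem hasDerivAt_shift (φ : Circ) (s : ℝ) :
    HasDerivAt (fun s : ℝ => B.γ (φ + (s : Circ))) (circDeriv B.γ (φ + (s : Circ))) s := by
  induction φ using QuotientAddGroup.induction_on with
  | H a =>
    have hd : Differentiable ℝ (fun s : ℝ => B.γ (s : Circ)) :=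
      B.contDiff.differentiable (by norm_num)
    have key : ∀ b s : ℝ, HasDerivAt (fun s : ℝ => B.γ ((b : Circ) + (s : Circ)))
        (deriv (fun s : ℝ => B.γ (s : Circ)) (b + s)) s := by
      intro b s
      have h := (hd (b + s)).hasDerivAt.comp_const_add b s
      exact h.congr_of_eventuallyEq (Filter.Eventually.of_forall fun u => by simp)
    have h2 : circDeriv B.γ ((a : Circ) + (s : Circ))
        = deriv (fun s : ℝ => B.γ (s : Circ)) (a + s) := by
      have := (key (a + s) 0).deriv
      simpa [circDeriv] using this
    have := key a s
    rw [← h2] at this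
    exact this

theorem hasDerivAt_tangent (φ : Circ) :
    HasDerivAt (fun s : ℝ => circDeriv B.γ (φ + (s : Circ)))
      (circDeriv (circDeriv B.γ) φ) 0 := by
  apply DifferentiableAt.hasDerivAt
  induction φ using QuotientAddGroup.induction_on with
  | H a =>
    have h5 : ContDiff ℝ (4 + 1) (fun s : ℝ => B.γ (s : Circ)) := by
      have h : (4 + 1 : WithTop ℕ∞) = 5 := by norm_num
      rw [h]
      exact B.contDiff
    have hd : Differentiable ℝ (deriv (fun s : ℝ => B.γ (s : Circ))) :=
      (contDiff_succ_iff_deriv.1 h5).2.2.differentiable (by norm_num)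
    have h2 : (fun s : ℝ => circDeriv B.γ ((a : Circ) + (s : Circ)))
        = fun s => deriv (fun s : ℝ => B.γ (s : Circ)) (a + s) := by
      funext s
      have h1 := (B.hasDerivAt_shift (a : Circ) s).deriv
      rw [← h1]
      have := deriv_comp_const_add (fun s : ℝ => B.γ (s : Circ)) a s
      rw [← this]
      simp
    change DifferentiableAt ℝ (fun s : ℝ => circDeriv B.γ ((a : Circ) + (s : Circ))) 0
    rw [h2]
    exact DifferentiableAt.comp (g := deriv (fun s : ℝ => B.γ (s : Circ)))
      (0 : ℝ) (hd (a + 0)) ((differentiableAt_id).const_add a)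

theorem mem (φ : Circ) : B.γ φ ∈ B.Γ :=
  B.isCompact.isClosed.frontier_subset (B.frontier_eq ▸ Set.mem_range_self φ)

theorem notMem_interior (φ : Circ) : B.γ φ ∉ interior B.Γ := by
  have h : B.γ φ ∈ frontier B.Γ := B.frontier_eq ▸ Set.mem_range_self φ
  exact h.2

theorem midpoint_mem {y z : ℂ} (hy : y ∈ B.Γ) (hz : z ∈ B.Γ) (h : y ≠ z) :
    (2⁻¹ : ℝ) • y + (2⁻¹ : ℝ) • z ∈ interior B.Γ :=
  B.strictConvex hy hz h (by norm_num) (by norm_num) (by norm_num)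

theorem coe_ne_zero {s : ℝ} (h0 : 0 < s) (h1 : s < 2 * Real.pi) : ((s : ℝ) : Circ) ≠ 0 := by
  intro h
  rw [AddCircle.coe_eq_zero_iff] at h
  obtain ⟨n, hn⟩ := h
  have hpi := Real.two_pi_pos
  rw [zsmul_eq_mul] at hn
  have h2 : (0 : ℝ) < n := by
    by_contra hc
    push Not at hc
    nlinarith
  have h3 : (n : ℝ) < 1 := by
    by_contra hc
    push Not at hc
    nlinarith
  have h4 : 0 < n := by exact_mod_cast h2
  have h5 : n < 1 := by exact_mod_cast h3
  omega

/-- The table lies strictly to the left of each of its tangent lines. -/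
theorem cross_pos (φ : Circ) {y : ℂ} (hy : y ∈ B.Γ) (hne : y ≠ B.γ φ) :
    0 < cross (circDeriv B.γ φ) (y - B.γ φ) := by
  obtain ⟨f, hf⟩ := geometric_hahn_banach_open_point B.strictConvex.convex.interior
    isOpen_interior (B.notMem_interior φ)
  set τ := circDeriv B.γ φ with hτ
  set p := B.γ φ with hp
  have hsq : τ.re * τ.re + τ.im * τ.im = 1 := by
    have h1 := Complex.normSq_eq_norm_sq τ
    rw [B.unit_speed φ, Complex.normSq_apply] at h1
    linarith
  have h0 : HasDerivAt (fun s : ℝ => B.γ (φ + (s : Circ))) τ 0 := by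
    simpa using B.hasDerivAt_shift φ 0
  have hlt : ∀ z ∈ B.Γ, z ≠ p → f z < f p := by
    intro z hz hzp
    have h1 := hf _ (B.midpoint_mem hz (B.mem φ) hzp)
    simp only [map_add, map_smul, smul_eq_mul] at h1
    linarith
  have hle : ∀ z ∈ B.Γ, f z ≤ f p := by
    intro z hz
    rcases eq_or_ne z p with h | h
    · rw [h]
    · exact (hlt z hz h).le
  have hfτ : f τ = 0 := by
    have h1 : HasDerivAt (fun s : ℝ => f (B.γ (φ + (s : Circ)))) (f τ) 0 :=
      f.hasFDerivAt.comp_hasDerivAt (0 : ℝ) h0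
    have h2 : IsLocalMax (fun s : ℝ => f (B.γ (φ + (s : Circ)))) 0 :=
      Filter.Eventually.of_forall fun s => by simpa using hle _ (B.mem _)
    exact h2.hasDerivAt_eq_zero h1
  have hform : ∀ z, f z = cross τ z * f (Complex.I * τ) := by
    intro z
    have h1 : z = (τ.re * z.re + τ.im * z.im) • τ + cross τ z • (Complex.I * τ) := by
      apply Complex.ext
      · simp [cross]
        linear_combination (-z.re) * hsq
      · simp [cross]
        linear_combination (-z.im) * hsq
    conv_lhs => rw [h1]
    rw [map_add, map_smul, map_smul, hfτ]
    simp
  set c := f (Complex.I * τ) with hc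
  have hcneg : c < 0 := by
    by_contra hcn
    push Not at hcn
    -- the height over the tangent line has a local maximum and a positive second derivative
    set h : ℝ → ℝ := fun s => cross τ (B.γ (φ + (s : Circ))) with hh
    have hcr : ∀ (g : ℝ → ℂ) (g' : ℂ) (s : ℝ), HasDerivAt g g' s →
        HasDerivAt (fun s => cross τ (g s)) (cross τ g') s := by
      intro g g' s hg
      have hre : HasDerivAt (fun s => (g s).re) g'.re s :=
        Complex.reCLM.hasFDerivAt.comp_hasDerivAt s hg
      have him : HasDerivAt (fun s => (g s).im) g'.im s :=
        Complex.imCLM.hasFDerivAt.comp_hasDerivAt s hg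
      exact (him.const_mul τ.re).sub (hre.const_mul τ.im)
    have hd1 : deriv h = fun s : ℝ => cross τ (circDeriv B.γ (φ + (s : Circ))) := by
      funext s
      exact (hcr _ _ s (B.hasDerivAt_shift φ s)).deriv
    have hd10 : deriv h 0 = 0 := by
      rw [hd1]
      simp [cross, ← hτ]
      ring
    have hd2 : deriv (deriv h) 0 = curvature B.γ φ := by
      rw [hd1]
      exact (hcr _ _ 0 (B.hasDerivAt_tangent φ)).deriv
    have hpos : deriv (deriv h) 0 > 0 := hd2 ▸ B.curvature_pos φ
    have hmin := isLocalMin_of_deriv_deriv_pos hpos hd10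
      (hcr _ _ 0 (B.hasDerivAt_shift φ 0)).continuousAt
    have hcpos : 0 < c := by
      rcases hcn.eq_or_lt with h1 | h1
      · exfalso
        have h2 := hlt y hy hne
        rw [hform, hform p, ← h1] at h2
        simp at h2
      · exact h1
    have hconst : h =ᶠ[nhds 0] fun _ => h 0 := by
      filter_upwards [hmin] with s hs
      apply le_antisymm _ hs
      have h1 := hle _ (B.mem (φ + (s : Circ)))
      rw [hform, hform p] at h1
      have h2 := le_of_mul_le_mul_right h1 hcpos
      simpa [hh] using h2
    have h3 : deriv h =ᶠ[nhds 0] fun _ => 0 := by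
      have := hconst.deriv
      simpa using this
    have h4 := h3.deriv_eq
    rw [deriv_const] at h4
    linarith
  have h1 := hlt y hy hne
  have h2 : f (y - p) < 0 := by
    rw [map_sub]
    linarith
  rw [hform] at h2
  by_contra hcon
  push Not at hcon
  nlinarith [mul_nonneg_of_nonpos_of_nonpos hcon hcneg.le]

theorem cross_swap (z w : ℂ) : cross z w = -cross w z := by
  simp only [cross]
  ring

/-- From every phase point there is exactly one billiard step. -/
theorem existsUnique_step (x : Phase) : ∃! y : Phase, IsBilliardStep B.γ x y := by
  obtain ⟨φ, θ, hθ⟩ := x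
  set τ := circDeriv B.γ φ with hτ
  set v := Complex.exp ((θ : ℝ) * Complex.I) * τ with hv
  have hsin := Real.sin_pos_of_mem_Ioo hθ
  have hτ1 : ‖τ‖ = 1 := B.unit_speed φ
  have hv1 : ‖v‖ = 1 := by
    rw [hv, norm_mul, Complex.norm_exp_ofReal_mul_I, hτ1, one_mul]
  have hsq : τ.re * τ.re + τ.im * τ.im = 1 := by
    have h1 := Complex.normSq_eq_norm_sq τ
    rw [hτ1, Complex.normSq_apply] at h1
    linarith
  have hvsq : v.re * v.re + v.im * v.im = 1 := by
    have h1 := Complex.normSq_eq_norm_sq v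
    rw [hv1, Complex.normSq_apply] at h1
    linarith
  have hvre : v.re = Real.cos θ * τ.re - Real.sin θ * τ.im := by
    rw [hv, Complex.exp_mul_I]
    simp [Complex.cos_ofReal_re, Complex.sin_ofReal_re]
  have hvim : v.im = Real.cos θ * τ.im + Real.sin θ * τ.re := by
    rw [hv, Complex.exp_mul_I]
    simp [Complex.cos_ofReal_re, Complex.sin_ofReal_re]
  have hτv : cross τ v = Real.sin θ := by
    simp only [cross, hvre, hvim]
    linear_combination Real.sin θ * hsq
  -- the signed distance of the boundary point from the ray
  set A : ℝ → ℝ := fun s => cross v (B.γ (φ + (s : Circ)) - B.γ φ) with hA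
  have hAd : ∀ s : ℝ, HasDerivAt A (cross v (circDeriv B.γ (φ + (s : Circ)))) s := by
    intro s
    have hg := (B.hasDerivAt_shift φ s).sub_const (B.γ φ)
    have hre := Complex.reCLM.hasFDerivAt.comp_hasDerivAt s hg
    have him := Complex.imCLM.hasFDerivAt.comp_hasDerivAt s hg
    exact (him.const_mul v.re).sub (hre.const_mul v.im)
  have hA0 : A 0 = 0 := by simp [hA, cross]
  have hAper : ∀ s, A (s + 2 * Real.pi) = A s := by
    intro s
    simp only [hA]
    rw [AddCircle.coe_add_period]
  have hAd0 : deriv A 0 = -Real.sin θ := by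
    rw [(hAd 0).deriv]
    simp only [QuotientAddGroup.mk_zero, add_zero]
    rw [cross_swap, hτv]
  have hcont : Continuous A := continuous_iff_continuousAt.2 fun s => (hAd s).continuousAt
  have hpi := Real.two_pi_pos
  have hzero : ∃ s, 0 < s ∧ s < 2 * Real.pi ∧ A s = 0 := by
    by_contra hno
    push Not at hno
    have hsign : (∀ s ∈ Set.Ioo 0 (2 * Real.pi), 0 < A s) ∨
        (∀ s ∈ Set.Ioo 0 (2 * Real.pi), A s < 0) := by
      by_contra hcon
      push Not at hcon
      obtain ⟨⟨a, ha, ha'⟩, b, hb, hb'⟩ := hcon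
      obtain ⟨s, hs, hs'⟩ := isPreconnected_Ioo.intermediate_value ha hb hcont.continuousOn
        (⟨ha', hb'⟩ : (0 : ℝ) ∈ Set.Icc (A a) (A b))
      exact hno s hs.1 hs.2 hs'
    have hnear : ∀ᶠ s in nhds (0 : ℝ), s ∈ Set.Ioo (-(2 * Real.pi)) (2 * Real.pi) :=
      Ioo_mem_nhds (by linarith) hpi
    have hloc : deriv A 0 = 0 := by
      rcases hsign with h | h
      · apply IsLocalMin.deriv_eq_zero
        filter_upwards [hnear] with s hs
        rw [hA0]
        rcases lt_trichotomy s 0 with h1 | h1 | h1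
        · rw [← hAper]
          exact (h _ ⟨by linarith [hs.1], by linarith⟩).le
        · rw [h1, hA0]
        · exact (h _ ⟨h1, hs.2⟩).le
      · apply IsLocalMax.deriv_eq_zero
        filter_upwards [hnear] with s hs
        rw [hA0]
        rcases lt_trichotomy s 0 with h1 | h1 | h1
        · rw [← hAper]
          exact (h _ ⟨by linarith [hs.1], by linarith⟩).le
        · rw [h1, hA0]
        · exact (h _ ⟨h1, hs.2⟩).le
    linarith
  obtain ⟨s, hs0, hs1, hs⟩ := hzero
  set ψ : Circ := φ + (s : Circ) with hψ
  have hψφ : ψ ≠ φ := by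
    intro h
    exact coe_ne_zero hs0 hs1 (by simpa [hψ] using h)
  have hγne : B.γ ψ ≠ B.γ φ := fun h => hψφ (B.injective h)
  set u := B.γ ψ - B.γ φ with hu
  set t : ℝ := v.re * u.re + v.im * u.im with ht
  have hs' : v.re * u.im - v.im * u.re = 0 := hs
  have hut : u = t * v := by
    apply Complex.ext
    · simp [ht]
      linear_combination (-u.re) * hvsq - v.im * hs'
    · simp [ht]
      linear_combination (-u.im) * hvsq + v.re * hs'
  have htpos : 0 < t := by
    have h1 := B.cross_pos φ (B.mem ψ) hγne
    rw [← hu, ← hτ, hut] at h1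
    have h2 : cross τ (t * v) = t * Real.sin θ := by
      rw [← hτv]
      simp [cross]
      ring
    rw [h2] at h1
    exact pos_of_mul_pos_left h1 hsin.le
  set w := circDeriv B.γ ψ with hw
  have hw1 : ‖w‖ = 1 := B.unit_speed ψ
  have hvw : 0 < cross v w := by
    have h1 := B.cross_pos ψ (B.mem φ) hγne.symm
    have h2 : B.γ φ - B.γ ψ = -(t * v) := by
      rw [← hut]
      simp [hu]
    rw [h2, ← hw] at h1
    have h3 : cross w (-(t * v)) = t * cross v w := by
      simp [cross]
      ring
    rw [h3] at h1
    exact pos_of_mul_pos_right h1 htpos.le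
  have hv0 : v ≠ 0 := by
    intro h
    simp [h] at hv1
  have hq : w / v = Complex.exp ((Complex.arg (w / v) : ℝ) * Complex.I) := by
    have h1 := Complex.norm_mul_exp_arg_mul_I (w / v)
    rw [norm_div, hw1, hv1] at h1
    simpa using h1.symm
  have him : 0 < (w / v).im := by
    have hn : Complex.normSq v = 1 := by
      rw [Complex.normSq_apply]
      exact hvsq
    rw [Complex.div_im, hn]
    simp only [cross] at hvw
    linarith
  have harg : Complex.arg (w / v) ∈ Set.Ioo 0 Real.pi := by
    constructor
    · rcases (Complex.arg_nonneg_iff.2 him.le).eq_or_lt with h | h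
      · have := (Complex.arg_eq_zero_iff.1 h.symm).2
        linarith
      · exact h
    · exact Complex.arg_lt_pi_iff.2 (Or.inr him.ne')
  refine ⟨(ψ, ⟨Complex.arg (w / v), harg⟩), ⟨⟨t, htpos, ?_⟩, ?_⟩, ?_⟩
  · change B.γ ψ = B.γ φ + t * v
    rw [← hut, hu]
    ring
  · change v = Complex.exp (-(Complex.arg (w / v) : ℝ) * Complex.I) * w
    have h1 : w = Complex.exp ((Complex.arg (w / v) : ℝ) * Complex.I) * v := by
      rw [← hq]
      field_simp
    have h2 : Complex.exp (-(Complex.arg (w / v) : ℝ) * Complex.I) *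
        Complex.exp ((Complex.arg (w / v) : ℝ) * Complex.I) = 1 := by
      rw [← Complex.exp_add]
      simp
    calc v = 1 * v := (one_mul v).symm
      _ = _ := by rw [← h2, mul_assoc, ← h1]
  · rintro ⟨ψ', θ', hθ'⟩ ⟨⟨t', ht', h1⟩, h2⟩
    change B.γ ψ' = B.γ φ + t' * v at h1
    change v = Complex.exp (-(θ' : ℝ) * Complex.I) * circDeriv B.γ ψ' at h2
    have h3 : B.γ ψ = B.γ φ + t * v := by
      rw [← hut, hu]
      ring
    have hlt : ∀ (a b : ℝ) (α β : Circ), 0 < a → a < b → B.γ α = B.γ φ + a * v →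
        B.γ β = B.γ φ + b * v → False := by
      intro a b α β ha hab hα hβ
      have hb : 0 < b := ha.trans hab
      have hne : B.γ φ ≠ B.γ β := by
        intro h
        rw [hβ] at h
        have h5 : (b : ℂ) * v = 0 := by simpa using h.symm
        rcases mul_eq_zero.1 h5 with h6 | h6
        · exact hb.ne' (by exact_mod_cast h6)
        · exact hv0 h6
      have h7 := B.strictConvex (B.mem φ) (B.mem β) hne
        (a := 1 - a / b) (b := a / b)
        (by rw [sub_pos, div_lt_one hb]; exact hab) (div_pos ha hb) (by ring)
      have h8 : (1 - a / b) • B.γ φ + (a / b) • B.γ β = B.γ α := by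
        rw [hα, hβ]
        have hb' : (b : ℂ) ≠ 0 := by exact_mod_cast hb.ne'
        simp only [Complex.real_smul]
        push_cast
        field_simp
        ring
      have h9 : B.γ α ∈ interior B.Γ := h8 ▸ h7
      exact B.notMem_interior α h9
    have htt : t' = t := by
      rcases lt_trichotomy t' t with h | h | h
      · exact (hlt _ _ _ _ ht' h h1 h3).elim
      · exact h
      · exact (hlt _ _ _ _ htpos h h3 h1).elim
    have hψψ : ψ' = ψ := B.injective (by rw [h1, h3, htt])
    subst hψψ
    have h4 : w / v = Complex.exp ((θ' : ℝ) * Complex.I) := by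
      rw [h2, neg_mul, Complex.exp_neg, ← hw]
      have hw0 : w ≠ 0 := by
        intro h
        simp [h] at hw1
      field_simp
    have h5 : Complex.arg (w / v) = θ' := by
      rw [h4, Complex.arg_exp_mul_I, toIocMod_eq_self]
      exact ⟨by linarith [hθ'.1, Real.pi_pos], by linarith [hθ'.2]⟩
    ext1
    · rfl
    · exact Subtype.ext h5.symm

/-- The billiard map `T₁` of the phase annulus. -/
noncomputable def billiardMap (x : Phase) : Phase := (B.existsUnique_step x).choose

/-- The billiard map takes a phase point to the next one. -/
theorem billiardMap_spec (x : Phase) : IsBilliardStep B.γ x (B.billiardMap x) :=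
  (B.existsUnique_step x).choose_spec.1

end Table

/-- The passage `T₂ (φ, θ) = (φ + ℓ cot θ, θ)` along the side of a coin of height `ℓ`. -/
noncomputable def sideMap (ℓ : ℝ) (x : Phase) : Phase :=
  (x.1 + ((ℓ * Real.cot x.2 : ℝ) : Circ), x.2)

/-- The coin map `T = T₂ ∘ T₁`. -/
noncomputable def coinMap (B : Table) (ℓ : ℝ) : Phase → Phase := sideMap ℓ ∘ B.billiardMap

/-- An essential curve: a simple closed curve in the open phase annulus which is not homotopic
to a point there. -/
def IsEssentialCurve (C : Set Phase) : Prop :=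
  ∃ c : C(Circ, Phase), Function.Injective c ∧ ¬ c.Nullhomotopic ∧ Set.range c = C

/-- An essential curve which the coin map maps onto itself. -/
def IsEssentialInvariantCurve (B : Table) (ℓ : ℝ) (C : Set Phase) : Prop :=
  IsEssentialCurve C ∧ coinMap B ℓ '' C = C

/-- The two strips of width `δ` at the ends of the phase annulus. -/
def boundaryStrips (δ : ℝ) : Set Phase :=
  {x | (x.2 : ℝ) < δ ∨ Real.pi - δ < (x.2 : ℝ)}

end Coin

/-! In the coordinates `φ` and `u = cot θ` the passage along the side is the shear `(φ, u) ↦ (φ + ℓ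
u, u)`, and a short chord changes `u` by `2/3 ρ'(φ)`, up to an error proportional to its length
(`exists_cotIn_sub_cotOut`). High up in the lift to the plane, the coin map `T` is therefore close
to a shear to the right. For a point over `x` the first coordinates of its images under `T` and
`T⁻¹` add up to nearly `S x = 2 x + 2/3 ℓ ρ'(x)`, whatever its height (`exists_billiardLift`). On an
invariant graph both maps would preserve the horizontal order, so `S` could not drop; but `S' = 2 +
2/3 ℓ ρ''` is negative somewhere once `ℓ > -3 / min ρ''`.

Birkhoff's theorem does not supply the graph: the billiard map twists against the shear, so `T` is
known to be a twist map only near the end of the annulus, and a curve that comes near this end might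
also go far from it. Birkhoff's argument is run instead on the set `V` of free points, which have
nothing of the invariant set `K` at or above them. If `K` reaches far up, then all free points lie
high (`Free.height_lt`). Being free means being accessible from the right and from the left
(`free_of_rightAcc`); as long as images stay high, `T` preserves accessibility from the right
(`RightAcc.map`) and `T⁻¹` that from the left.

Forward and backward images of free points cannot both sink. Otherwise images of vertical rays would
contain a right accessible arc leading up to the right and a left accessible arc leading up to the
left; after a translation by periods these meet, in a free point that lies too low
(`iterate_im_dichotomy`). Hence, in one of the two time directions, an orbit that leaves `V` never
comes back to `V` (`free_iterate_dichotomy`). Since `T` preserves the finite measure `sin θ dθ dφ`,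
Poincaré recurrence shows that `V` and `T⁻¹ V` agree up to null sets (`measure_fold_eq_zero`).

If `S` drops, however, `T` or `T⁻¹` reverses the order of two topmost points of `K`, and this fold
produces a nonempty open set of points on which exactly one of `z` and `T z` is free
(`exists_fold_of_sum`). So the height of invariant bands is bounded (`exists_height_bound`). The
other end of the annulus is reached by time reversal. Finally `min ρ'' < 0`, since otherwise the
periodic function `ρ'` would be monotone, hence zero, and the boundary a circle. -/

namespace Coin

/-! ### Angles of plane vectors -/

/-- `θ` is an angle of the vector `v`. -/
def IsAngle (v : ℂ) (θ : ℝ) : Prop := v = ‖v‖ * Complex.exp (θ * Complex.I)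

namespace IsAngle

variable {v w : ℂ} {θ θ' : ℝ}

theorem re_eq (h : IsAngle v θ) : v.re = ‖v‖ * Real.cos θ := by
  conv_lhs => rw [h]
  rw [Complex.re_ofReal_mul, Complex.exp_ofReal_mul_I_re]

theorem im_eq (h : IsAngle v θ) : v.im = ‖v‖ * Real.sin θ := by
  conv_lhs => rw [h]
  rw [Complex.im_ofReal_mul, Complex.exp_ofReal_mul_I_im]

theorem of_eq {r : ℝ} (hr : 0 ≤ r) (h : v = r * Complex.exp (θ * Complex.I)) : IsAngle v θ := by
  have : ‖v‖ = r := by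
    rw [h, norm_mul, Complex.norm_exp_ofReal_mul_I, Complex.norm_real, mul_one,
      Real.norm_of_nonneg hr]
  rw [IsAngle, this, ← h]

theorem arg (v : ℂ) : IsAngle v v.arg := (Complex.norm_mul_exp_arg_mul_I v).symm

theorem add_arg (h : IsAngle v θ) (hv : v ≠ 0) : IsAngle w (θ + (w / v).arg) := by
  have h1 := arg (w / v)
  refine of_eq (norm_nonneg w) ?_
  have h2 : w = v * (w / v) := by field_simp
  have h3 : (‖v‖ : ℂ) * ‖w / v‖ = ‖w‖ := by
    rw [← Complex.ofReal_mul, ← norm_mul, ← h2]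
  calc w = v * (w / v) := h2
    _ = (‖v‖ * Complex.exp (θ * Complex.I)) *
        (‖w / v‖ * Complex.exp ((w / v).arg * Complex.I)) := by rw [← h, ← h1]
    _ = (‖v‖ * ‖w / v‖) * (Complex.exp (θ * Complex.I) *
        Complex.exp ((w / v).arg * Complex.I)) := by ring
    _ = _ := by rw [h3, ← Complex.exp_add]; push_cast; ring_nf

theorem mul_I (h : IsAngle v θ) : IsAngle (Complex.I * v) (θ + Real.pi / 2) := by
  refine of_eq (norm_nonneg v) ?_
  have h1 : Complex.exp ((Real.pi / 2 : ℝ) * Complex.I) = Complex.I := by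
    push_cast
    rw [Complex.exp_pi_div_two_mul_I]
  rw [Complex.ofReal_add, add_mul, Complex.exp_add, h1]
  conv_lhs => rw [h]
  ring

theorem reflect (h : IsAngle v θ) : IsAngle (-(starRingEnd ℂ v)) (Real.pi - θ) := by
  refine of_eq (norm_nonneg v) ?_
  apply Complex.ext
  · rw [Complex.re_ofReal_mul, Complex.exp_ofReal_mul_I_re, Real.cos_pi_sub]
    simp [h.re_eq]
  · rw [Complex.im_ofReal_mul, Complex.exp_ofReal_mul_I_im, Real.sin_pi_sub]
    simp [h.im_eq]

theorem sub_two_pi (h : IsAngle v θ) (n : ℤ) : IsAngle v (θ + n * (2 * Real.pi)) := by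
  refine of_eq (norm_nonneg v) ?_
  have : Complex.exp ((θ + n * (2 * Real.pi) : ℝ) * Complex.I) = Complex.exp (θ * Complex.I) := by
    rw [Complex.exp_eq_exp_iff_exists_int]
    exact ⟨n, by push_cast; ring⟩
  rw [this]
  exact h

theorem eq_add (h : IsAngle v θ) (h' : IsAngle v θ') (hv : v ≠ 0) :
    ∃ n : ℤ, θ' = θ + n * (2 * Real.pi) := by
  have h1 : (‖v‖ : ℂ) ≠ 0 := by simpa using hv
  have h2 : Complex.exp (θ' * Complex.I) = Complex.exp (θ * Complex.I) := by
    have : (‖v‖ : ℂ) * Complex.exp (θ' * Complex.I) = ‖v‖ * Complex.exp (θ * Complex.I) := by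
      rw [← h, ← h']
    exact mul_left_cancel₀ h1 this
  obtain ⟨n, hn⟩ := Complex.exp_eq_exp_iff_exists_int.1 h2
  refine ⟨n, ?_⟩
  have h3 : ((θ' : ℂ)) * Complex.I = (θ + n * (2 * Real.pi)) * Complex.I := by rw [hn]; ring
  exact_mod_cast mul_right_cancel₀ Complex.I_ne_zero h3

theorem cos_pos (h : IsAngle v θ) (hv : 0 < v.re) : 0 < Real.cos θ := by
  rw [h.re_eq] at hv
  exact pos_of_mul_pos_right hv (norm_nonneg _)

theorem cos_neg (h : IsAngle v θ) (hv : v.re < 0) : Real.cos θ < 0 := by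
  rw [h.re_eq] at hv
  exact neg_of_mul_neg_right hv (norm_nonneg _)

theorem sin_pos (h : IsAngle v θ) (hv : 0 < v.im) : 0 < Real.sin θ := by
  rw [h.im_eq] at hv
  exact pos_of_mul_pos_right hv (norm_nonneg _)

theorem sin_neg (h : IsAngle v θ) (hv : v.im < 0) : Real.sin θ < 0 := by
  rw [h.im_eq] at hv
  exact neg_of_mul_neg_right hv (norm_nonneg _)

theorem of_up (h : v.re = 0) (h' : 0 < v.im) : IsAngle v (Real.pi / 2) := by
  refine of_eq h'.le ?_
  push_cast
  rw [Complex.exp_pi_div_two_mul_I]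
  apply Complex.ext <;> simp [h]

end IsAngle

/-- Two angles that differ by less than `π` and lie on the same side of a line through the origin
lie in the same half turn. -/
theorem half_turn {θ θ' c : ℝ} (h : |θ - c| ≤ Real.pi / 2) (h' : |θ' - θ| < Real.pi)
    (hc : 0 < Real.cos (θ' - c)) : |θ' - c| < Real.pi / 2 := by
  rw [abs_le] at h
  rw [abs_lt] at h' ⊢
  constructor
  · by_contra hcon
    push Not at hcon
    have := Real.cos_nonpos_of_pi_div_two_le_of_le (x := -(θ' - c)) (by linarith)
      (by linarith)
    rw [Real.cos_neg] at this
    linarith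
  · by_contra hcon
    push Not at hcon
    have := Real.cos_nonpos_of_pi_div_two_le_of_le (x := θ' - c) (by linarith)
      (by linarith)
    linarith

/-! ### Continuous angles and paths that must meet -/

section lifting

variable {X : Type*} [TopologicalSpace X] [LocallyPathConnectedSpace X] [SimplyConnectedSpace X]

/-- A nowhere vanishing plane vector field on a simply connected space has a continuous angle. -/
theorem exists_continuous_angle {f : X → ℂ} (hf : Continuous f) (h0 : ∀ x, f x ≠ 0) :
    ∃ Θ : X → ℝ, Continuous Θ ∧ ∀ x, IsAngle (f x) (Θ x) := by
  obtain ⟨x₀⟩ : Nonempty X := inferInstance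
  obtain ⟨F, ⟨-, hF⟩, -⟩ := Complex.isCoveringMapOn_exp.existsUnique_continuousMap_lifts
    (⟨f, hf⟩ : C(X, ℂ)) (Complex.exp_log (h0 x₀)) (fun x => h0 x)
  refine ⟨fun x => (F x).im, Complex.continuous_im.comp F.continuous, fun x => ?_⟩
  have h1 : Complex.exp (F x) = f x := congrFun hF x
  refine IsAngle.of_eq (Real.exp_pos (F x).re).le ?_
  rw [← h1, Complex.ofReal_exp, ← Complex.exp_add, Complex.re_add_im]

end lifting

/-- The intermediate value theorem in the form used for continuous angles: a value that is never
taken is never passed. -/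
theorem lt_of_continuousOn_ne {S : Set ℝ} (hS : IsPreconnected S) {f : ℝ → ℝ}
    (hf : ContinuousOn f S) {c s₀ : ℝ} (hs₀ : s₀ ∈ S) (h0 : f s₀ < c) (hne : ∀ s ∈ S, f s ≠ c) :
    ∀ s ∈ S, f s < c := by
  intro s hs
  by_contra hcon
  push Not at hcon
  obtain ⟨t, ht, ht'⟩ := hS.intermediate_value hs₀ hs hf ⟨h0.le, hcon⟩
  exact hne t ht ht'

theorem gt_of_continuousOn_ne {S : Set ℝ} (hS : IsPreconnected S) {f : ℝ → ℝ}
    (hf : ContinuousOn f S) {c s₀ : ℝ} (hs₀ : s₀ ∈ S) (h0 : c < f s₀) (hne : ∀ s ∈ S, f s ≠ c) :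
    ∀ s ∈ S, c < f s := by
  intro s hs
  by_contra hcon
  push Not at hcon
  obtain ⟨t, ht, ht'⟩ := hS.intermediate_value hs hs₀ hf ⟨hcon, h0.le⟩
  exact hne t ht ht'

/-- An angle that starts in `[0, π]` and has nonnegative sine stays there. -/
theorem mem_Icc_of_sin_nonneg {a b : ℝ} (hab : a ≤ b) {f : ℝ → ℝ} (hf : ContinuousOn f (Set.Icc a b))
    (h0 : 0 ≤ f a) (h1 : f a ≤ Real.pi) (hs : ∀ t ∈ Set.Icc a b, 0 ≤ Real.sin (f t)) :
    0 ≤ f b ∧ f b ≤ Real.pi := by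
  have hpi := Real.pi_pos
  constructor
  · by_contra hcon
    push Not at hcon
    -- Clamping at `-π/2` keeps the value in `(-π, 0)`, where the sine is negative, even if `f b`
    -- lies far below.
    have hm : max (f b) (-(Real.pi / 2)) ∈ Set.Icc (f b) (f a) :=
      ⟨le_max_left _ _, max_le (by linarith) (by linarith)⟩
    obtain ⟨t, ht, ht'⟩ := isPreconnected_Icc.intermediate_value
      (Set.right_mem_Icc.2 hab) (Set.left_mem_Icc.2 hab) hf hm
    have h2 := hs t ht
    rw [ht'] at h2
    have h3 : max (f b) (-(Real.pi / 2)) < 0 := max_lt hcon (by linarith)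
    have h4 := Real.sin_neg_of_neg_of_neg_pi_lt h3
      (lt_of_lt_of_le (by linarith) (le_max_right _ _))
    linarith
  · by_contra hcon
    push Not at hcon
    have hm : min (f b) (Real.pi + Real.pi / 2) ∈ Set.Icc (f a) (f b) :=
      ⟨le_min (by linarith) (by linarith), min_le_left _ _⟩
    obtain ⟨t, ht, ht'⟩ := isPreconnected_Icc.intermediate_value
      (Set.left_mem_Icc.2 hab) (Set.right_mem_Icc.2 hab) hf hm
    have h2 := hs t ht
    rw [ht'] at h2
    have h3 : Real.pi < min (f b) (Real.pi + Real.pi / 2) := lt_min hcon (by linarith)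
    have h4 := Real.sin_pos_of_pos_of_lt_pi (x := min (f b) (Real.pi + Real.pi / 2) - Real.pi)
      (by linarith) (by linarith [min_le_right (f b) (Real.pi + Real.pi / 2)])
    rw [Real.sin_sub_pi] at h4
    linarith

/-- Two paths which cross a horizontal strip and whose ends are interchanged meet. -/
theorem exists_eq_of_cross {α β : ℝ → ℂ} {a b a' b' m M : ℝ} (hab : a ≤ b) (hab' : a' ≤ b')
    (hα : ContinuousOn α (Set.Icc a b)) (hβ : ContinuousOn β (Set.Icc a' b'))
    (hαm : ∀ s ∈ Set.Icc a b, m ≤ (α s).im ∧ (α s).im ≤ M)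
    (hβm : ∀ s ∈ Set.Icc a' b', m ≤ (β s).im ∧ (β s).im ≤ M)
    (ha : (α a).im = m) (ha' : (β a').im = m) (hb : (α b).im = M) (hb' : (β b').im = M)
    (h0 : (α a).re < (β a').re) (h1 : (β b').re < (α b).re) :
    ∃ s ∈ Set.Icc a b, ∃ t ∈ Set.Icc a' b', α s = β t := by
  by_contra hcon
  push Not at hcon
  -- Clamped parameters turn the difference of the paths into a nowhere zero field on all of `ℝ ×
  -- ℝ`, which is simply connected. Its angle is followed along the two ways around the rectangle
  -- from `(a, a')` to `(b, b')`: on one way the difference never points downwards, on the other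
  -- never upwards.
  set p : ℝ → Set.Icc a b := Set.projIcc a b hab with hp
  set q : ℝ → Set.Icc a' b' := Set.projIcc a' b' hab' with hq
  have hcα : Continuous fun s : ℝ => α (p s) :=
    hα.comp_continuous (continuous_subtype_val.comp continuous_projIcc) fun s => (p s).2
  have hcβ : Continuous fun s : ℝ => β (q s) :=
    hβ.comp_continuous (continuous_subtype_val.comp continuous_projIcc) fun s => (q s).2
  obtain ⟨Θ, hΘ, hang⟩ := exists_continuous_angle (X := ℝ × ℝ)
    (f := fun x => α (p x.1) - β (q x.2))
    ((hcα.comp continuous_fst).sub (hcβ.comp continuous_snd))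
    (fun x => sub_ne_zero.2 (hcon _ (p x.1).2 _ (q x.2).2))
  have hpa : (p a : ℝ) = a := by rw [hp, Set.projIcc_left]
  have hpb : (p b : ℝ) = b := by rw [hp, Set.projIcc_right]
  have hqa : (q a' : ℝ) = a' := by rw [hq, Set.projIcc_left]
  have hqb : (q b' : ℝ) = b' := by rw [hq, Set.projIcc_right]
  -- the angle at the first corner is an odd multiple of `π`
  have hang' : ∀ s t, ∃ N : ℝ, 0 < N ∧ (α (p s)).re - (β (q t)).re = N * Real.cos (Θ (s, t)) ∧
      (α (p s)).im - (β (q t)).im = N * Real.sin (Θ (s, t)) := by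
    intro s t
    refine ⟨‖α (p s) - β (q t)‖, norm_pos_iff.2 (sub_ne_zero.2 (hcon _ (p s).2 _ (q t).2)), ?_, ?_⟩
    · have := (hang (s, t)).re_eq
      simpa using this
    · have := (hang (s, t)).im_eq
      simpa using this
  have hcorner : Real.sin (Θ (a, a')) = 0 ∧ Real.cos (Θ (a, a')) < 0 := by
    obtain ⟨N, hN, h2, h3⟩ := hang' a a'
    rw [hpa, hqa] at h2 h3
    constructor
    · have h4 : N * Real.sin (Θ (a, a')) = 0 := by rw [← h3, ha, ha']; ring
      exact (mul_eq_zero.1 h4).resolve_left hN.ne'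
    · by_contra hc
      push Not at hc
      nlinarith [mul_nonneg hN.le hc]
  have hcorner' : 0 < Real.cos (Θ (b, b')) := by
    obtain ⟨N, hN, h2, h3⟩ := hang' b b'
    rw [hpb, hqb] at h2
    by_contra hc
    push Not at hc
    nlinarith [mul_nonneg_of_nonpos_of_nonpos (neg_nonpos.2 hN.le) hc]
  have hsinb : Real.sin (Θ (b, b')) = 0 := by
    obtain ⟨N, hN, h2, h3⟩ := hang' b b'
    rw [hpb, hqb] at h3
    have h4 : N * Real.sin (Θ (b, b')) = 0 := by rw [← h3, hb, hb']; ring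
    exact (mul_eq_zero.1 h4).resolve_left hN.ne'
  obtain ⟨n, hn⟩ := Real.sin_eq_zero_iff.1 hcorner.1
  -- normalise the angle so that it is `π` at the first corner
  set Ψ : ℝ × ℝ → ℝ := fun x => Θ x - Θ (a, a') + Real.pi with hΨ
  have hΨc : Continuous Ψ := (hΘ.sub continuous_const).add continuous_const
  have hshift : ∀ x, Real.sin (Ψ x) = Real.sin (Θ x) ∧ Real.cos (Ψ x) = Real.cos (Θ x) := by
    have hc1 : Real.cos (Θ (a, a')) = -1 := by
      have h5 := Real.sin_sq_add_cos_sq (Θ (a, a'))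
      rw [hcorner.1] at h5
      have h6 : (Real.cos (Θ (a, a')) - 1) * (Real.cos (Θ (a, a')) + 1) = 0 := by linarith
      rcases mul_eq_zero.1 h6 with h | h
      · linarith [hcorner.2]
      · linarith
    intro x
    simp only [hΨ]
    rw [Real.sin_add_pi, Real.cos_add_pi, Real.sin_sub, Real.cos_sub, hcorner.1, hc1]
    constructor <;> ring
  have hΨa : Ψ (a, a') = Real.pi := by simp [hΨ]
  have hpi := Real.pi_pos
  have e1 := mem_Icc_of_sin_nonneg (f := fun s => Ψ (s, a')) hab (by fun_prop)
    (by simp only [hΨa]; positivity) (by simp only [hΨa]; exact le_rfl) (by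
      intro s hs
      rw [(hshift _).1]
      obtain ⟨N, hN, h2, h3⟩ := hang' s a'
      rw [hqa, ha'] at h3
      exact nonneg_of_mul_nonneg_right (by linarith [(hαm _ (p s).2).1]) hN)
  have e2 := mem_Icc_of_sin_nonneg (f := fun t => Ψ (b, t)) hab' (by fun_prop) e1.1 e1.2 (by
      intro t ht
      rw [(hshift _).1]
      obtain ⟨N, hN, h2, h3⟩ := hang' b t
      rw [hpb, hb] at h3
      exact nonneg_of_mul_nonneg_right (by linarith [(hβm _ (q t).2).2]) hN)
  have e3 := mem_Icc_of_sin_nonneg (f := fun t => Ψ (a, t) - Real.pi) hab' (by fun_prop)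
    (by simp only [hΨa]; linarith) (by simp only [hΨa]; linarith) (by
      intro t ht
      rw [Real.sin_sub_pi, (hshift _).1]
      obtain ⟨N, hN, h2, h3⟩ := hang' a t
      rw [hpa, ha] at h3
      have : 0 ≤ N * (-Real.sin (Θ (a, t))) := by linarith [(hβm _ (q t).2).1]
      exact nonneg_of_mul_nonneg_right this hN)
  have e4 := mem_Icc_of_sin_nonneg (f := fun s => Ψ (s, b') - Real.pi) hab (by fun_prop) e3.1 e3.2
    (by
      intro s hs
      rw [Real.sin_sub_pi, (hshift _).1]
      obtain ⟨N, hN, h2, h3⟩ := hang' s b'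
      rw [hqb, hb'] at h3
      have : 0 ≤ N * (-Real.sin (Θ (s, b'))) := by linarith [(hαm _ (p s).2).2]
      exact nonneg_of_mul_nonneg_right this hN)
  -- One way bounds the final angle above by `π`, the other bounds it below by `π`. The difference
  -- would thus point west at the corner where it points east.
  have e5 : Ψ (b, b') = Real.pi := le_antisymm e2.2 (by linarith [e4.1])
  have e6 := (hshift (b, b')).2
  rw [e5, Real.cos_pi] at e6
  linarith

end Coin

namespace Coin

open Filter Topology

/-! ### Twist maps of the plane near the upper end -/

/-- A plane homeomorphism which twists vertical lines to the right above the height `k`, where it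
is close to a shear. The function `Δ` measures the turn of the vector between two points. -/
structure TwistLift (T : ℂ ≃ₜ ℂ) (Δ : ℂ → ℂ → ℝ) (k c ℓ : ℝ) : Prop where
  turn : ∀ p q θ, p ≠ q → IsAngle (q - p) θ → IsAngle (T q - T p) (θ + Δ p q)
  cont : ∀ p, ContinuousOn (Δ p) {p}ᶜ
  -- `turn` determines `Δ` only modulo `2π`; the bounds for far points select the branch at the ends
  -- of crossing paths.
  far_right : ∀ p q, 2 * Real.pi < (q - p).re → 2 * Real.pi < (T q - T p).re → |Δ p q| < Real.pi
  far_left : ∀ p q, (q - p).re < -(2 * Real.pi) → (T q - T p).re < -(2 * Real.pi) →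
    |Δ p q| < Real.pi
  twist : ∀ p q, p ≠ q → p.re = q.re → k < p.im → k < q.im → -Real.pi < Δ p q ∧ Δ p q < 0
  twist' : ∀ p q, p ≠ q → (T p).re = (T q).re → k < (T p).im → k < (T q).im →
    -Real.pi < Δ p q ∧ Δ p q < 0
  -- The horizontal displacement is compared with the height before and after the step, because the
  -- mirrored inverse exchanges the two.
  near : ∀ z, k < z.im ∨ k < (T z).im → |(T z).im - z.im| ≤ c ∧
    |(T z).re - z.re - ℓ * z.im| ≤ c ∧ |(T z).re - z.re - ℓ * (T z).im| ≤ c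

/-- The reflection in the vertical axis. -/
noncomputable def mirror : ℂ ≃ₜ ℂ where
  toFun z := -(starRingEnd ℂ z)
  invFun z := -(starRingEnd ℂ z)
  left_inv z := by simp
  right_inv z := by simp
  continuous_toFun := by fun_prop
  continuous_invFun := by fun_prop

theorem mirror_apply (z : ℂ) : mirror z = -(starRingEnd ℂ z) := rfl

@[simp] theorem mirror_re (z : ℂ) : (mirror z).re = -z.re := by simp [mirror_apply]

@[simp] theorem mirror_im (z : ℂ) : (mirror z).im = z.im := by simp [mirror_apply]

@[simp] theorem mirror_mirror (z : ℂ) : mirror (mirror z) = z := by simp [mirror_apply]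

theorem mirror_sub (z w : ℂ) : mirror z - mirror w = mirror (z - w) := by
  simp [mirror_apply]
  ring

theorem IsAngle.mirror {v : ℂ} {θ : ℝ} (h : IsAngle v θ) :
    IsAngle (Coin.mirror v) (Real.pi - θ) := h.reflect

/-- The inverse of a homeomorphism, seen in a mirror. -/
noncomputable def mirrorInv (T : ℂ ≃ₜ ℂ) : ℂ ≃ₜ ℂ := mirror.trans (T.symm.trans mirror)

theorem mirrorInv_apply (T : ℂ ≃ₜ ℂ) (z : ℂ) : mirrorInv T z = mirror (T.symm (mirror z)) := rfl

/-- Inversion and reflection each change the sign of a turn, so the mirrored inverse is a twist map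
of the same kind. Every statement on forward images and right accessible points thereby has a twin
on backward images and left accessible points. -/
theorem TwistLift.mirrorInv {T : ℂ ≃ₜ ℂ} {Δ : ℂ → ℂ → ℝ} {k c ℓ : ℝ} (h : TwistLift T Δ k c ℓ) :
    TwistLift (mirrorInv T) (fun p q => Δ (T.symm (mirror p)) (T.symm (mirror q))) k c ℓ where
  turn p q θ hpq hθ := by
    set a := T.symm (mirror p) with ha
    set b := T.symm (mirror q) with hb
    have hab : a ≠ b := fun h' => hpq (mirror.injective (T.symm.injective h'))
    have h0 : b - a ≠ 0 := sub_ne_zero.2 hab.symm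
    have h1 := h.turn a b _ hab (IsAngle.arg (b - a))
    have h2 : T b - T a = mirror (q - p) := by
      simp [ha, hb, mirror_sub]
    rw [h2] at h1
    obtain ⟨n, hn⟩ := h1.eq_add hθ.mirror (by
      rw [← h2]
      exact sub_ne_zero.2 fun h' => hab (T.injective h'.symm))
    have h3 := ((IsAngle.arg (b - a)).mirror).sub_two_pi (-n)
    have h4 : Real.pi - (b - a).arg + ((-n : ℤ) : ℝ) * (2 * Real.pi) = θ + Δ a b := by
      push_cast
      linarith
    rw [h4] at h3
    rw [mirrorInv_apply, mirrorInv_apply, mirror_sub]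
    exact h3
  cont p := by
    refine (h.cont (T.symm (mirror p))).comp
      (T.symm.continuous.comp mirror.continuous).continuousOn fun q hq h' => ?_
    exact hq (mirror.injective (T.symm.injective h'))
  far_right p q h1 h2 := by
    apply h.far_left
    · simp [mirrorInv_apply] at h2 ⊢
      linarith
    · simp at h1 ⊢
      linarith
  far_left p q h1 h2 := by
    apply h.far_right
    · simp [mirrorInv_apply] at h2 ⊢
      linarith
    · simp at h1 ⊢
      linarith
  twist p q hpq h1 h2 h3 := by
    apply h.twist'
    · exact fun h' => hpq (mirror.injective (T.symm.injective h'))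
    · simp [h1]
    · simpa using h2
    · simpa using h3
  twist' p q hpq h1 h2 h3 := by
    apply h.twist
    · exact fun h' => hpq (mirror.injective (T.symm.injective h'))
    · simpa [mirrorInv_apply] using h1
    · simpa [mirrorInv_apply] using h2
    · simpa [mirrorInv_apply] using h3
  near z hz := by
    obtain ⟨h1, h2, h3⟩ := h.near (T.symm (mirror z)) (by simpa [mirrorInv_apply, or_comm] using hz)
    simp [mirrorInv_apply] at h1 h2 h3 ⊢
    refine ⟨by rwa [abs_sub_comm], ?_, ?_⟩
    · convert h3 using 2
      ring
    · convert h2 using 2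
      ring

/-- The paths in `K` from the left end of the plane to the right end. -/
def Crossing (K : Set ℂ) : Set (ℝ → ℂ) :=
  {e | Continuous e ∧ (∀ t, e t ∈ K) ∧ Tendsto (fun t => (e t).re) atBot atBot ∧
    Tendsto (fun t => (e t).re) atTop atTop}

/-- A closed invariant periodic set below the height `N`, covered by crossing paths. -/
structure InvariantBand (T : ℂ ≃ₜ ℂ) (K : Set ℂ) (N D : ℝ) : Prop where
  closed : IsClosed K
  inv : ∀ z, T z ∈ K ↔ z ∈ K
  le : ∀ z ∈ K, z.im ≤ N
  periodic : ∀ (n : ℤ) (z : ℂ), z + n * (2 * Real.pi) ∈ K ↔ z ∈ K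
  map_add : ∀ (n : ℤ) (z : ℂ), T (z + n * (2 * Real.pi)) = T z + n * (2 * Real.pi)
  disp : ∀ z ∈ K, |(T z).re - z.re| ≤ D
  cross : ∀ z ∈ K, ∃ e ∈ Crossing K, ∃ t, e t = z

theorem mirror_mem_crossing {K : Set ℂ} {e : ℝ → ℂ} (he : e ∈ Crossing K) :
    (fun t => mirror (e (-t))) ∈ Crossing (mirror ⁻¹' K) := by
  obtain ⟨h1, h2, h3, h4⟩ := he
  refine ⟨mirror.continuous.comp (h1.comp continuous_neg), fun t => ?_, ?_, ?_⟩
  · simpa using h2 (-t)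
  · simp only [mirror_re]
    exact tendsto_neg_atTop_atBot.comp (h4.comp tendsto_neg_atBot_atTop)
  · simp only [mirror_re]
    exact tendsto_neg_atBot_atTop.comp (h3.comp tendsto_neg_atTop_atBot)

section band

variable {T : ℂ ≃ₜ ℂ} {K : Set ℂ} {N D : ℝ}

theorem InvariantBand.symm_mem (hK : InvariantBand T K N D) (z : ℂ) : T.symm z ∈ K ↔ z ∈ K := by
  rw [← hK.inv, T.apply_symm_apply]

theorem InvariantBand.symm_map_add (hK : InvariantBand T K N D) (n : ℤ) (z : ℂ) :
    T.symm (z + n * (2 * Real.pi)) = T.symm z + n * (2 * Real.pi) := by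
  rw [T.symm_apply_eq, hK.map_add, T.apply_symm_apply]

theorem mirror_add_int (z : ℂ) (n : ℤ) :
    mirror (z + n * (2 * Real.pi)) = mirror z + ((-n : ℤ) : ℂ) * (2 * Real.pi) := by
  apply Complex.ext <;> simp [mirror_apply]
  ring

theorem InvariantBand.mirrorInv (hK : InvariantBand T K N D) :
    InvariantBand (mirrorInv T) (mirror ⁻¹' K) N D where
  closed := hK.closed.preimage mirror.continuous
  inv z := by simp [mirrorInv_apply, hK.symm_mem]
  le z hz := by simpa using hK.le _ hz
  periodic n z := by
    rw [Set.mem_preimage, Set.mem_preimage, mirror_add_int, hK.periodic]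
  map_add n z := by
    rw [mirrorInv_apply, mirrorInv_apply, mirror_add_int, hK.symm_map_add, mirror_add_int]
    simp
  disp z hz := by
    have := hK.disp (T.symm (mirror z)) ((hK.symm_mem _).2 hz)
    simp [mirrorInv_apply] at this ⊢
    convert this using 2
    ring
  cross z hz := by
    obtain ⟨e, he, t, ht⟩ := hK.cross _ hz
    exact ⟨_, (mirror_mem_crossing he), -t, by simp [ht]⟩

theorem InvariantBand.comp_mem (hK : InvariantBand T K N D) {e : ℝ → ℂ} (he : e ∈ Crossing K) :
    (fun t => T (e t)) ∈ Crossing K := by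
  obtain ⟨h1, h2, h3, h4⟩ := he
  refine ⟨T.continuous.comp h1, fun t => (hK.inv _).2 (h2 t), ?_, ?_⟩
  · refine tendsto_atBot_mono (fun t => ?_) (tendsto_atBot_add_const_right _ D h3)
    have := abs_le.1 (hK.disp _ (h2 t))
    simp only
    linarith
  · refine tendsto_atTop_mono (fun t => ?_) (tendsto_atTop_add_const_right _ (-D) h4)
    have := abs_le.1 (hK.disp _ (h2 t))
    simp only
    linarith

theorem InvariantBand.symm_comp_mem (hK : InvariantBand T K N D) {e : ℝ → ℂ}
    (he : e ∈ Crossing K) : (fun t => T.symm (e t)) ∈ Crossing K := by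
  obtain ⟨h1, h2, h3, h4⟩ := he
  refine ⟨T.symm.continuous.comp h1, fun t => (hK.symm_mem _).2 (h2 t), ?_, ?_⟩
  · refine tendsto_atBot_mono (fun t => ?_) (tendsto_atBot_add_const_right _ D h3)
    have := abs_le.1 (hK.disp _ ((hK.symm_mem _).2 (h2 t)))
    rw [T.apply_symm_apply] at this
    simp only
    linarith
  · refine tendsto_atTop_mono (fun t => ?_) (tendsto_atTop_add_const_right _ (-D) h4)
    have := abs_le.1 (hK.disp _ ((hK.symm_mem _).2 (h2 t)))
    rw [T.apply_symm_apply] at this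
    simp only
    linarith

end band

/-! ### Free points and accessible points -/

/-- No point of `K` lies at or above `z` on the vertical line of `z`. -/
def Free (K : Set ℂ) (z : ℂ) : Prop := ∀ w ∈ K, w.re = z.re → w.im < z.im

theorem Free.notMem {K : Set ℂ} {z : ℂ} (h : Free K z) : z ∉ K := fun hz => (h z hz rfl).false

theorem Free.mirror {K : Set ℂ} {z : ℂ} (h : Free K z) :
    Free (Coin.mirror ⁻¹' K) (Coin.mirror z) := by
  intro w hw hre
  simpa using h _ hw (by simp [hre])

theorem Free.of_mirror {K : Set ℂ} {z : ℂ} (h : Free (Coin.mirror ⁻¹' K) (Coin.mirror z)) :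
    Free K z := by
  intro w hw hre
  simpa using h (Coin.mirror w) (by simpa using hw) (by simp [hre])

/-- The angle `Θ` of the path `e`, seen from `z`, is continuous and starts in the west, at `-π`. -/
structure IsView (z : ℂ) (e : ℝ → ℂ) (Θ : ℝ → ℝ) : Prop where
  cont : Continuous Θ
  angle : ∀ t, IsAngle (e t - z) (Θ t)
  west : ∀ᶠ t in atBot, |Θ t - -Real.pi| < Real.pi / 2

/-- The point `z` is accessible from the right of its vertical line: no path in `K` passes over it
from the right. -/
def RightAcc (K : Set ℂ) (z : ℂ) : Prop :=
  z ∉ K ∧ ∀ e ∈ Crossing K, ∃ Θ, IsView z e Θ ∧ (∀ᶠ t in atTop, |Θ t| < Real.pi / 2) ∧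
    ∀ t, Θ t < Real.pi / 2

section views

variable {K : Set ℂ} {z : ℂ} {e : ℝ → ℂ}

/-- The difference of two views is continuous, has values in `2π ℤ`, and is smaller than `π` where
both are within `π/2` of `-π`; so it vanishes. -/
theorem IsView.ext {Θ Θ' : ℝ → ℝ} (h : IsView z e Θ) (h' : IsView z e Θ') (hz : ∀ t, e t ≠ z) :
    Θ = Θ' := by
  have hpi := Real.pi_pos
  set f : ℝ → ℝ := fun t => Θ' t - Θ t with hf
  have hfc : Continuous f := h'.cont.sub h.cont
  have hint : ∀ t, ∃ n : ℤ, f t = n * (2 * Real.pi) := by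
    intro t
    obtain ⟨n, hn⟩ := (h.angle t).eq_add (h'.angle t) (sub_ne_zero.2 (hz t))
    exact ⟨n, by simp [hf, hn]⟩
  have hne : ∀ t, ∀ c : ℝ, |c| = Real.pi → f t ≠ c := by
    intro t c hc h1
    obtain ⟨n, hn⟩ := hint t
    rw [← h1, hn, abs_mul, abs_of_pos Real.two_pi_pos] at hc
    have h2 : |(n : ℝ)| * 2 = 1 := by
      have h3 : Real.pi * (|(n : ℝ)| * 2) = Real.pi * 1 := by linarith
      exact mul_left_cancel₀ hpi.ne' h3
    have h3 : |n| * 2 = 1 := by exact_mod_cast h2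
    omega
  obtain ⟨t₀, h1, h2⟩ := (h.west.and h'.west).exists
  rw [abs_lt] at h1 h2
  have h3 := lt_of_continuousOn_ne isPreconnected_univ hfc.continuousOn (Set.mem_univ t₀)
    (c := Real.pi) (by simp only [hf]; linarith) (fun t _ => hne t _ (abs_of_pos hpi))
  have h4 := gt_of_continuousOn_ne isPreconnected_univ hfc.continuousOn (Set.mem_univ t₀)
    (c := -Real.pi) (by simp only [hf]; linarith)
    (fun t _ => hne t _ (by rw [abs_neg, abs_of_pos hpi]))
  funext t
  obtain ⟨n, hn⟩ := hint t
  have h5 := h3 t trivial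
  have h6 := h4 t trivial
  rw [hn] at h5 h6
  have h7 : (n : ℝ) < 1 := by
    by_contra hc
    push Not at hc
    nlinarith
  have h8 : (-1 : ℝ) < n := by
    by_contra hc
    push Not at hc
    nlinarith
  have h9 : n = 0 := by
    have : n < 1 := by exact_mod_cast h7
    have : -1 < n := by exact_mod_cast h8
    omega
  rw [h9] at hn
  simp only [hf] at hn
  push_cast at hn
  linarith

/-- Seen from a free point, a crossing path stays on the other side of the upward direction. -/
theorem Free.exists_view (hz : Free K z) (he : e ∈ Crossing K) :
    ∃ Θ, IsView z e Θ ∧ (∀ᶠ t in atTop, |Θ t| < Real.pi / 2) ∧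
      ∀ t, -(3 * Real.pi / 2) < Θ t ∧ Θ t < Real.pi / 2 := by
  have hpi := Real.pi_pos
  obtain ⟨h1, h2, h3, h4⟩ := he
  have hne : ∀ t, e t - z ≠ 0 := fun t h =>
    hz.notMem (sub_eq_zero.1 h ▸ h2 t)
  obtain ⟨Θ₀, hΘ₀, hang₀⟩ := exists_continuous_angle (h1.sub continuous_const) hne
  have hw : ∀ᶠ t in atBot, (e t - z).re < 0 := by
    filter_upwards [h3.eventually_lt_atBot z.re] with t ht
    simpa using ht
  have he : ∀ᶠ t in atTop, 0 < (e t - z).re := by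
    filter_upwards [h4.eventually_gt_atTop z.re] with t ht
    simpa using ht
  obtain ⟨t₀, ht₀⟩ := hw.exists
  -- The upward directions `-3π/2` and `π/2` are never taken, so an angle placed between them at one
  -- parameter stays between them.
  obtain ⟨n, hn, -⟩ := existsUnique_add_zsmul_mem_Ioc Real.two_pi_pos (Θ₀ t₀) (-(3 * Real.pi / 2))
  rw [zsmul_eq_mul] at hn
  have hang : ∀ t, IsAngle (e t - z) (Θ₀ t + n * (2 * Real.pi)) := fun t => (hang₀ t).sub_two_pi n
  have hup : ∀ t, ∀ c, Real.cos c = 0 → Real.sin c = 1 → Θ₀ t + n * (2 * Real.pi) ≠ c := by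
    intro t c hc hs h
    have h5 := hang t
    rw [h] at h5
    have h6 := h5.re_eq
    have h7 := h5.im_eq
    rw [hc, mul_zero] at h6
    rw [hs, mul_one] at h7
    have h8 := hz _ (h2 t) (by simpa [sub_eq_zero] using h6)
    have h9 := norm_nonneg (e t - z)
    rw [← h7] at h9
    simp at h9
    linarith
  have hs3 : Real.sin (-(3 * Real.pi / 2)) = 1 := by
    rw [show -(3 * Real.pi / 2) = Real.pi / 2 - 2 * Real.pi by ring, Real.sin_sub_two_pi,
      Real.sin_pi_div_two]
  have hc3 : Real.cos (-(3 * Real.pi / 2)) = 0 := by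
    rw [show -(3 * Real.pi / 2) = Real.pi / 2 - 2 * Real.pi by ring, Real.cos_sub_two_pi,
      Real.cos_pi_div_two]
  have hcont : Continuous fun t => Θ₀ t + n * (2 * Real.pi) := hΘ₀.add continuous_const
  have hlt := lt_of_continuousOn_ne isPreconnected_univ hcont.continuousOn (Set.mem_univ t₀)
    (c := Real.pi / 2)
    (lt_of_le_of_ne (by linarith [hn.2]) (hup t₀ _ Real.cos_pi_div_two Real.sin_pi_div_two))
    (fun t _ => hup t _ Real.cos_pi_div_two Real.sin_pi_div_two)
  have hgt := gt_of_continuousOn_ne isPreconnected_univ hcont.continuousOn (Set.mem_univ t₀)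
    hn.1 (fun t _ => hup t _ hc3 hs3)
  refine ⟨_, ⟨hcont, hang, ?_⟩, ?_, fun t => ⟨hgt t trivial, hlt t trivial⟩⟩
  · filter_upwards [hw] with t ht
    have h5 := (hang t).cos_neg ht
    have h6 := hlt t trivial
    have h7 := hgt t trivial
    rw [abs_lt]
    constructor
    · linarith
    · by_contra hcon
      push Not at hcon
      have := Real.cos_nonneg_of_neg_pi_div_two_le_of_le
        (x := Θ₀ t + n * (2 * Real.pi)) (by linarith) (by linarith)
      linarith
  · filter_upwards [he] with t ht
    have h5 := (hang t).cos_pos ht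
    have h6 := hlt t trivial
    have h7 := hgt t trivial
    rw [abs_lt]
    constructor
    · by_contra hcon
      push Not at hcon
      have := Real.cos_nonpos_of_pi_div_two_le_of_le
        (x := -(Θ₀ t + n * (2 * Real.pi))) (by linarith) (by linarith)
      rw [Real.cos_neg] at this
      linarith
    · linarith

theorem Free.rightAcc (hz : Free K z) : RightAcc K z := by
  refine ⟨hz.notMem, fun e he => ?_⟩
  obtain ⟨Θ, h1, h2, h3⟩ := hz.exists_view he
  exact ⟨Θ, h1, h2, fun t => (h3 t).2⟩

/-- A point accessible from both sides is free. -/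
theorem free_of_rightAcc (hcross : ∀ z ∈ K, ∃ e ∈ Crossing K, ∃ t, e t = z) (h : RightAcc K z)
    (h' : RightAcc (mirror ⁻¹' K) (mirror z)) : Free K z := by
  intro w hw hre
  by_contra hcon
  push Not at hcon
  have hpi := Real.pi_pos
  obtain ⟨e, he, t, ht⟩ := hcross w hw
  have hne : ∀ t, e t ≠ z := fun t h1 => h.1 (h1 ▸ he.2.1 t)
  obtain ⟨Θ, h1, -, h3⟩ := h.2 e he
  obtain ⟨Ψ, g1, g2, g3⟩ := h'.2 _ (mirror_mem_crossing he)
  -- The western end of the mirrored path is the eastern end of `e`. That the reflected view is also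
  -- normalised at the western end of `e` is what the condition `|Θ t| < π / 2` at the eastern end
  -- in `RightAcc` is for.
  have hview : IsView z e (fun t => -Real.pi - Ψ (-t)) := by
    refine ⟨by have := g1.cont; fun_prop, fun t => ?_, ?_⟩
    · have h4 := (g1.angle (-t)).mirror.sub_two_pi (-1)
      rw [mirror_sub, mirror_mirror, neg_neg] at h4
      convert h4 using 1
      push_cast
      ring
    · filter_upwards [tendsto_neg_atBot_atTop.eventually g2] with t ht
      rw [show -Real.pi - Ψ (-t) - -Real.pi = -Ψ (-t) by ring, abs_neg]
      exact ht
  have heq := h1.ext hview hne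
  have h5 : IsAngle (e t - z) (Real.pi / 2) := by
    apply IsAngle.of_up
    · simp [ht, hre]
    · rw [ht, Complex.sub_im]
      rcases hcon.eq_or_lt with h6 | h6
      · exact (h.1 (Complex.ext hre h6.symm ▸ hw)).elim
      · linarith
  -- The point `e t` lies straight above `z`, but no upward direction lies strictly between `-3π/2`
  -- and `π/2`.
  obtain ⟨n, hn⟩ := h5.eq_add (h1.angle t) (sub_ne_zero.2 (hne t))
  have h6 := h3 t
  have h7 : -(3 * Real.pi / 2) < Θ t := by
    rw [heq]
    simp only
    linarith [g3 (-t)]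
  rw [hn] at h6 h7
  have h8 : (n : ℝ) < 0 := by
    by_contra hc
    push Not at hc
    nlinarith
  have h9 : (-1 : ℝ) < n := by
    by_contra hc
    push Not at hc
    nlinarith
  have : n < 0 := by exact_mod_cast h8
  have : -1 < n := by exact_mod_cast h9
  omega

end views

/-! ### Accessibility under the twist map, and the height of free points -/

section dynamics

variable {T : ℂ ≃ₜ ℂ} {Δ : ℂ → ℂ → ℝ} {k c ℓ N D : ℝ} {K : Set ℂ}

/-- The twist map preserves accessibility from the right. -/
theorem RightAcc.map (hT : TwistLift T Δ k c ℓ) (hK : InvariantBand T K N D) {z : ℂ}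
    (h : RightAcc K z) (hz : k < (T z).im) : RightAcc K (T z) := by
  have hpi := Real.pi_pos
  refine ⟨fun h' => h.1 ((hK.inv z).1 h'), fun e he => ?_⟩
  -- A path is seen from `T z` at the angle at which its preimage is seen from `z`, plus the turn.
  have he₁ := hK.symm_comp_mem he
  obtain ⟨Θ, h1, h2, h3⟩ := h.2 _ he₁
  have hne : ∀ t, T.symm (e t) ≠ z := fun t h1 => h.1 (h1 ▸ he₁.2.1 t)
  have hcont : Continuous fun t => Θ t + Δ z (T.symm (e t)) :=
    h1.cont.add ((hT.cont z).comp_continuous he₁.1 hne)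
  have hang : ∀ t, IsAngle (e t - T z) (Θ t + Δ z (T.symm (e t))) := by
    intro t
    have h4 := hT.turn z (T.symm (e t)) (Θ t) (hne t).symm (h1.angle t)
    rwa [T.apply_symm_apply] at h4
  have hwest : ∀ᶠ t in atBot, |Θ t + Δ z (T.symm (e t)) - -Real.pi| < Real.pi / 2 := by
    filter_upwards [h1.west, he₁.2.2.1.eventually_lt_atBot (z.re - 2 * Real.pi),
      he.2.2.1.eventually_lt_atBot ((T z).re - 2 * Real.pi)] with t g1 g2 g3
    have g4 : (e t - T z).re < -(2 * Real.pi) := by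
      rw [Complex.sub_re]; linarith
    refine half_turn g1.le ?_ ?_
    · rw [add_sub_cancel_left]
      apply hT.far_left
      · rw [Complex.sub_re]; linarith
      · rwa [T.apply_symm_apply]
    · have := (hang t).cos_neg (by linarith)
      rw [sub_neg_eq_add, Real.cos_add_pi]
      linarith
  refine ⟨_, ⟨hcont, hang, hwest⟩, ?_, ?_⟩
  · filter_upwards [h2, he₁.2.2.2.eventually_gt_atTop (z.re + 2 * Real.pi),
      he.2.2.2.eventually_gt_atTop ((T z).re + 2 * Real.pi)] with t g1 g2 g3
    have g4 : 2 * Real.pi < (e t - T z).re := by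
      rw [Complex.sub_re]; linarith
    have := half_turn (c := 0) (θ := Θ t) (θ' := Θ t + Δ z (T.symm (e t)))
      (by rw [sub_zero]; exact g1.le) ?_ ?_
    · rwa [sub_zero] at this
    · rw [add_sub_cancel_left]
      apply hT.far_right
      · rw [Complex.sub_re]; linarith
      · rwa [T.apply_symm_apply]
    · have := (hang t).cos_pos (by linarith)
      rwa [sub_zero]
  · obtain ⟨t₀, ht₀⟩ := hwest.exists
    rw [abs_lt] at ht₀
    intro t
    refine lt_of_continuousOn_ne isPreconnected_univ hcont.continuousOn (Set.mem_univ t₀)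
      (by linarith) (fun t _ g => ?_) t trivial
    have g1 := hang t
    rw [g] at g1
    have g2 := g1.re_eq
    have g3 := g1.im_eq
    rw [Real.cos_pi_div_two, mul_zero, Complex.sub_re] at g2
    rw [Real.sin_pi_div_two, mul_one, Complex.sub_im] at g3
    have g4 := norm_nonneg (e t - T z)
    -- An angle `π/2` would put a point of `e` straight above `T z`. The turn is clockwise there, so
    -- the angle before the step would have exceeded `π/2`.
    have g5 := hT.twist' z (T.symm (e t)) (hne t).symm
      (by rw [T.apply_symm_apply]; linarith) hz (by rw [T.apply_symm_apply]; linarith)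
    linarith [h3 t]

theorem Free.rightAcc_iterate (hT : TwistLift T Δ k c ℓ) (hK : InvariantBand T K N D) {z : ℂ}
    (h : Free K z) (n : ℕ) (hn : ∀ i < n, k < (T^[i + 1] z).im) : RightAcc K (T^[n] z) := by
  induction n with
  | zero => exact h.rightAcc
  | succ n ih =>
    have h1 := hn n (Nat.lt_succ_self n)
    rw [Function.iterate_succ_apply'] at h1 ⊢
    exact (ih fun i hi => hn i (hi.trans (Nat.lt_succ_self n))).map hT hK h1

/-- Free points are close to the top of `K`. -/
theorem Free.height_lt (hT : TwistLift T Δ k c ℓ) (hK : InvariantBand T K N D) (hℓ : 0 < ℓ)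
    (hglob : ∀ z, z.re + ℓ * (T z).im ≤ (T z).re ∧ (T z).re ≤ z.re + ℓ * (T z).im + 2 * Real.pi)
    {p : ℂ} (hp : p ∈ K) (hpN : p.im = N) (hk : k < N - c - 8 * Real.pi / ℓ) (hc : 0 ≤ c) {z : ℂ}
    (hz : Free K z) : N - 2 * c - 8 * Real.pi / ℓ < z.im := by
  have hpi := Real.two_pi_pos
  have h8 : 0 < 8 * Real.pi / ℓ := by positivity
  have h8' : ℓ * (8 * Real.pi / ℓ) = 8 * Real.pi := by field_simp
  set x₀ := z.re with hx₀
  -- The translates place `T⁻¹ q` at most one period to the left of the line over `x₀`, and the line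
  -- over `y₀`, a translate of it, at most one period to the left of `T q`.
  obtain ⟨i, hi, -⟩ := existsUnique_add_zsmul_mem_Ico hpi (T.symm p).re (x₀ - 2 * Real.pi)
  rw [zsmul_eq_mul] at hi
  set q : ℂ := p + i * (2 * Real.pi) with hq
  have hqK : q ∈ K := (hK.periodic i p).2 hp
  have hqim : q.im = N := by simp [hq, hpN]
  have hqre : (T.symm q).re = (T.symm p).re + i * (2 * Real.pi) := by
    rw [hq, hK.symm_map_add]
    simp
  obtain ⟨j, hj, -⟩ := existsUnique_add_zsmul_mem_Ico hpi x₀ ((T q).re - 2 * Real.pi)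
  rw [zsmul_eq_mul] at hj
  set y₀ := x₀ + j * (2 * Real.pi) with hy₀
  have h1 := hglob (T.symm q)
  rw [T.apply_symm_apply, hqim] at h1
  have h2 := hglob q
  have h3 := abs_le.1 (hT.near q (Or.inl (by rw [hqim]; linarith))).1
  have hdist : ℓ * (2 * N - c) - 4 * Real.pi ≤ y₀ - x₀ := by
    have : ℓ * (N - c) ≤ ℓ * (T q).im := by
      apply mul_le_mul_of_nonneg_left _ hℓ.le
      linarith
    have h5 := hi.1
    have h6 := hj.1
    have : ℓ * (2 * N - c) = ℓ * N + ℓ * (N - c) := by ring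
    linarith
  obtain ⟨e, he, t₀, ht₀⟩ := hK.cross q hqK
  have he₁ := hK.symm_comp_mem he
  have he₂ := hK.comp_mem he
  -- At a zero of `f` either `T⁻¹ (e t)` lies over `x₀` or `T (e t)` lies over `y₀`, while the two
  -- points are still at least `y₀ - x₀` apart horizontally. Such a distance requires both `e t` and
  -- `T (e t)` to be near the top, which gives a high point of `K` on the line of `z`, up to
  -- periods.
  set f : ℝ → ℝ := fun t => min (x₀ - (T.symm (e t)).re) ((T (e t)).re - y₀) with hf
  have hfc : Continuous f := by
    have g1 := he₁.1
    have g2 := he₂.1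
    exact (continuous_const.sub (Complex.continuous_re.comp g1)).min
      ((Complex.continuous_re.comp g2).sub continuous_const)
  have hf0 : 0 ≤ f t₀ := by
    simp only [hf, ht₀]
    apply le_min
    · linarith [hi.2]
    · linarith [hj.2]
  obtain ⟨t₁, ht₁⟩ := (he₁.2.2.2.eventually_gt_atTop x₀).exists
  have hf1 : f t₁ ≤ 0 := (min_le_left _ _).trans (by linarith)
  obtain ⟨t, -, ht⟩ := isPreconnected_univ.intermediate_value (Set.mem_univ t₁) (Set.mem_univ t₀)
    hfc.continuousOn (⟨hf1, hf0⟩ : (0 : ℝ) ∈ Set.Icc (f t₁) (f t₀))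
  have hKt := he.2.1 t
  have g1 : 0 ≤ x₀ - (T.symm (e t)).re := ht ▸ min_le_left _ _
  have g2 : 0 ≤ (T (e t)).re - y₀ := ht ▸ min_le_right _ _
  have g3 := (hglob (T.symm (e t))).2
  rw [T.apply_symm_apply] at g3
  have g4 := (hglob (e t)).2
  have g5 := hK.le _ hKt
  have g6 := hK.le _ (he₂.2.1 t)
  -- The choice of the translates cost `4π`, and the two steps from `T⁻¹ (e t)` to `T (e t)` cost
  -- `2π` each; this is the `8π / ℓ`.
  have g7 : 2 * N - c - 8 * Real.pi / ℓ ≤ (e t).im + (T (e t)).im := by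
    have : ℓ * (2 * N - c - 8 * Real.pi / ℓ) ≤ ℓ * ((e t).im + (T (e t)).im) := by
      have : ℓ * (2 * N - c - 8 * Real.pi / ℓ) = ℓ * (2 * N - c) - 8 * Real.pi := by
        rw [mul_sub, h8']
      rw [this, mul_add]
      linarith
    exact le_of_mul_le_mul_left this hℓ
  rcases min_choice (x₀ - (T.symm (e t)).re) ((T (e t)).re - y₀) with h | h
  · have h5 : x₀ - (T.symm (e t)).re = 0 := h ▸ ht
    have h6 := hz _ (he₁.2.1 t) (by linarith)
    have h7 := abs_le.1 (hT.near (T.symm (e t)) (Or.inr (by rw [T.apply_symm_apply]; linarith))).1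
    rw [T.apply_symm_apply] at h7
    linarith
  · have h5 : (T (e t)).re - y₀ = 0 := h ▸ ht
    have h6 := hz (T (e t) + ((-j : ℤ) : ℂ) * (2 * Real.pi))
      ((hK.periodic (-j) _).2 (he₂.2.1 t)) (by
        simp
        linarith)
    simp at h6
    linarith

end dynamics

end Coin

/-! ### Images of vertical rays and the dichotomy between the time directions -/

namespace Coin

open Filter Topology

/-- A function that starts below `m` and tends to infinity crosses the band between `m` and `M`
for the last time. -/
theorem exists_last_crossing {f : ℝ → ℝ} (hf : Continuous f) (hlim : Tendsto f atTop atTop)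
    {s₀ m M : ℝ} (h0 : f s₀ ≤ m) (hmM : m < M) :
    ∃ a b, s₀ ≤ a ∧ a ≤ b ∧ f a = m ∧ f b = M ∧ (∀ s, a < s → m < f s) ∧
      ∀ s ∈ Set.Icc a b, f s ≤ M := by
  obtain ⟨s₁, hs₁⟩ := (eventually_atTop.1 (hlim.eventually_gt_atTop m))
  set S : Set ℝ := {s | s₀ ≤ s ∧ f s ≤ m} with hS
  have hbdd : BddAbove S := ⟨s₁, fun s hs => by
    by_contra hcon
    push Not at hcon
    exact absurd (hs₁ s hcon.le) (not_lt.2 hs.2)⟩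
  have hSc : IsClosed S := isClosed_Ici.inter (isClosed_le hf continuous_const)
  have haS := hSc.csSup_mem ⟨s₀, le_rfl, h0⟩ hbdd
  set a := sSup S
  have hgt : ∀ s, a < s → m < f s := by
    intro s hs
    by_contra hcon
    push Not at hcon
    exact absurd (le_csSup hbdd (⟨haS.1.trans hs.le, hcon⟩ : s ∈ S)) (not_le.2 hs)
  have hfa : f a = m := by
    refine le_antisymm haS.2 ?_
    have hc : Tendsto f (𝓝[>] a) (𝓝 (f a)) := hf.continuousAt.mono_left nhdsWithin_le_nhds
    exact ge_of_tendsto hc (by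
      filter_upwards [self_mem_nhdsWithin] with s hs using (hgt s hs).le)
  obtain ⟨s₂, hs₂⟩ := (eventually_atTop.1 (hlim.eventually_gt_atTop M))
  set S' : Set ℝ := {s | a ≤ s ∧ M ≤ f s} with hS'
  have hbdd' : BddBelow S' := ⟨a, fun s hs => hs.1⟩
  have hSc' : IsClosed S' := isClosed_Ici.inter (isClosed_le continuous_const hf)
  have hbS := hSc'.csInf_mem ⟨max a s₂, le_max_left _ _, (hs₂ _ (le_max_right _ _)).le⟩ hbdd'
  set b := sInf S'
  have hlt : ∀ s, a ≤ s → s < b → f s < M := by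
    intro s hs hsb
    by_contra hcon
    push Not at hcon
    exact absurd (csInf_le hbdd' (⟨hs, hcon⟩ : s ∈ S')) (not_le.2 hsb)
  have hab : a < b := lt_of_le_of_ne hbS.1 fun h => by
    have := hbS.2
    rw [← h, hfa] at this
    linarith
  have hfb : f b = M := by
    refine le_antisymm ?_ hbS.2
    have hc : Tendsto f (𝓝[<] b) (𝓝 (f b)) := hf.continuousAt.mono_left nhdsWithin_le_nhds
    exact le_of_tendsto hc (by
      filter_upwards [Ioo_mem_nhdsLT hab] with s hs using (hlt s hs.1.le hs.2).le)
  refine ⟨a, b, haS.1, hab.le, hfa, hfb, hgt, fun s hs => ?_⟩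
  rcases hs.2.eq_or_lt with h | h
  · rw [h, hfb]
  · exact (hlt s hs.1 h).le

section dynamics

variable {T : ℂ ≃ₜ ℂ} {Δ : ℂ → ℂ → ℝ} {k c ℓ N D : ℝ} {K : Set ℂ}

theorem continuous_vertical (x₀ : ℝ) : Continuous fun s : ℝ => (⟨x₀, s⟩ : ℂ) := by
  have : (fun s : ℝ => (⟨x₀, s⟩ : ℂ)) = fun s : ℝ => (x₀ : ℂ) + s * Complex.I := by
    funext s
    apply Complex.ext <;> simp
  rw [this]
  fun_prop

theorem tendsto_iterate_im (hT : TwistLift T Δ k c ℓ) (x₀ : ℝ) (i : ℕ) :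
    Tendsto (fun s : ℝ => (T^[i] (⟨x₀, s⟩ : ℂ)).im) atTop atTop := by
  induction i with
  | zero => exact tendsto_id
  | succ i ih =>
    refine tendsto_atTop_mono' _ ?_ (tendsto_atTop_add_const_right _ (-c) ih)
    filter_upwards [ih.eventually_gt_atTop k] with s hs
    have := abs_le.1 (hT.near _ (Or.inl hs)).1
    rw [Function.iterate_succ_apply']
    linarith

theorem tendsto_iterate_re (hT : TwistLift T Δ k c ℓ) (hℓ : 0 < ℓ) (x₀ : ℝ) (i : ℕ) :
    Tendsto (fun s : ℝ => (T^[i + 1] (⟨x₀, s⟩ : ℂ)).re) atTop atTop := by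
  have key : ∀ i : ℕ, ∃ C, ∀ᶠ s : ℝ in atTop, C ≤ (T^[i] (⟨x₀, s⟩ : ℂ)).re := by
    intro i
    induction i with
    | zero => exact ⟨x₀, Eventually.of_forall fun s => le_rfl⟩
    | succ i ih =>
      obtain ⟨C, hC⟩ := ih
      refine ⟨C - c, ?_⟩
      filter_upwards [hC, (tendsto_iterate_im hT x₀ i).eventually_gt_atTop k,
        (tendsto_iterate_im hT x₀ i).eventually_ge_atTop 0] with s h1 h2 h3
      have := abs_le.1 (hT.near _ (Or.inl h2)).2.1
      rw [Function.iterate_succ_apply']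
      have := mul_nonneg hℓ.le h3
      linarith
  obtain ⟨C, hC⟩ := key i
  refine tendsto_atTop_mono' _ ?_ (tendsto_atTop_add_const_right _ (C - c)
    ((tendsto_iterate_im hT x₀ i).const_mul_atTop hℓ))
  filter_upwards [hC, (tendsto_iterate_im hT x₀ i).eventually_gt_atTop k] with s h1 h2
  have := abs_le.1 (hT.near _ (Or.inl h2)).2.1
  rw [Function.iterate_succ_apply']
  linarith

/-- If an iterate of a vertical ray is the first to come below the level `m`, then it contains an
arc which climbs from the level `m` to the level `M` and goes far to the right. -/
theorem exists_arc (hT : TwistLift T Δ k c ℓ) (hℓ : 0 < ℓ) {x₀ s₀ m M : ℝ} {n : ℕ}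
    (hkm : k < m) (hmM : m < M) (hpre : ∀ i ≤ n, ∀ s, s₀ ≤ s → m < (T^[i] (⟨x₀, s⟩ : ℂ)).im)
    (hdeep : (T^[n + 1] (⟨x₀, s₀⟩ : ℂ)).im ≤ m) :
    ∃ a b, s₀ ≤ a ∧ a ≤ b ∧ (T^[n + 1] (⟨x₀, a⟩ : ℂ)).im = m ∧
      (T^[n + 1] (⟨x₀, b⟩ : ℂ)).im = M ∧
      (∀ s ∈ Set.Icc a b, m ≤ (T^[n + 1] (⟨x₀, s⟩ : ℂ)).im ∧
        (T^[n + 1] (⟨x₀, s⟩ : ℂ)).im ≤ M) ∧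
      (T^[n + 1] (⟨x₀, a⟩ : ℂ)).re + ℓ * (M - m) - 2 * c ≤ (T^[n + 1] (⟨x₀, b⟩ : ℂ)).re := by
  have hpi := Real.pi_pos
  set F : ℕ → ℝ → ℂ := fun i s => T^[i] (⟨x₀, s⟩ : ℂ) with hF
  have hFs : ∀ i s, F (i + 1) s = T (F i s) := fun i s => Function.iterate_succ_apply' _ _ _
  have hFc : ∀ i, Continuous (F i) := fun i =>
    (T.continuous.iterate i).comp (continuous_vertical x₀)
  have hFi : ∀ i, Function.Injective (F i) := fun i s t h => by
    have := T.injective.iterate i h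
    simpa using congrArg Complex.im this
  obtain ⟨a, b, ha, hab, hfa, hfb, hgt, hle⟩ := exists_last_crossing
    (Complex.continuous_im.comp (hFc (n + 1))) (tendsto_iterate_im hT x₀ (n + 1)) hdeep hmM
  simp only [Function.comp_apply] at hfa hfb hgt hle
  have hlow : ∀ i ≤ n + 1, ∀ s, a ≤ s → k < (F i s).im := by
    intro i hi s hs
    rcases Nat.lt_or_eq_of_le hi with h | h
    · exact hkm.trans (hpre i (Nat.lt_succ_iff.1 h) s (ha.trans hs))
    · rw [h]
      rcases hs.eq_or_lt with h1 | h1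
      · rw [← h1, hfa]
        exact hkm
      · exact hkm.trans (hgt s h1)
  -- The angle between the images of the points at `a` and `s`: it starts at `π/2` on the vertical
  -- ray and is continued by the turns, so that its branch is determined after every step.
  set Θ : ℕ → ℝ → ℝ := fun i s => Real.pi / 2 + ∑ j ∈ Finset.range i, Δ (F j a) (F j s) with hΘ
  have hΘs : ∀ i s, Θ (i + 1) s = Θ i s + Δ (F i a) (F i s) := fun i s => by
    simp only [hΘ]
    rw [Finset.sum_range_succ, add_assoc]
  have hne : ∀ i s, a < s → F i a ≠ F i s := fun i s hs h => hs.ne (hFi i h)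
  have hΘc : ∀ i, ContinuousOn (Θ i) (Set.Ioi a) := by
    intro i
    refine continuousOn_const.add (continuousOn_finsetSum _ fun j _ => ?_)
    exact (hT.cont (F j a)).comp (hFc j).continuousOn fun s hs => (hne j s hs).symm
  have hang : ∀ i s, a < s → IsAngle (F i s - F i a) (Θ i s) := by
    intro i s hs
    induction i with
    | zero =>
      simp only [hΘ, Finset.range_zero, Finset.sum_empty, add_zero]
      apply IsAngle.of_up
      · simp [hF]
      · simpa [hF] using hs
    | succ i ih =>
      rw [hΘs, hFs, hFs]
      exact hT.turn _ _ _ (hne i s hs) ih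
  have hvert : ∀ i s, a < s → ∀ θ, Real.cos θ = 0 → Θ i s = θ → (F i a).re = (F i s).re := by
    intro i s hs θ hθ h
    have h1 := (hang i s hs).re_eq
    rw [h, hθ, mul_zero, Complex.sub_re] at h1
    linarith
  -- Far out on the ray the images after at least one step lie up and far to the right, which places
  -- the angle in `(0, π/2)` there. It cannot reach `π/2` elsewhere, since the turn into the upward
  -- direction is clockwise.
  have hmain : ∀ i ≤ n + 1, (∀ s, a < s → Θ i s ≤ Real.pi / 2) ∧ ∀ᶠ s in atTop, 0 < Θ i s := by
    intro i hi
    induction i with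
    | zero => simp [hΘ, hpi]
    | succ i ih =>
      obtain ⟨h1, h2⟩ := ih (Nat.le_of_succ_le hi)
      have hev : ∀ᶠ s in atTop, 0 < Θ (i + 1) s ∧ Θ (i + 1) s < Real.pi / 2 ∧ a < s := by
        have hΔ : ∀ᶠ s in atTop, |Δ (F i a) (F i s)| < Real.pi := by
          -- The initial vector is vertical and not far to the right, so its turn is bounded by
          -- `twist` instead of `far_right`.
          rcases i with _ | i
          · filter_upwards [eventually_gt_atTop a] with s hs
            have h3 := hT.twist (F 0 a) (F 0 s) (hne 0 s hs) rfl (hlow 0 (Nat.zero_le _) a le_rfl)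
              (hlow 0 (Nat.zero_le _) s hs.le)
            rw [abs_lt]
            constructor <;> linarith
          · filter_upwards [(tendsto_iterate_re hT hℓ x₀ i).eventually_gt_atTop
              ((F (i + 1) a).re + 2 * Real.pi),
              (tendsto_iterate_re hT hℓ x₀ (i + 1)).eventually_gt_atTop
              ((F (i + 2) a).re + 2 * Real.pi)] with s h3 h4
            apply hT.far_right
            · rw [Complex.sub_re]
              simp only [hF]
              simp only [hF] at h3
              linarith
            · rw [Complex.sub_re, ← hFs, ← hFs]
              simp only [hF]
              simp only [hF] at h4
              linarith
        filter_upwards [hΔ, h2, eventually_gt_atTop a,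
          (tendsto_iterate_re hT hℓ x₀ i).eventually_gt_atTop (F (i + 1) a).re,
          (tendsto_iterate_im hT x₀ (i + 1)).eventually_gt_atTop (F (i + 1) a).im]
          with s h3 h4 h5 h6 h7
        have h8 := (hang (i + 1) s h5).cos_pos (by rw [Complex.sub_re]; simp only [hF] at h6 ⊢; linarith)
        have h9 := (hang (i + 1) s h5).sin_pos (by rw [Complex.sub_im]; simp only [hF] at h7 ⊢; linarith)
        have h10 := h1 s h5
        have h11 := half_turn (c := 0) (θ := Θ i s) (θ' := Θ (i + 1) s)
          (by rw [sub_zero, abs_le]; constructor <;> linarith)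
          (by rw [hΘs, add_sub_cancel_left]; exact h3) (by rwa [sub_zero])
        rw [sub_zero, abs_lt] at h11
        refine ⟨?_, h11.2, h5⟩
        by_contra hcon
        push Not at hcon
        have := Real.sin_nonpos_of_nonpos_of_neg_pi_le hcon (by linarith)
        linarith
      refine ⟨fun s hs => ?_, hev.mono fun s h => h.1⟩
      obtain ⟨s₁, hs₁⟩ := hev.exists
      refine (lt_of_continuousOn_ne isPreconnected_Ioi (hΘc (i + 1)) hs₁.2.2 hs₁.2.1
        (fun s hs h => ?_) s hs).le
      have h3 := hvert (i + 1) s hs _ Real.cos_pi_div_two h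
      rw [hFs, hFs] at h3
      have h4 := hT.twist' _ _ (hne i s hs) h3 (by rw [← hFs]; exact hlow _ hi a le_rfl)
        (by rw [← hFs]; exact hlow _ hi s (le_of_lt hs))
      rw [hΘs] at h
      linarith [h1 s hs]
  obtain ⟨hn1, hn2⟩ := hmain (n + 1) le_rfl
  obtain ⟨hp1, hp2⟩ := hmain n (Nat.le_succ n)
  -- above its lowest point the arc lies to the right
  have hpos : ∀ s, a < s → 0 < Θ (n + 1) s := by
    obtain ⟨s₁, hs₁, hs₁'⟩ := (hn2.and (eventually_gt_atTop a)).exists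
    refine gt_of_continuousOn_ne isPreconnected_Ioi (hΘc (n + 1)) hs₁' hs₁ fun s hs h => ?_
    have h1 := (hang (n + 1) s hs).sin_pos (by
      rw [Complex.sub_im, hfa]
      linarith [hgt s hs])
    rw [h, Real.sin_zero] at h1
    exact h1.false
  -- A previous angle `-π/2` would become smaller by the clockwise turn, whereas the present angle
  -- is positive.
  have hprev : ∀ s, a < s → -(Real.pi / 2) < Θ n s := by
    obtain ⟨s₁, hs₁, hs₁'⟩ := (hp2.and (eventually_gt_atTop a)).exists
    refine gt_of_continuousOn_ne isPreconnected_Ioi (hΘc n) hs₁' (by linarith) fun s hs h => ?_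
    have h3 := hvert n s hs _ (by rw [Real.cos_neg, Real.cos_pi_div_two]) h
    have h4 := hT.twist _ _ (hne n s hs) h3 (hlow _ (Nat.le_succ n) a le_rfl)
      (hlow _ (Nat.le_succ n) s (le_of_lt hs))
    have h5 := hpos s hs
    rw [hΘs] at h5
    linarith
  have hab' : a < b := lt_of_le_of_ne hab fun h => by
    rw [h, hfb] at hfa
    linarith
  refine ⟨a, b, ha, hab, hfa, hfb, fun s hs => ⟨?_, hle s hs⟩, ?_⟩
  · rcases hs.1.eq_or_lt with h | h
    · rw [← h]
      exact hfa.ge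
    · exact (hgt s h).le
  -- Before the last step the upper end of the arc was not to the left of the lower one. The last
  -- step separates them by `ℓ (M - m)`, with an error of at most `c` for each end.
  · have h1 : (F n a).re ≤ (F n b).re := by
      have h2 := (hang n b hab').re_eq
      rw [Complex.sub_re] at h2
      have h3 := Real.cos_nonneg_of_neg_pi_div_two_le_of_le (hprev b hab').le (hp1 b hab')
      have := mul_nonneg (norm_nonneg (F n b - F n a)) h3
      linarith
    have h2 := abs_le.1 (hT.near (F n a) (Or.inl (hlow n (Nat.le_succ n) a le_rfl))).2.2
    have h3 := abs_le.1 (hT.near (F n b) (Or.inl (hlow n (Nat.le_succ n) b hab))).2.2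
    rw [← hFs, hfa] at h2
    rw [← hFs, hfb] at h3
    have : ℓ * (M - m) = ℓ * M - ℓ * m := by ring
    change (F (n + 1) a).re + ℓ * (M - m) - 2 * c ≤ (F (n + 1) b).re
    linarith

theorem Free.up {z : ℂ} (h : Free K z) {s : ℝ} (hs : z.im ≤ s) : Free K ⟨z.re, s⟩ :=
  fun w hw hre => (h w hw hre).trans_le hs

theorem mirrorInv_iterate (T : ℂ ≃ₜ ℂ) (n : ℕ) (z : ℂ) :
    (mirrorInv T)^[n] z = mirror (T.symm^[n] (mirror z)) := by
  induction n with
  | zero => simp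
  | succ n ih =>
    rw [Function.iterate_succ_apply', ih, Function.iterate_succ_apply', mirrorInv_apply,
      mirror_mirror]

/-- Forward and backward images of the free points cannot both come down far below the top. -/
theorem iterate_im_dichotomy (hT : TwistLift T Δ k c ℓ) (hK : InvariantBand T K N D) (hℓ : 0 < ℓ)
    {m M : ℝ} (hkm : k < m) (hmM : m < M) (hM : ∀ z, Free K z → M < z.im)
    (hD : Real.pi + 2 * c < ℓ * (M - m)) :
    (∀ n z, Free K z → m < (T^[n] z).im) ∨ (∀ n z, Free K z → m < (T.symm^[n] z).im) := by
  classical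
  -- the first image that comes down contains an arc accessible from the right
  have harc : ∀ (T : ℂ ≃ₜ ℂ) (Δ : ℂ → ℂ → ℝ) (K : Set ℂ), TwistLift T Δ k c ℓ →
      InvariantBand T K N D → (∀ z, Free K z → M < z.im) →
      ¬ (∀ n z, Free K z → m < (T^[n] z).im) →
      ∃ (σ : ℝ → ℂ) (a b : ℝ), a ≤ b ∧ Continuous σ ∧ (σ a).im = m ∧ (σ b).im = M ∧
        (∀ s ∈ Set.Icc a b, m ≤ (σ s).im ∧ (σ s).im ≤ M) ∧
        (∀ s ∈ Set.Icc a b, RightAcc K (σ s)) ∧ (σ a).re + ℓ * (M - m) - 2 * c ≤ (σ b).re := by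
    intro T Δ K hT hK hM h
    push Not at h
    have hn := Nat.find_spec h
    have hmin := fun i => @Nat.find_min _ _ h i
    set n := Nat.find h
    obtain ⟨z, hz, hzn⟩ := hn
    rcases hcase : n with _ | n'
    · rw [hcase] at hzn
      have := hM z hz
      simp only [Function.iterate_zero, id] at hzn
      linarith
    rw [hcase] at hzn hmin
    -- Points above a free point are free, so the minimality of `n` keeps the earlier images of the
    -- whole ray above `m`.
    have hpre : ∀ i ≤ n', ∀ s, z.im ≤ s → m < (T^[i] (⟨z.re, s⟩ : ℂ)).im := by
      intro i hi s hs
      have := hmin i (Nat.lt_succ_of_le hi)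
      push Not at this
      exact this _ (hz.up hs)
    obtain ⟨a, b, h1, h2, h3, h4, h5, h6⟩ := exists_arc hT hℓ hkm hmM hpre hzn
    refine ⟨fun s => T^[n' + 1] ⟨z.re, s⟩, a, b, h2,
      (T.continuous.iterate _).comp (continuous_vertical _), h3, h4, h5, fun s hs => ?_, h6⟩
    refine (hz.up (h1.trans hs.1)).rightAcc_iterate hT hK _ fun i hi => ?_
    rcases Nat.lt_or_eq_of_le (Nat.succ_le_of_lt hi) with h | h
    · exact hkm.trans (hpre (i + 1) (Nat.lt_succ_iff.1 h) s (h1.trans hs.1))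
    · have h' : i + 1 = n' + 1 := h
      rw [h']
      exact hkm.trans_le (h5 s hs).1
  by_contra hcon
  push Not at hcon
  obtain ⟨hr, hl⟩ := hcon
  obtain ⟨σ, a, b, hab, hσ, hσa, hσb, hσm, hσr, hσd⟩ := harc T Δ K hT hK hM (by
    push Not
    exact hr)
  obtain ⟨τ, a', b', hab', hτ, hτa, hτb, hτm, hτr, hτd⟩ := harc (mirrorInv T) _ (mirror ⁻¹' K)
    hT.mirrorInv hK.mirrorInv (fun z hz => by
      have h1 : Free K (mirror z) := Free.of_mirror (by simpa using hz)
      simpa using hM _ h1) (by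
      push Not
      obtain ⟨n, z, hz, hzn⟩ := hl
      exact ⟨n, mirror z, hz.mirror, by simpa [mirrorInv_iterate] using hzn⟩)
  have hpi := Real.two_pi_pos
  -- One arc gains more than `π` to the right, the reflected other one more than `π` to the left.
  -- With the lower end of the second placed to the right of that of the first by at most one
  -- period, the upper ends are interchanged.
  obtain ⟨j, hj, -⟩ := existsUnique_add_zsmul_mem_Ioc hpi (-(τ a').re) (σ a).re
  rw [zsmul_eq_mul] at hj
  obtain ⟨s, hs, t, ht, hst⟩ := exists_eq_of_cross (α := σ)
    (β := fun t => mirror (τ t) + j * (2 * Real.pi)) (m := m) (M := M) hab hab' hσ.continuousOn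
    ((mirror.continuous.comp hτ).add continuous_const).continuousOn hσm
    (fun t ht => by simpa using hτm t ht) hσa (by simpa using hτa) hσb (by simpa using hτb)
    (by
      simp
      linarith [hj.1])
    (by
      simp
      linarith [hj.2])
  -- The common point is accessible from both sides, hence free, although it is no higher than `M`.
  have hfree : Free K (σ s) := by
    refine free_of_rightAcc hK.cross (hσr s hs) ?_
    have h1 := hτr t ht
    have h2 : mirror (σ s) = τ t + ((-j : ℤ) : ℂ) * (2 * Real.pi) := by
      rw [hst, mirror_add_int, mirror_mirror]
    have h3 := hK.mirrorInv.periodic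
    rw [h2]
    refine ⟨fun h => h1.1 ((h3 _ _).1 h), fun e he => ?_⟩
    have he' : (fun t => e t + j * (2 * Real.pi)) ∈ Crossing (mirror ⁻¹' K) := by
      obtain ⟨g1, g2, g3, g4⟩ := he
      refine ⟨g1.add continuous_const, fun t => (h3 _ _).2 (g2 t), ?_, ?_⟩
      · simpa using tendsto_atBot_add_const_right _ (j * (2 * Real.pi)) g3
      · simpa using tendsto_atTop_add_const_right _ (j * (2 * Real.pi)) g4
    obtain ⟨Θ, ⟨g1, g2, g3⟩, g4, g5⟩ := h1.2 _ he'
    refine ⟨Θ, ⟨g1, fun t => ?_, g3⟩, g4, g5⟩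
    convert g2 t using 1
    push_cast
    ring
  have := hM _ hfree
  linarith [(hσm s hs).2]

/-- Far orbits of free points, in one of the two time directions, come back to free points only
through free points. -/
theorem free_iterate_dichotomy (hT : TwistLift T Δ k c ℓ) (hK : InvariantBand T K N D) (hℓ : 0 < ℓ)
    {m M : ℝ} (hkm : k < m) (hmM : m < M) (hM : ∀ z, Free K z → M < z.im)
    (hD : Real.pi + 2 * c < ℓ * (M - m)) :
    (∀ n z, Free K z → Free K (T (T^[n] z)) → Free K (T^[n] z)) ∨
    (∀ n z, Free K z → Free K (T.symm (T.symm^[n] z)) → Free K (T.symm^[n] z)) := by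
  have key : ∀ (T : ℂ ≃ₜ ℂ) (Δ : ℂ → ℂ → ℝ) (K : Set ℂ), TwistLift T Δ k c ℓ →
      InvariantBand T K N D → (∀ n z, Free K z → m < (T^[n] z).im) →
      ∀ n z, Free K z → Free K (T (T^[n] z)) → Free K (T^[n] z) := by
    intro T Δ K hT hK h n z hz hz'
    -- `T^[n] z` is accessible from the right as an image of a free point, and from the left as a
    -- preimage of one.
    refine free_of_rightAcc hK.cross
      (hz.rightAcc_iterate hT hK n fun i _ => hkm.trans (h (i + 1) z hz)) ?_
    have h1 := hz'.mirror.rightAcc.map hT.mirrorInv hK.mirrorInv (by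
      simpa [mirrorInv_apply] using hkm.trans (h n z hz))
    simpa [mirrorInv_apply] using h1
  rcases iterate_im_dichotomy hT hK hℓ hkm hmM hM hD with h | h
  · exact Or.inl (key T Δ K hT hK h)
  · refine Or.inr fun n z hz hz' => ?_
    have h1 := key (mirrorInv T) _ (mirror ⁻¹' K) hT.mirrorInv hK.mirrorInv (fun n z hz => by
      have h2 := h n (mirror z) (Free.of_mirror (by simpa using hz))
      simpa [mirrorInv_iterate] using h2) n (mirror z) hz.mirror
    simp only [mirrorInv_iterate, mirrorInv_apply, mirror_mirror] at h1
    exact (h1 hz'.mirror).of_mirror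

end dynamics

end Coin

/-! ### Folds of the set of free points -/

namespace Coin

open Filter Topology

/-- The vertical segment from `z` up to the height `N` is compact and avoids the closed set `K`, so
a thickening of it avoids `K` as well. -/
theorem isOpen_free {K : Set ℂ} (hK : IsClosed K) {N : ℝ} (hN : ∀ z ∈ K, z.im ≤ N) :
    IsOpen {z | Free K z} := by
  rw [Metric.isOpen_iff]
  intro z hz
  have hS : IsCompact ((fun s : ℝ => (⟨z.re, s⟩ : ℂ)) '' Set.Icc z.im (max z.im N)) :=
    isCompact_Icc.image (continuous_vertical z.re)
  obtain ⟨δ, hδ, hsub⟩ := hS.exists_thickening_subset_open hK.isOpen_compl (by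
    rintro _ ⟨s, hs, rfl⟩
    exact (hz.up hs.1).notMem)
  refine ⟨δ, hδ, fun z' hz' w hw hre => ?_⟩
  by_contra hcon
  push Not at hcon
  refine hsub (Metric.mem_thickening_iff.2 ?_) hw
  rw [Metric.mem_ball, Complex.dist_eq] at hz'
  have h1 := (Complex.abs_re_le_norm (z' - z)).trans_lt hz'
  rw [Complex.sub_re] at h1
  refine ⟨⟨z.re, max z.im w.im⟩, ⟨_, ⟨le_max_left _ _, max_le_max le_rfl (hN w hw)⟩, rfl⟩, ?_⟩
  rw [Complex.dist_eq]
  refine lt_of_le_of_lt ?_ hz'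
  rw [← Real.sqrt_sq (norm_nonneg (z' - z)), Complex.norm_def]
  apply Real.sqrt_le_sqrt
  rw [← Complex.normSq_eq_norm_sq, Complex.normSq_apply, Complex.normSq_apply]
  simp only [Complex.sub_re, Complex.sub_im, hre]
  rcases le_total z.im w.im with h | h
  · rw [max_eq_right h]
    nlinarith [mul_self_nonneg (z'.im - z.im)]
  · rw [max_eq_left h]
    nlinarith

/-- A point accessible from the right below a point of `K` has a one-sided neighbourhood without
free points. -/
theorem RightAcc.not_free_nearby {K : Set ℂ} (hK : IsClosed K)
    (hcross : ∀ z ∈ K, ∃ e ∈ Crossing K, ∃ t, e t = z) {w κ : ℂ} (hw : RightAcc K w) (hκ : κ ∈ K)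
    (hre : κ.re = w.re) (him : w.im < κ.im) :
    ∃ ε > 0, ∀ w', ‖w - w'‖ < ε → w'.re < w.re → ¬ Free K w' := by
  have hpi := Real.pi_pos
  obtain ⟨ε, hε, hball⟩ := Metric.isOpen_iff.1 hK.isOpen_compl w hw.1
  have hfar : ∀ z ∈ K, ε ≤ ‖z - w‖ := by
    intro z hz
    by_contra hcon
    push Not at hcon
    exact hball (by rwa [Metric.mem_ball, Complex.dist_eq]) hz
  refine ⟨ε, hε, fun w' hw' hre' hfree => ?_⟩
  obtain ⟨e, he, t₀, ht₀⟩ := hcross κ hκ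
  obtain ⟨Θ, hΘ, -, hΘlt⟩ := hw.2 e he
  have hne : ∀ t, e t - w ≠ 0 := fun t h => by
    have := hfar _ (he.2.1 t)
    rw [h, norm_zero] at this
    linarith
  have hne' : ∀ t, e t - w' ≠ 0 := fun t h =>
    hfree.notMem (sub_eq_zero.1 h ▸ he.2.1 t)
  -- The point `w'` is closer to `w` than `K` is, so a point of the path is seen from `w` and from
  -- `w'` in directions that differ by less than `π/2`; a view from `w` can be corrected to a view
  -- from `w'`.
  have hquot : ∀ t, 0 < ((e t - w') / (e t - w)).re := by
    intro t
    have h1 : (e t - w') / (e t - w) = 1 + (w - w') / (e t - w) := by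
      field_simp [hne t]
      ring
    have h2 : ‖(w - w') / (e t - w)‖ < 1 := by
      rw [norm_div, div_lt_one (norm_pos_iff.2 (hne t))]
      exact hw'.trans_le (hfar _ (he.2.1 t))
    have h3 := (abs_le.1 (Complex.abs_re_le_norm ((w - w') / (e t - w)))).1
    rw [h1, Complex.add_re, Complex.one_re]
    linarith
  have harg : ∀ t, |((e t - w') / (e t - w)).arg| < Real.pi / 2 := fun t =>
    Complex.abs_arg_lt_pi_div_two_iff.2 (Or.inl (hquot t))
  set Ψ : ℝ → ℝ := fun t => Θ t + ((e t - w') / (e t - w)).arg with hΨ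
  have hang : ∀ t, IsAngle (e t - w') (Ψ t) := fun t => (hΘ.angle t).add_arg (hne t)
  have hview : IsView w' e Ψ := by
    refine ⟨?_, hang, ?_⟩
    · refine hΘ.cont.add (continuous_iff_continuousAt.2 fun t => ?_)
      refine (Complex.continuousAt_arg (Complex.mem_slitPlane_iff.2 (Or.inl (hquot t)))).comp
        (f := fun t => (e t - w') / (e t - w)) ?_
      exact ((he.1.sub continuous_const).div (he.1.sub continuous_const) hne).continuousAt
    · filter_upwards [hΘ.west, he.2.2.1.eventually_lt_atBot w'.re] with t h1 h2
      refine half_turn h1.le ?_ ?_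
      · rw [hΨ]
        simp only [add_sub_cancel_left]
        linarith [harg t]
      · have := (hang t).cos_neg (by rw [Complex.sub_re]; linarith)
        rw [sub_neg_eq_add, Real.cos_add_pi]
        linarith
  obtain ⟨Φ, hΦ, -, hΦlt⟩ := hfree.exists_view he
  have heq := hview.ext hΦ fun t h => hne' t (sub_eq_zero.2 h)
  have h1 : IsAngle (e t₀ - w) (Real.pi / 2) := by
    apply IsAngle.of_up
    · simp [ht₀, hre]
    · rw [ht₀, Complex.sub_im]
      linarith
  obtain ⟨n, hn⟩ := h1.eq_add (hΘ.angle t₀) (hne t₀)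
  have h2 := hΘlt t₀
  -- The point `κ` is straight above `w`, but its angle is below `π/2`, hence at most `-3π/2`. From
  -- `w'`, which lies to the left of `w`, it is seen at a still smaller angle, while a free point
  -- sees only angles above `-3π/2`.
  have h3 : (n : ℝ) ≤ -1 := by
    have h4 : (n : ℝ) < 0 := by
      by_contra hc
      push Not at hc
      nlinarith
    have h5 : n < 0 := by exact_mod_cast h4
    have h6 : n ≤ -1 := by omega
    exact_mod_cast h6
  have h4 := (hang t₀).cos_pos (by rw [Complex.sub_re, ht₀]; linarith)
  have h5 := abs_lt.1 (harg t₀)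
  have h6 := (hΦlt t₀).1
  rw [← heq] at h6
  simp only [hΨ] at h4 h6
  set α := ((e t₀ - w') / (e t₀ - w)).arg
  have h7 : Real.cos (Θ t₀ + α) = -Real.sin α := by
    rw [hn, show Real.pi / 2 + n * (2 * Real.pi) + α = (α + Real.pi / 2) + n * (2 * Real.pi) by ring,
      Real.cos_add_int_mul_two_pi, Real.cos_add_pi_div_two]
  rw [h7] at h4
  have h8 : α < 0 := by
    by_contra hc
    push Not at hc
    have := Real.sin_nonneg_of_nonneg_of_le_pi hc (by linarith)
    linarith
  nlinarith

section dynamics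

variable {T : ℂ ≃ₜ ℂ} {Δ : ℂ → ℂ → ℝ} {k c ℓ N D : ℝ} {K : Set ℂ}

/-- Over every point of the line there is a topmost point of `K`. -/
theorem InvariantBand.exists_top (hK : InvariantBand T K N D) (hne : K.Nonempty) (x : ℝ) :
    ∃ q ∈ K, q.re = x ∧ ∀ s, q.im < s → Free K ⟨x, s⟩ := by
  obtain ⟨p, hp⟩ := hne
  obtain ⟨e, he, -⟩ := hK.cross p hp
  obtain ⟨t, ht⟩ : ∃ t, (e t).re = x := by
    obtain ⟨t₁, h1⟩ := (he.2.2.1.eventually_le_atBot x).exists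
    obtain ⟨t₂, h2⟩ := (he.2.2.2.eventually_ge_atTop x).exists
    obtain ⟨t, -, ht⟩ := isPreconnected_univ.intermediate_value (Set.mem_univ t₁)
      (Set.mem_univ t₂) (Complex.continuous_re.comp he.1).continuousOn ⟨h1, h2⟩
    exact ⟨t, ht⟩
  set S : Set ℝ := (fun s : ℝ => (⟨x, s⟩ : ℂ)) ⁻¹' K with hS
  have hSc : IsClosed S := hK.closed.preimage (continuous_vertical x)
  have hb : BddAbove S := ⟨N, fun s hs => hK.le _ hs⟩
  have hn : S.Nonempty := ⟨(e t).im, by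
    change (⟨x, (e t).im⟩ : ℂ) ∈ K
    rw [← ht]
    exact he.2.1 t⟩
  refine ⟨⟨x, sSup S⟩, hSc.csSup_mem hn hb, rfl, fun s hs w hw hre => ?_⟩
  have : w.im ∈ S := by
    change (⟨x, w.im⟩ : ℂ) ∈ K
    rwa [show (⟨x, w.im⟩ : ℂ) = w from Complex.ext hre.symm rfl]
  exact (le_csSup hb this).trans_lt hs

/-- A forward fold: if the images of two points of `K` appear in the wrong order, then some free
points have images which are not free. -/
theorem exists_fold (hT : TwistLift T Δ k c ℓ) (hK : InvariantBand T K N D) (hℓ : 0 < ℓ)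
    {p q : ℂ} (hp : p ∈ K) (htop : ∀ s, q.im < s → Free K ⟨q.re, s⟩)
    (hpk : k < (T p).im) (hqk : k + c < q.im) (hc : 0 ≤ c) (hre : p.re < q.re)
    (hre' : (T q).re < (T p).re) :
    ∃ O : Set ℂ, IsOpen O ∧ O.Nonempty ∧ ∀ z ∈ O, Free K z ∧ ¬ Free K (T z) := by
  have hpi := Real.pi_pos
  have hcont : Continuous fun s : ℝ => (T ⟨q.re, s⟩).re :=
    Complex.continuous_re.comp (T.continuous.comp (continuous_vertical q.re))
  -- All points above `q` are free and high ones are carried far to the right, so the image of one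
  -- of them lies on the vertical line of `T p`.
  obtain ⟨s₁, hs₁, hs₁'⟩ := (((tendsto_iterate_re hT hℓ q.re 0).eventually_ge_atTop
    (T p).re).and (eventually_ge_atTop q.im)).exists
  obtain ⟨s, hs, hsre⟩ := isPreconnected_Icc.intermediate_value (Set.left_mem_Icc.2 hs₁')
    (Set.right_mem_Icc.2 hs₁') hcont.continuousOn (⟨hre'.le, hs₁⟩ : (T p).re ∈ Set.Icc _ _)
  simp only at hsre
  have hsq : q.im < s := lt_of_le_of_ne hs.1 fun h => by
    rw [← h] at hsre
    exact hre'.ne hsre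
  have hfree := htop s hsq
  have hk : k < (T ⟨q.re, s⟩).im := by
    have := abs_le.1 (hT.near ⟨q.re, s⟩ (Or.inl (by simp only; linarith))).1
    simp only at this
    linarith
  have hacc : RightAcc K (T ⟨q.re, s⟩) := hfree.rightAcc.map hT hK hk
  have hTp : T p ∈ K := (hK.inv p).2 hp
  have hne : p ≠ ⟨q.re, s⟩ := fun h => hfree.notMem (h ▸ hp)
  -- Otherwise undoing the clockwise turn would give the vector from `p` to the free point an angle
  -- between `π/2` and `3π/2`, although it points to the right.
  have him : (T ⟨q.re, s⟩).im < (T p).im := by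
    by_contra hcon
    push Not at hcon
    have h1 : (T p).im < (T ⟨q.re, s⟩).im := lt_of_le_of_ne hcon fun h =>
      hne (T.injective (Complex.ext hsre.symm h))
    have h2 := hT.twist' p _ hne hsre.symm hpk hk
    have h3 := IsAngle.arg ((⟨q.re, s⟩ : ℂ) - p)
    have h4 := hT.turn _ _ _ hne h3
    have h5 : IsAngle (T ⟨q.re, s⟩ - T p) (Real.pi / 2) := by
      apply IsAngle.of_up
      · rw [Complex.sub_re, hsre, sub_self]
      · rw [Complex.sub_im]
        linarith
    obtain ⟨n, hn⟩ := h5.eq_add h4 (sub_ne_zero.2 fun h => hne (T.injective h.symm))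
    have h6 := h3.cos_pos (by rw [Complex.sub_re]; simp only; linarith)
    have h7 : ((⟨q.re, s⟩ : ℂ) - p).arg = (Real.pi / 2 - Δ p ⟨q.re, s⟩) + n * (2 * Real.pi) := by
      linarith
    rw [h7, Real.cos_add_int_mul_two_pi] at h6
    have := Real.cos_nonpos_of_pi_div_two_le_of_le (x := Real.pi / 2 - Δ p ⟨q.re, s⟩)
      (by linarith) (by linarith)
    linarith
  obtain ⟨ε, hε, hnear⟩ := hacc.not_free_nearby hK.closed hK.cross hTp hsre.symm him
  set w := T ⟨q.re, s⟩ with hw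
  have hO : IsOpen {z : ℂ | Free K (T.symm z)} :=
    (isOpen_free hK.closed hK.le).preimage T.symm.continuous
  have hwO : w ∈ {z : ℂ | Free K (T.symm z)} := by
    simpa [hw] using hfree
  obtain ⟨η, hη, hηO⟩ := Metric.isOpen_iff.1 hO w hwO
  -- The free points whose images lie near `w` and to its left, where nothing is free.
  refine ⟨{z | Free K z} ∩ T ⁻¹' (Metric.ball w ε ∩ {z | z.re < w.re}), ?_, ?_, ?_⟩
  · exact (isOpen_free hK.closed hK.le).inter ((Metric.isOpen_ball.inter
      (isOpen_lt Complex.continuous_re continuous_const)).preimage T.continuous)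
  · have hδ : 0 < min ε η / 2 := half_pos (lt_min hε hη)
    have hn : ‖w - ((min ε η / 2 : ℝ) : ℂ) - w‖ = min ε η / 2 := by
      rw [sub_sub_cancel_left, norm_neg, Complex.norm_real, Real.norm_of_nonneg hδ.le]
    refine ⟨T.symm (w - ((min ε η / 2 : ℝ) : ℂ)), ?_, ?_, ?_⟩
    · apply hηO
      rw [Metric.mem_ball, Complex.dist_eq, hn]
      linarith [min_le_right ε η]
    · rw [T.apply_symm_apply, Metric.mem_ball, Complex.dist_eq, hn]
      linarith [min_le_left ε η]
    · rw [T.apply_symm_apply]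
      simp only [Set.mem_ofPred_eq, Complex.sub_re, Complex.ofReal_re]
      linarith
  · rintro z ⟨h1, h2, h3⟩
    refine ⟨h1, hnear _ ?_ h3⟩
    rw [Metric.mem_ball, Complex.dist_eq] at h2
    rwa [norm_sub_rev]

/-- If the sum of the forward and backward displacement decreases somewhere, then the map or its
inverse folds the set of free points. -/
theorem exists_fold_of_sum (hT : TwistLift T Δ k c ℓ) (hK : InvariantBand T K N D) (hℓ : 0 < ℓ)
    (hc : 0 ≤ c) (hne : K.Nonempty) {M : ℝ} (hM : ∀ z, Free K z → M < z.im) (hkM : k + c < M)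
    {x y : ℝ} (hxy : x < y)
    (hsum : ∀ p q : ℂ, p.re = x → q.re = y → k < p.im → k < q.im →
      (T q).re + (T.symm q).re < (T p).re + (T.symm p).re) :
    ∃ O : Set ℂ, IsOpen O ∧ O.Nonempty ∧
      ((∀ z ∈ O, Free K z ∧ ¬ Free K (T z)) ∨ (∀ z ∈ O, Free K (T z) ∧ ¬ Free K z)) := by
  have htop : ∀ x, ∃ q ∈ K, q.re = x ∧ (∀ s, q.im < s → Free K ⟨x, s⟩) ∧ M ≤ q.im := by
    intro x
    obtain ⟨q, hq, hqx, hqs⟩ := hK.exists_top hne x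
    exact ⟨q, hq, hqx, hqs, le_of_forall_gt_imp_ge_of_dense fun s hs => (hM _ (hqs s hs)).le⟩
  -- the top points lie high enough for both maps
  obtain ⟨p, hp, rfl, hps, hpM⟩ := htop x
  obtain ⟨q, hq, rfl, hqs, hqM⟩ := htop y
  have h1 := hsum p q rfl rfl (by linarith) (by linarith)
  have himg : ∀ z, M ≤ z.im → k < (T z).im ∧ k < (T.symm z).im := by
    intro z hz
    have h2 := abs_le.1 (hT.near z (Or.inl (by linarith))).1
    have h3 := abs_le.1 (hT.near (T.symm z) (Or.inr (by rw [T.apply_symm_apply]; linarith))).1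
    rw [T.apply_symm_apply] at h3
    constructor <;> linarith
  by_cases h : (T q).re < (T p).re
  · obtain ⟨O, hO, hO', hO''⟩ := exists_fold hT hK hℓ hp hqs (himg p hpM).1 (by linarith) hc hxy h
    exact ⟨O, hO, hO', Or.inl hO''⟩
  -- If `T` does not reverse the order of the two top points, then `T⁻¹` does, and the fold is found
  -- for the mirrored inverse.
  · push Not at h
    obtain ⟨O, hO, ⟨z, hz⟩, hO''⟩ := exists_fold (p := mirror q) (q := mirror p) hT.mirrorInv
      hK.mirrorInv hℓ (by simpa using hq) (fun s hs => by
        have h2 := (hps s (by simpa using hs)).mirror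
        convert h2 using 1
        apply Complex.ext <;> simp)
      (by simpa [mirrorInv_apply] using (himg q hqM).2) (by simp; linarith) hc (by simpa using hxy)
      (by
        simp [mirrorInv_apply]
        linarith)
    refine ⟨mirror ⁻¹' (mirrorInv T '' O), ?_, ⟨T.symm (mirror z), ?_⟩, Or.inr ?_⟩
    · exact ((mirrorInv T).isOpenMap O hO).preimage mirror.continuous
    · exact ⟨z, hz, by simp [mirrorInv_apply]⟩
    · rintro w ⟨v, hv, hvw⟩
      obtain ⟨h2, h3⟩ := hO'' v hv
      rw [hvw] at h3
      rw [mirrorInv_apply] at hvw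
      have h4 : T w = mirror v := by
        have := mirror.injective hvw
        rw [← this, T.apply_symm_apply]
      refine ⟨?_, fun h5 => h3 h5.mirror⟩
      rw [h4]
      exact Free.of_mirror (by simpa using h2)

end dynamics

/-! ### Poincaré recurrence -/

section recurrence

open MeasureTheory

variable {X : Type*} [MeasurableSpace X] {μ : Measure X} [IsFiniteMeasure μ] {f : X → X}

/-- A measure preserving map cannot fold a set whose orbits come back only through the set. -/
theorem measure_fold_eq_zero (hf : MeasurePreserving f μ μ) {V : Set X} (hV : MeasurableSet V)
    (h : (∀ n x, x ∈ V → f (f^[n] x) ∈ V → f^[n] x ∈ V) ∨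
      (∀ n x, x ∈ V → f^[n + 1] x ∈ V → f x ∈ V)) :
    μ (f ⁻¹' V \ V) = 0 ∧ μ (V \ f ⁻¹' V) = 0 := by
  have hV' : MeasurableSet (f ⁻¹' V) := hf.measurable hV
  have hμ : μ (f ⁻¹' V) = μ V := hf.measure_preimage hV.nullMeasurableSet
  have heq : μ (f ⁻¹' V \ V) = μ (V \ f ⁻¹' V) := by
    have h1 := measure_inter_add_sdiff (μ := μ) (f ⁻¹' V) hV
    have h2 := measure_inter_add_sdiff (μ := μ) V hV'
    rw [Set.inter_comm] at h2
    rw [hμ, ← h2] at h1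
    exact (ENNReal.add_right_inj (measure_ne_top μ _)).1 h1
  rcases h with h | h
  -- A point that enters `V` in one step would recur to this situation: from `V` its orbit would get
  -- outside and then in again. The measure of the points that leave `V` is the same, since `V` and
  -- `f ⁻¹' V` have equal finite measure.
  · have h0 : μ (f ⁻¹' V \ V) = 0 := by
      by_contra hcon
      obtain ⟨x, hx, n, hn, hx'⟩ := hf.exists_mem_iterate_mem
        (hV'.diff hV).nullMeasurableSet hcon
      obtain ⟨n, rfl⟩ := Nat.exists_eq_succ_of_ne_zero hn
      refine hx'.2 ?_
      have := h n (f x) hx.1 (by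
        rw [← Function.iterate_succ_apply]
        exact hx'.1)
      rwa [← Function.iterate_succ_apply] at this
    exact ⟨h0, heq ▸ h0⟩
  · have h0 : μ (V \ f ⁻¹' V) = 0 := by
      by_contra hcon
      obtain ⟨x, hx, n, hn, hx'⟩ := hf.exists_mem_iterate_mem
        (hV.diff hV').nullMeasurableSet hcon
      obtain ⟨n, rfl⟩ := Nat.exists_eq_succ_of_ne_zero hn
      exact hx.2 (h n x hx.1 hx'.1)
    exact ⟨heq ▸ h0, h0⟩

end recurrence

end Coin

namespace Coin

open Filter Topology

/-! ### Calculus on the circle -/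

theorem exists_bound_circ {E : Type*} [NormedAddCommGroup E] {f : Circ → E} (hf : Continuous f) : ∃ M > 0, ∀ φ, ‖f φ‖ ≤ M := by
  have : CompactSpace Circ := by
    have : Fact (0 < 2 * Real.pi) := ⟨Real.two_pi_pos⟩
    infer_instance
  obtain ⟨M, hM⟩ := (isCompact_univ (X := Circ)).exists_bound_of_continuousOn hf.continuousOn
  exact ⟨max M 1, by positivity, fun φ => (hM φ trivial).trans (le_max_left _ _)⟩

section circle

variable {E : Type*} [NormedAddCommGroup E] [NormedSpace ℝ E]

theorem hasDerivAt_circ {f : Circ → E} {n : WithTop ℕ∞} (hn : n ≠ 0)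
    (hf : ContDiff ℝ n fun s : ℝ => f (s : Circ)) (φ : Circ) (s : ℝ) :
    HasDerivAt (fun s : ℝ => f (φ + (s : Circ))) (circDeriv f (φ + (s : Circ))) s := by
  induction φ using QuotientAddGroup.induction_on with
  | H a =>
    have hd : Differentiable ℝ (fun s : ℝ => f (s : Circ)) := hf.differentiable hn
    have key : ∀ b s : ℝ, HasDerivAt (fun s : ℝ => f ((b : Circ) + (s : Circ)))
        (deriv (fun s : ℝ => f (s : Circ)) (b + s)) s := by
      intro b s
      have h := (hd (b + s)).hasDerivAt.comp_const_add b s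
      exact h.congr_of_eventuallyEq (Eventually.of_forall fun u => by simp)
    have h2 : circDeriv f ((a : Circ) + (s : Circ)) = deriv (fun s : ℝ => f (s : Circ)) (a + s) := by
      have := (key (a + s) 0).deriv
      simpa [circDeriv] using this
    have := key a s
    rw [← h2] at this
    exact this

theorem circDeriv_coe {f : Circ → E} {n : WithTop ℕ∞} (hn : n ≠ 0)
    (hf : ContDiff ℝ n fun s : ℝ => f (s : Circ)) :
    (fun s : ℝ => circDeriv f (s : Circ)) = deriv fun s : ℝ => f (s : Circ) := by
  funext s
  have := (hasDerivAt_circ hn hf 0 s).deriv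
  simp only [zero_add] at this
  exact this.symm

theorem contDiff_circDeriv {f : Circ → E} {n m : WithTop ℕ∞} (hnm : m + 1 ≤ n)
    (hf : ContDiff ℝ n fun s : ℝ => f (s : Circ)) :
    ContDiff ℝ m fun s : ℝ => circDeriv f (s : Circ) := by
  have hn : n ≠ 0 := by
    rintro rfl
    have := (le_trans (self_le_add_left 1 m) hnm)
    simp at this
  rw [circDeriv_coe hn hf]
  exact (contDiff_succ_iff_deriv.1 (hf.of_le hnm)).2.2

theorem continuous_circ {F : Type*} [TopologicalSpace F] {f : Circ → F}
    (hf : Continuous fun s : ℝ => f (s : Circ)) : Continuous f :=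
  (QuotientAddGroup.isQuotientMap_mk (N := AddSubgroup.zmultiples (2 * Real.pi))).continuous_iff.2 hf

/-- Integration of a polynomial bound. -/
theorem norm_le_pow_succ {f f' : ℝ → E} {M r : ℝ} {n : ℕ} (hr : 0 ≤ r)
    (hf : ∀ s, HasDerivAt f (f' s) s) (h0 : f 0 = 0)
    (hb : ∀ s, 0 ≤ s → s ≤ r → ‖f' s‖ ≤ M * s ^ n) : ‖f r‖ ≤ M * r ^ (n + 1) := by
  have hM : 0 ≤ M * r ^ n := (norm_nonneg _).trans (hb r hr le_rfl)
  rcases hr.eq_or_lt with h | h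
  · rw [← h, h0]
    simp
  have hM' : 0 ≤ M := nonneg_of_mul_nonneg_left hM (pow_pos h n)
  have := (convex_Icc (0 : ℝ) r).norm_image_sub_le_of_norm_hasDerivWithin_le (f := f) (f' := f')
    (C := M * r ^ n) (fun s _ => (hf s).hasDerivWithinAt) (fun s hs => (hb s hs.1 hs.2).trans
      (mul_le_mul_of_nonneg_left (pow_le_pow_left₀ hs.1 hs.2 n) hM'))
    (Set.left_mem_Icc.2 hr) (Set.right_mem_Icc.2 hr)
  rw [h0, sub_zero, sub_zero, Real.norm_of_nonneg hr] at this
  rw [pow_succ, ← mul_assoc]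
  exact this

end circle

/-- The scalar product of two plane vectors. -/
def dot (z w : ℂ) : ℝ := z.re * w.re + z.im * w.im

section planar

variable {f g : ℝ → ℂ} {f' g' : ℂ} {s : ℝ}

theorem hasDerivAt_dot (hf : HasDerivAt f f' s) (hg : HasDerivAt g g' s) :
    HasDerivAt (fun s => dot (f s) (g s)) (dot f' (g s) + dot (f s) g') s := by
  have h1 := Complex.reCLM.hasFDerivAt.comp_hasDerivAt s hf
  have h2 := Complex.imCLM.hasFDerivAt.comp_hasDerivAt s hf
  have h3 := Complex.reCLM.hasFDerivAt.comp_hasDerivAt s hg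
  have h4 := Complex.imCLM.hasFDerivAt.comp_hasDerivAt s hg
  refine ((h1.mul h3).add (h2.mul h4)).congr_deriv ?_
  simp [dot]
  ring

theorem hasDerivAt_cross (hf : HasDerivAt f f' s) (hg : HasDerivAt g g' s) :
    HasDerivAt (fun s => cross (f s) (g s)) (cross f' (g s) + cross (f s) g') s := by
  have h1 := Complex.reCLM.hasFDerivAt.comp_hasDerivAt s hf
  have h2 := Complex.imCLM.hasFDerivAt.comp_hasDerivAt s hf
  have h3 := Complex.reCLM.hasFDerivAt.comp_hasDerivAt s hg
  have h4 := Complex.imCLM.hasFDerivAt.comp_hasDerivAt s hg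
  refine ((h1.mul h4).sub (h2.mul h3)).congr_deriv ?_
  simp [cross]
  ring

theorem abs_dot_le (z w : ℂ) : |dot z w| ≤ ‖z‖ * ‖w‖ := by
  have h : dot z w = ((starRingEnd ℂ z) * w).re := by simp [dot]
  rw [h, ← Complex.norm_conj z, ← norm_mul]
  exact Complex.abs_re_le_norm _

theorem abs_cross_le (z w : ℂ) : |cross z w| ≤ ‖z‖ * ‖w‖ := by
  have h : cross z w = ((starRingEnd ℂ z) * w).im := by
    simp [cross]
    ring
  rw [h, ← Complex.norm_conj z, ← norm_mul]
  exact Complex.abs_im_le_norm _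

end planar

namespace Table

variable (B : Table)

/-- The unit tangent vector. -/
noncomputable def tangent (φ : Circ) : ℂ := circDeriv B.γ φ

/-- The curvature as a function on the circle. -/
noncomputable def curv (φ : Circ) : ℝ := curvature B.γ φ

theorem curv_pos (φ : Circ) : 0 < B.curv φ := B.curvature_pos φ

theorem norm_tangent (φ : Circ) : ‖B.tangent φ‖ = 1 := B.unit_speed φ

theorem dot_tangent (φ : Circ) : dot (B.tangent φ) (B.tangent φ) = 1 := by
  have h1 := Complex.normSq_eq_norm_sq (B.tangent φ)
  rw [B.norm_tangent φ, Complex.normSq_apply] at h1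
  simp only [dot]
  linarith

theorem contDiff_tangent : ContDiff ℝ 4 fun s : ℝ => B.tangent (s : Circ) :=
  contDiff_circDeriv (by norm_num) B.contDiff

theorem contDiff_tangent' : ContDiff ℝ 3 fun s : ℝ => circDeriv B.tangent (s : Circ) :=
  contDiff_circDeriv (by norm_num) B.contDiff_tangent

theorem contDiff_curv : ContDiff ℝ 3 fun s : ℝ => B.curv (s : Circ) := by
  have h1 : ContDiff ℝ 3 fun s : ℝ => B.tangent (s : Circ) := B.contDiff_tangent.of_le (by norm_num)
  have h2 := B.contDiff_tangent'
  have hre : ∀ {f : ℝ → ℂ}, ContDiff ℝ 3 f → ContDiff ℝ 3 fun s => (f s).re := fun hf =>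
    Complex.reCLM.contDiff.comp hf
  have him : ∀ {f : ℝ → ℂ}, ContDiff ℝ 3 f → ContDiff ℝ 3 fun s => (f s).im := fun hf =>
    Complex.imCLM.contDiff.comp hf
  exact ((hre h1).mul (him h2)).sub ((him h1).mul (hre h2))

theorem hasDerivAt_γ (φ : Circ) (s : ℝ) :
    HasDerivAt (fun s : ℝ => B.γ (φ + (s : Circ))) (B.tangent (φ + (s : Circ))) s :=
  hasDerivAt_circ (by norm_num) B.contDiff φ s

/-- The Frenet equation: a unit vector is orthogonal to its derivative. -/
theorem circDeriv_tangent (φ : Circ) :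
    circDeriv B.tangent φ = B.curv φ * (Complex.I * B.tangent φ) := by
  have h1 := hasDerivAt_circ (by norm_num) B.contDiff_tangent φ 0
  simp only [QuotientAddGroup.mk_zero, add_zero] at h1
  have h2 := hasDerivAt_dot h1 h1
  have h3 : (fun s : ℝ => dot (B.tangent (φ + (s : Circ))) (B.tangent (φ + (s : Circ)))) =
      fun _ => 1 := funext fun s => B.dot_tangent _
  rw [h3] at h2
  have h4 := h2.unique (hasDerivAt_const (0 : ℝ) (1 : ℝ))
  simp only [QuotientAddGroup.mk_zero, add_zero] at h4
  have h5 := B.dot_tangent φ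
  have h6 : B.curv φ = cross (B.tangent φ) (circDeriv B.tangent φ) := rfl
  rw [h6]
  simp only [dot, cross] at h4 h5 ⊢
  apply Complex.ext
  · simp
    linear_combination (-(circDeriv B.tangent φ).re) * h5 + (B.tangent φ).re / 2 * h4
  · simp
    linear_combination (-(circDeriv B.tangent φ).im) * h5 + (B.tangent φ).im / 2 * h4

theorem hasDerivAt_tangent_shift (φ : Circ) (s : ℝ) :
    HasDerivAt (fun s : ℝ => B.tangent (φ + (s : Circ)))
      (B.curv (φ + (s : Circ)) * (Complex.I * B.tangent (φ + (s : Circ)))) s := by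
  rw [← B.circDeriv_tangent]
  exact hasDerivAt_circ (by norm_num) B.contDiff_tangent φ s

theorem continuous_γ : Continuous B.γ := continuous_circ B.contDiff.continuous

theorem continuous_tangent : Continuous B.tangent := continuous_circ B.contDiff_tangent.continuous

theorem continuous_curv : Continuous B.curv := continuous_circ B.contDiff_curv.continuous

theorem exists_curv_bounds : ∃ κ₀ κ₁ : ℝ, 0 < κ₀ ∧ ∀ φ, κ₀ ≤ B.curv φ ∧ B.curv φ ≤ κ₁ := by
  have : Fact (0 < 2 * Real.pi) := ⟨Real.two_pi_pos⟩
  obtain ⟨φ₀, -, h0⟩ := (isCompact_univ (X := Circ)).exists_isMinOn ⟨0, trivial⟩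
    B.continuous_curv.continuousOn
  obtain ⟨φ₁, -, h1⟩ := (isCompact_univ (X := Circ)).exists_isMaxOn ⟨0, trivial⟩
    B.continuous_curv.continuousOn
  exact ⟨B.curv φ₀, B.curv φ₁, B.curv_pos _, fun φ => ⟨h0 (Set.mem_univ φ), h1 (Set.mem_univ φ)⟩⟩

/-- The curvature has a second order Taylor expansion, uniformly on the circle. -/
theorem exists_curv_taylor : ∃ M > 0, ∀ φ : Circ, ∀ r : ℝ, 0 ≤ r →
    |B.curv φ| ≤ M ∧ |circDeriv B.curv φ| ≤ M ∧ |B.curv (φ + (r : Circ)) - B.curv φ| ≤ M * r ∧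
    |B.curv (φ + (r : Circ)) - B.curv φ - circDeriv B.curv φ * r| ≤ M * r ^ 2 := by
  have hc1 : ContDiff ℝ 2 fun s : ℝ => circDeriv B.curv (s : Circ) :=
    contDiff_circDeriv (by norm_num) B.contDiff_curv
  have hc2 : ContDiff ℝ 1 fun s : ℝ => circDeriv (circDeriv B.curv) (s : Circ) :=
    contDiff_circDeriv (by norm_num) hc1
  obtain ⟨M₀, hM₀, h0⟩ := exists_bound_circ B.continuous_curv
  obtain ⟨M₁, hM₁, h1⟩ := exists_bound_circ (continuous_circ hc1.continuous)
  obtain ⟨M₂, hM₂, h2⟩ := exists_bound_circ (continuous_circ hc2.continuous)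
  refine ⟨M₀ + M₁ + M₂, by positivity, fun φ r hr => ⟨?_, ?_, ?_, ?_⟩⟩
  · have := h0 φ
    rw [Real.norm_eq_abs] at this
    linarith
  · have := h1 φ
    rw [Real.norm_eq_abs] at this
    linarith
  · have := norm_le_pow_succ (f := fun s : ℝ => B.curv (φ + (s : Circ)) - B.curv φ) (n := 0)
      (M := M₁) hr (fun s => (hasDerivAt_circ (by norm_num) B.contDiff_curv φ s).sub_const _)
      (by simp) (fun s _ _ => by simpa using h1 (φ + (s : Circ)))
    rw [Real.norm_eq_abs, zero_add, pow_one] at this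
    nlinarith
  · have := norm_le_pow_succ
      (f := fun s : ℝ => B.curv (φ + (s : Circ)) - B.curv φ - circDeriv B.curv φ * s) (n := 1)
      (M := M₂) hr (fun s => ((hasDerivAt_circ (by norm_num) B.contDiff_curv φ s).sub_const _).sub
        ((hasDerivAt_id s).const_mul (circDeriv B.curv φ)))
      (by simp) (fun s hs _ => by
        have := norm_le_pow_succ
          (f := fun s : ℝ => circDeriv B.curv (φ + (s : Circ)) - circDeriv B.curv φ) (n := 0)
          (M := M₂) hs (fun s => (hasDerivAt_circ (by norm_num) hc1 φ s).sub_const _)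
          (by simp) (fun s _ _ => by simpa using h2 (φ + (s : Circ)))
        simpa using this)
    rw [Real.norm_eq_abs] at this
    refine this.trans ?_
    norm_num
    nlinarith [sq_nonneg r]

/-! ### Chords -/

/-- The chord from `γ φ` to `γ (φ + r)`. -/
noncomputable def chord (φ : Circ) (r : ℝ) : ℂ := B.γ (φ + (r : Circ)) - B.γ φ

/-- The component of the chord normal to the curve at its initial point. -/
noncomputable def normalOut (φ : Circ) (r : ℝ) : ℝ := cross (B.tangent φ) (B.chord φ r)

/-- The component of the chord tangent to the curve at its initial point. -/
noncomputable def tangentOut (φ : Circ) (r : ℝ) : ℝ := dot (B.tangent φ) (B.chord φ r)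

/-- The component of the chord normal to the curve at its final point. -/
noncomputable def normalIn (φ : Circ) (r : ℝ) : ℝ :=
  cross (B.chord φ r) (B.tangent (φ + (r : Circ)))

/-- The component of the chord tangent to the curve at its final point. -/
noncomputable def tangentIn (φ : Circ) (r : ℝ) : ℝ :=
  dot (B.tangent (φ + (r : Circ))) (B.chord φ r)

/-- The cotangent of the angle at the initial point of a chord. -/
noncomputable def cotOut (φ : Circ) (r : ℝ) : ℝ := B.tangentOut φ r / B.normalOut φ r

/-- The cotangent of the angle at the final point of a chord. -/
noncomputable def cotIn (φ : Circ) (r : ℝ) : ℝ := B.tangentIn φ r / B.normalIn φ r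

/-- A chord run backwards covers the rest of the circumference. The reversal rules below exchange
the quantities at its two ends, so that properties of one end carry over to the other. -/
theorem add_reverse (φ : Circ) (r : ℝ) :
    φ + (r : Circ) + ((2 * Real.pi - r : ℝ) : Circ) = φ := by
  have h : ((2 * Real.pi : ℝ) : Circ) = 0 := AddCircle.coe_period (2 * Real.pi)
  rw [add_assoc, ← AddCircle.coe_add, add_sub_cancel, h, add_zero]

theorem chord_reverse (φ : Circ) (r : ℝ) :
    B.chord (φ + (r : Circ)) (2 * Real.pi - r) = -B.chord φ r := by
  rw [chord, add_reverse, chord, neg_sub]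

theorem normalOut_reverse (φ : Circ) (r : ℝ) :
    B.normalOut (φ + (r : Circ)) (2 * Real.pi - r) = B.normalIn φ r := by
  rw [normalOut, chord_reverse, normalIn]
  simp [cross]
  ring

theorem tangentOut_reverse (φ : Circ) (r : ℝ) :
    B.tangentOut (φ + (r : Circ)) (2 * Real.pi - r) = -B.tangentIn φ r := by
  rw [tangentOut, chord_reverse, tangentIn]
  simp [dot]
  ring

theorem cotOut_reverse (φ : Circ) (r : ℝ) :
    B.cotOut (φ + (r : Circ)) (2 * Real.pi - r) = -B.cotIn φ r := by
  rw [cotOut, normalOut_reverse, tangentOut_reverse, cotIn, neg_div]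

theorem normalIn_reverse (φ : Circ) (r : ℝ) :
    B.normalIn (φ + (r : Circ)) (2 * Real.pi - r) = B.normalOut φ r := by
  rw [← normalOut_reverse, add_reverse]
  congr 1
  ring

theorem cotIn_reverse (φ : Circ) (r : ℝ) :
    B.cotIn (φ + (r : Circ)) (2 * Real.pi - r) = -B.cotOut φ r := by
  have h := B.cotOut_reverse (φ + (r : Circ)) (2 * Real.pi - r)
  rw [add_reverse, sub_sub_cancel] at h
  rw [h, neg_neg]

theorem chord_ne_zero (φ : Circ) {r : ℝ} (h0 : 0 < r) (h1 : r < 2 * Real.pi) :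
    B.chord φ r ≠ 0 := by
  intro h
  exact coe_ne_zero h0 h1 (by simpa using B.injective (sub_eq_zero.1 h))

theorem normalOut_pos (φ : Circ) {r : ℝ} (h0 : 0 < r) (h1 : r < 2 * Real.pi) :
    0 < B.normalOut φ r :=
  B.cross_pos φ (B.mem _) (sub_ne_zero.1 (B.chord_ne_zero φ h0 h1))

theorem normalIn_pos (φ : Circ) {r : ℝ} (h0 : 0 < r) (h1 : r < 2 * Real.pi) :
    0 < B.normalIn φ r := by
  rw [← normalOut_reverse]
  exact B.normalOut_pos _ (by linarith) (by linarith)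

theorem hasDerivAt_chord (φ : Circ) (r : ℝ) :
    HasDerivAt (B.chord φ) (B.tangent (φ + (r : Circ))) r := (B.hasDerivAt_γ φ r).sub_const _

theorem hasDerivAt_normalOut (φ : Circ) (r : ℝ) :
    HasDerivAt (B.normalOut φ) (cross (B.tangent φ) (B.tangent (φ + (r : Circ)))) r := by
  refine (hasDerivAt_cross (hasDerivAt_const r (B.tangent φ)) (B.hasDerivAt_chord φ r)).congr_deriv
    ?_
  simp [cross]

theorem hasDerivAt_tangentOut (φ : Circ) (r : ℝ) :
    HasDerivAt (B.tangentOut φ) (dot (B.tangent φ) (B.tangent (φ + (r : Circ)))) r := by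
  refine (hasDerivAt_dot (hasDerivAt_const r (B.tangent φ)) (B.hasDerivAt_chord φ r)).congr_deriv
    ?_
  simp [dot]

theorem hasDerivAt_normalIn (φ : Circ) (r : ℝ) :
    HasDerivAt (B.normalIn φ) (B.curv (φ + (r : Circ)) * B.tangentIn φ r) r := by
  refine (hasDerivAt_cross (B.hasDerivAt_chord φ r)
    (B.hasDerivAt_tangent_shift φ r)).congr_deriv ?_
  simp [cross, tangentIn, dot]
  ring

theorem hasDerivAt_tangentIn (φ : Circ) (r : ℝ) :
    HasDerivAt (B.tangentIn φ) (1 - B.curv (φ + (r : Circ)) * B.normalIn φ r) r := by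
  refine (hasDerivAt_dot (B.hasDerivAt_tangent_shift φ r)
    (B.hasDerivAt_chord φ r)).congr_deriv ?_
  rw [B.dot_tangent]
  simp [cross, normalIn, dot]
  ring

/-- The numerator of the quotient rule collapses to `-normalIn` by the identity for dot and cross
products with a unit vector. -/
theorem hasDerivAt_cotOut (φ : Circ) {r : ℝ} (h0 : 0 < r) (h1 : r < 2 * Real.pi) :
    HasDerivAt (B.cotOut φ) (-B.normalIn φ r / B.normalOut φ r ^ 2) r := by
  have h := (B.normalOut_pos φ h0 h1).ne'
  refine ((B.hasDerivAt_tangentOut φ r).div (B.hasDerivAt_normalOut φ r) h).congr_deriv ?_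
  congr 1
  have h2 := B.dot_tangent φ
  simp only [normalIn, normalOut, tangentOut, cross, dot] at h2 ⊢
  linear_combination (-((B.chord φ r).re * (B.tangent (φ + (r : Circ))).im -
    (B.chord φ r).im * (B.tangent (φ + (r : Circ))).re)) * h2

theorem hasDerivAt_cotIn (φ : Circ) {r : ℝ} (h0 : 0 < r) (h1 : r < 2 * Real.pi) :
    HasDerivAt (B.cotIn φ) ((B.normalIn φ r - B.curv (φ + (r : Circ)) *
      (B.tangentIn φ r ^ 2 + B.normalIn φ r ^ 2)) / B.normalIn φ r ^ 2) r := by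
  have h := (B.normalIn_pos φ h0 h1).ne'
  refine ((B.hasDerivAt_tangentIn φ r).div (B.hasDerivAt_normalIn φ r) h).congr_deriv ?_
  congr 1
  ring

theorem strictAntiOn_cotOut (φ : Circ) :
    StrictAntiOn (B.cotOut φ) (Set.Ioo 0 (2 * Real.pi)) := by
  refine strictAntiOn_of_deriv_neg (convex_Ioo _ _)
    (fun r hr => (B.hasDerivAt_cotOut φ hr.1 hr.2).continuousAt.continuousWithinAt) fun r hr => ?_
  rw [interior_Ioo] at hr
  rw [(B.hasDerivAt_cotOut φ hr.1 hr.2).deriv]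
  exact div_neg_of_neg_of_pos (neg_neg_of_pos (B.normalIn_pos φ hr.1 hr.2))
    (pow_pos (B.normalOut_pos φ hr.1 hr.2) 2)

/-- Uniform expansions of the components of short chords. -/
theorem exists_chord_taylor : ∃ M > 0, ∀ φ : Circ, ∀ r : ℝ, 0 ≤ r → r ≤ 1 →
    |B.tangentOut φ r - r| ≤ M * r ^ 3 ∧ |B.tangentIn φ r - r| ≤ M * r ^ 3 ∧
    |B.normalOut φ r - (B.curv φ * r ^ 2 / 2 + circDeriv B.curv φ * r ^ 3 / 6)| ≤ M * r ^ 4 ∧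
    |B.normalIn φ r - (B.curv φ * r ^ 2 / 2 + circDeriv B.curv φ * r ^ 3 / 3)| ≤ M * r ^ 4 := by
  obtain ⟨M, hM, hκ⟩ := B.exists_curv_taylor
  have hcs : ∀ (φ : Circ) (r : ℝ), |B.curv (φ + (r : Circ))| ≤ M := fun φ r => (hκ _ 0 le_rfl).1
  have hch0 : ∀ φ, B.chord φ 0 = 0 := fun φ => by simp [chord]
  -- The bounds are integrated one from another by `norm_le_pow_succ`, each integration raising the
  -- power of `r` by one.
  have hch : ∀ (φ : Circ) (r : ℝ), 0 ≤ r → ‖B.chord φ r‖ ≤ r := by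
    intro φ r hr
    have := norm_le_pow_succ (f := B.chord φ) (n := 0) (M := 1) hr (B.hasDerivAt_chord φ) (hch0 φ)
      (fun s _ _ => by simp [B.norm_tangent])
    simpa using this
  -- the two products of the tangent vectors
  have hq1 : ∀ (φ : Circ) (r : ℝ), 0 ≤ r → |cross (B.tangent φ) (B.tangent (φ + (r : Circ)))| ≤ M * r := by
    intro φ r hr
    have := norm_le_pow_succ (f := fun s : ℝ => cross (B.tangent φ) (B.tangent (φ + (s : Circ))))
      (n := 0) (M := M) hr (fun s => hasDerivAt_cross (hasDerivAt_const s (B.tangent φ))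
        (B.hasDerivAt_tangent_shift φ s)) (by simp [cross]; ring) (fun s _ _ => by
        have h1 := abs_cross_le (B.tangent φ)
          (B.curv (φ + (s : Circ)) * (Complex.I * B.tangent (φ + (s : Circ))))
        rw [norm_mul, norm_mul, B.norm_tangent, B.norm_tangent, Complex.norm_I, Complex.norm_real,
          Real.norm_eq_abs] at h1
        have h2 : cross 0 (B.tangent (φ + (s : Circ))) = 0 := by simp [cross]
        rw [h2, zero_add, Real.norm_eq_abs]
        linarith [hcs φ s])
    simpa using this
  have hp1 : ∀ (φ : Circ) (r : ℝ), 0 ≤ r →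
      |dot (B.tangent φ) (B.tangent (φ + (r : Circ))) - 1| ≤ M ^ 2 * r ^ 2 := by
    intro φ r hr
    have := norm_le_pow_succ
      (f := fun s : ℝ => dot (B.tangent φ) (B.tangent (φ + (s : Circ))) - 1)
      (n := 1) (M := M ^ 2) hr (fun s => (hasDerivAt_dot (hasDerivAt_const s (B.tangent φ))
        (B.hasDerivAt_tangent_shift φ s)).sub_const 1) (by simp [B.dot_tangent])
      (fun s hs _ => by
        have h1 : dot 0 (B.tangent (φ + (s : Circ))) + dot (B.tangent φ)
            (B.curv (φ + (s : Circ)) * (Complex.I * B.tangent (φ + (s : Circ)))) =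
            B.curv (φ + (s : Circ)) * (-cross (B.tangent φ) (B.tangent (φ + (s : Circ)))) := by
          simp [dot, cross]
          ring
        rw [h1, Real.norm_eq_abs, abs_mul, abs_neg, pow_one, pow_two, mul_assoc]
        exact mul_le_mul (hcs φ s) (hq1 φ s hs) (abs_nonneg _) hM.le)
    simpa using this
  have hA0 : ∀ (φ : Circ) (r : ℝ), 0 ≤ r → |B.tangentOut φ r - r| ≤ M ^ 2 * r ^ 3 := by
    intro φ r hr
    have := norm_le_pow_succ (f := fun s : ℝ => B.tangentOut φ s - s) (n := 2) (M := M ^ 2) hr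
      (fun s => (B.hasDerivAt_tangentOut φ s).sub (hasDerivAt_id s))
      (by simp [tangentOut, hch0, dot]) (fun s hs _ => hp1 φ s hs)
    simpa using this
  have hq2 : ∀ (φ : Circ) (r : ℝ), 0 ≤ r → r ≤ 1 → |cross (B.tangent φ) (B.tangent (φ + (r : Circ))) -
      (B.curv φ * r + circDeriv B.curv φ * r ^ 2 / 2)| ≤ (M ^ 3 + M) * r ^ 3 := by
    intro φ r hr hr1
    have := norm_le_pow_succ
      (f := fun s : ℝ => cross (B.tangent φ) (B.tangent (φ + (s : Circ))) -
        (B.curv φ * s + circDeriv B.curv φ * s ^ 2 / 2)) (n := 2) (M := M ^ 3 + M) hr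
      (fun s => (hasDerivAt_cross (hasDerivAt_const s (B.tangent φ))
        (B.hasDerivAt_tangent_shift φ s)).sub (((hasDerivAt_id s).const_mul (B.curv φ)).add
          (((hasDerivAt_pow 2 s).const_mul (circDeriv B.curv φ)).div_const 2)))
      (by simp [cross]; ring) (fun s hs _ => by
        obtain ⟨-, -, -, h4⟩ := hκ φ s hs
        have h1 : cross 0 (B.tangent (φ + (s : Circ))) + cross (B.tangent φ)
            (B.curv (φ + (s : Circ)) * (Complex.I * B.tangent (φ + (s : Circ)))) -
            (B.curv φ * 1 + circDeriv B.curv φ * ((2 : ℕ) * s ^ (2 - 1)) / 2) =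
            B.curv (φ + (s : Circ)) * (dot (B.tangent φ) (B.tangent (φ + (s : Circ))) - 1) +
            (B.curv (φ + (s : Circ)) - B.curv φ - circDeriv B.curv φ * s) := by
          simp [dot, cross]
          ring
        rw [h1, Real.norm_eq_abs]
        refine (abs_add_le _ _).trans ?_
        rw [abs_mul, add_mul]
        refine add_le_add ?_ h4
        calc _ ≤ M * (M ^ 2 * s ^ 2) := mul_le_mul (hcs φ s) (hp1 φ s hs) (abs_nonneg _) hM.le
          _ = M ^ 3 * s ^ 2 := by ring)
    simpa using this
  have hC0 : ∀ (φ : Circ) (r : ℝ), 0 ≤ r → r ≤ 1 → |B.normalOut φ r -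
      (B.curv φ * r ^ 2 / 2 + circDeriv B.curv φ * r ^ 3 / 6)| ≤ (M ^ 3 + M) * r ^ 4 := by
    intro φ r hr hr1
    have := norm_le_pow_succ
      (f := fun s : ℝ => B.normalOut φ s -
        (B.curv φ * s ^ 2 / 2 + circDeriv B.curv φ * s ^ 3 / 6)) (n := 3) (M := M ^ 3 + M) hr
      (fun s => (B.hasDerivAt_normalOut φ s).sub
        ((((hasDerivAt_pow 2 s).const_mul (B.curv φ)).div_const 2).add
          (((hasDerivAt_pow 3 s).const_mul (circDeriv B.curv φ)).div_const 6)))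
      (by simp [normalOut, hch0, cross]) (fun s hs hsr => by
        refine le_of_eq_of_le ?_ (hq2 φ s hs (hsr.trans hr1))
        rw [Real.norm_eq_abs]
        congr 1
        norm_num
        ring)
    simpa using this
  have hCr1 : ∀ (φ : Circ) (r : ℝ), 0 ≤ r → |B.normalIn φ r| ≤ M * r ^ 2 := by
    intro φ r hr
    have := norm_le_pow_succ (f := B.normalIn φ) (n := 1) (M := M) hr (B.hasDerivAt_normalIn φ)
      (by simp [normalIn, hch0, cross]) (fun s hs _ => by
        rw [Real.norm_eq_abs, abs_mul, pow_one]
        refine mul_le_mul (hcs φ s) ?_ (abs_nonneg _) hM.le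
        have h1 := abs_dot_le (B.tangent (φ + (s : Circ))) (B.chord φ s)
        rw [B.norm_tangent, one_mul] at h1
        exact h1.trans (hch φ s hs))
    simpa using this
  have hA1 : ∀ (φ : Circ) (r : ℝ), 0 ≤ r → |B.tangentIn φ r - r| ≤ M ^ 2 * r ^ 3 := by
    intro φ r hr
    have := norm_le_pow_succ (f := fun s : ℝ => B.tangentIn φ s - s) (n := 2) (M := M ^ 2) hr
      (fun s => (B.hasDerivAt_tangentIn φ s).sub (hasDerivAt_id s))
      (by simp [tangentIn, hch0, dot]) (fun s hs _ => by
        rw [sub_sub_cancel_left, norm_neg, Real.norm_eq_abs, abs_mul]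
        calc _ ≤ M * (M * s ^ 2) := mul_le_mul (hcs φ s) (hCr1 φ s hs) (abs_nonneg _) hM.le
          _ = M ^ 2 * s ^ 2 := by ring)
    simpa using this
  have hCr : ∀ (φ : Circ) (r : ℝ), 0 ≤ r → r ≤ 1 → |B.normalIn φ r -
      (B.curv φ * r ^ 2 / 2 + circDeriv B.curv φ * r ^ 3 / 3)| ≤ (M ^ 3 + M) * r ^ 4 := by
    intro φ r hr hr1
    have := norm_le_pow_succ
      (f := fun s : ℝ => B.normalIn φ s -
        (B.curv φ * s ^ 2 / 2 + circDeriv B.curv φ * s ^ 3 / 3)) (n := 3) (M := M ^ 3 + M) hr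
      (fun s => (B.hasDerivAt_normalIn φ s).sub
        ((((hasDerivAt_pow 2 s).const_mul (B.curv φ)).div_const 2).add
          (((hasDerivAt_pow 3 s).const_mul (circDeriv B.curv φ)).div_const 3)))
      (by simp [normalIn, hch0, cross]) (fun s hs hsr => by
        obtain ⟨-, -, -, h4⟩ := hκ φ s hs
        have h1 : B.curv (φ + (s : Circ)) * B.tangentIn φ s -
            (B.curv φ * ((2 : ℕ) * s ^ (2 - 1)) / 2 +
              circDeriv B.curv φ * ((3 : ℕ) * s ^ (3 - 1)) / 3) =
            B.curv (φ + (s : Circ)) * (B.tangentIn φ s - s) +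
            (B.curv (φ + (s : Circ)) - B.curv φ - circDeriv B.curv φ * s) * s := by
          norm_num
          ring
        rw [h1, Real.norm_eq_abs]
        refine (abs_add_le _ _).trans ?_
        rw [abs_mul, abs_mul, abs_of_nonneg hs, add_mul]
        refine add_le_add ?_ ?_
        · calc _ ≤ M * (M ^ 2 * s ^ 3) := mul_le_mul (hcs φ s) (hA1 φ s hs) (abs_nonneg _) hM.le
            _ = M ^ 3 * s ^ 3 := by ring
        · calc _ ≤ M * s ^ 2 * s := mul_le_mul_of_nonneg_right h4 hs
            _ = M * s ^ 3 := by ring)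
    simpa using this
  refine ⟨M ^ 3 + M ^ 2 + M, by positivity, fun φ r hr hr1 => ⟨?_, ?_, ?_, ?_⟩⟩
  · exact (hA0 φ r hr).trans (mul_le_mul_of_nonneg_right (by nlinarith [pow_pos hM 3]) (by positivity))
  · exact (hA1 φ r hr).trans (mul_le_mul_of_nonneg_right (by nlinarith [pow_pos hM 3]) (by positivity))
  · exact (hC0 φ r hr hr1).trans (mul_le_mul_of_nonneg_right (by nlinarith [pow_pos hM 2]) (by positivity))
  · exact (hCr φ r hr hr1).trans (mul_le_mul_of_nonneg_right (by nlinarith [pow_pos hM 2]) (by positivity))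

end Table

end Coin

namespace Coin

open Filter Topology

namespace Table

variable (B : Table)

/-! ### Short chords -/

/-- The components of short chords, up to the leading powers of the length. -/
theorem exists_chord_scaled : ∃ κ₀ > 0, ∃ M > 0, ∀ φ : Circ, ∀ r : ℝ, 0 < r → r ≤ 1 →
    ∃ p₀ p₁ c₀ c₁ : ℝ, B.tangentOut φ r = r * p₀ ∧ B.tangentIn φ r = r * p₁ ∧
    B.normalOut φ r = r ^ 2 * c₀ ∧ B.normalIn φ r = r ^ 2 * c₁ ∧
    |p₀ - 1| ≤ M * r ^ 2 ∧ |p₁ - 1| ≤ M * r ^ 2 ∧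
    |c₀ - (B.curv φ / 2 + circDeriv B.curv φ * r / 6)| ≤ M * r ^ 2 ∧
    |c₁ - (B.curv φ / 2 + circDeriv B.curv φ * r / 3)| ≤ M * r ^ 2 ∧
    κ₀ ≤ B.curv φ ∧ B.curv φ ≤ M ∧ |circDeriv B.curv φ| ≤ M ∧
    |B.curv (φ + (r : Circ)) - B.curv φ| ≤ M * r := by
  obtain ⟨κ₀, κ₁, hκ₀, hκ⟩ := B.exists_curv_bounds
  obtain ⟨M₁, hM₁, h₁⟩ := B.exists_curv_taylor
  obtain ⟨M₂, hM₂, h₂⟩ := B.exists_chord_taylor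
  refine ⟨κ₀, hκ₀, M₁ + M₂, by positivity, fun φ r hr hr1 => ?_⟩
  obtain ⟨a1, a2, a3, -⟩ := h₁ φ r hr.le
  obtain ⟨b1, b2, b3, b4⟩ := h₂ φ r hr.le hr1
  have hscale : ∀ {x y n : ℝ} {j : ℕ}, |x - r ^ j * y| ≤ M₂ * r ^ (j + 2) →
      |x / r ^ j - y| ≤ (M₁ + M₂) * r ^ 2 := by
    intro x y n j h
    have hj := pow_pos hr j
    have e : x / r ^ j - y = (x - r ^ j * y) / r ^ j := by field_simp
    rw [e, abs_div, abs_of_pos hj, div_le_iff₀ hj]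
    refine h.trans ?_
    rw [pow_add]
    have : 0 < r ^ j * r ^ 2 := by positivity
    nlinarith
  refine ⟨B.tangentOut φ r / r ^ 1, B.tangentIn φ r / r ^ 1, B.normalOut φ r / r ^ 2,
    B.normalIn φ r / r ^ 2, by field_simp, by field_simp, by field_simp, by field_simp,
    hscale (n := 0) (by simpa using b1), hscale (n := 0) (by simpa using b2),
    hscale (n := 0) ?_, hscale (n := 0) ?_, (hκ φ).1,
    ((le_abs_self _).trans a1).trans (by linarith), a2.trans (by linarith),
    a3.trans (by nlinarith)⟩
  · refine le_of_eq_of_le ?_ b3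
    ring_nf
  · refine le_of_eq_of_le ?_ b4
    ring_nf

theorem circDeriv_radius (φ : Circ) :
    circDeriv (radius B.γ) φ = -circDeriv B.curv φ / B.curv φ ^ 2 := by
  have h1 := hasDerivAt_circ (by norm_num) B.contDiff_curv φ 0
  have h2 := h1.inv (by simpa using (B.curv_pos φ).ne')
  simp only [QuotientAddGroup.mk_zero, add_zero] at h2
  exact h2.deriv

/-- The two angles of short chords. -/
theorem exists_cotIn_sub_cotOut : ∃ K > 0, ∃ r₀ > 0, ∀ φ : Circ, ∀ r : ℝ, 0 < r → r ≤ r₀ →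
    |B.cotIn φ r - B.cotOut φ r - 2 / 3 * circDeriv (radius B.γ) φ| ≤ K * r := by
  obtain ⟨κ₀, hκ₀, M, hM, h⟩ := B.exists_chord_scaled
  -- The bound `r ≤ κ₀ / (8 M)` keeps `c₀` and `c₁` above `κ₀ / 4`, so `κ₀ ^ 4 / 16` bounds the
  -- denominator `c₀ c₁ κ ^ 2` from below; the numerator collects the errors `hN` and `hD`.
  refine ⟨(M ^ 2 * (2 * M + 4 * M ^ 2) + 2 / 3 * M * (5 * M ^ 2)) / (κ₀ ^ 4 / 16), by positivity,
    min 1 (κ₀ / (8 * M)), by positivity, fun φ r hr hr0 => ?_⟩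
  have hr1 : r ≤ 1 := hr0.trans (min_le_left _ _)
  have hr2 : r * (8 * M) ≤ κ₀ := (le_div_iff₀ (by positivity)).1 (hr0.trans (min_le_right _ _))
  obtain ⟨p₀, p₁, c₀, c₁, hA0, hA1, hC0, hC1, hp0, hp1, hc0, hc1, hκ, hκM, hκ', -⟩ := h φ r hr hr1
  rw [circDeriv_radius]
  set κ := B.curv φ
  set κ' := circDeriv B.curv φ
  have hMr : M * r ^ 2 ≤ M * r := by nlinarith [mul_pos hM hr]
  have hκr : |κ' * r| ≤ M * r := by
    rw [abs_mul, abs_of_pos hr]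
    exact mul_le_mul_of_nonneg_right hκ' hr.le
  have hd0 : |c₀ - κ / 2| ≤ 2 * M * r := by
    rw [abs_le] at hc0 hκr ⊢
    constructor <;> linarith
  have hd1 : |c₁ - κ / 2| ≤ 2 * M * r := by
    rw [abs_le] at hc1 hκr ⊢
    constructor <;> linarith
  have hl0 : κ₀ / 4 ≤ c₀ := by linarith [(abs_le.1 hd0).1]
  have hl1 : κ₀ / 4 ≤ c₁ := by linarith [(abs_le.1 hd1).1]
  have hu0 : |c₀| ≤ 2 * M := by
    rw [abs_le] at hc0 hκr ⊢
    constructor <;> nlinarith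
  have hu1 : |c₁| ≤ 2 * M := by
    rw [abs_le] at hc1 hκr ⊢
    constructor <;> nlinarith
  have hc0' : 0 < c₀ := by linarith
  have hc1' : 0 < c₁ := by linarith
  have hκ0 : 0 < κ := by linarith
  -- The leading terms cancel. The remainder `-κ' r / 6` is the difference of the cubic terms of the
  -- two normal components; divided by `r` and by `κ ^ 2 / 4` it becomes `2/3 ρ'`.
  have hN : |p₁ * c₀ - p₀ * c₁ + κ' * r / 6| ≤ (2 * M + 4 * M ^ 2) * r ^ 2 := by
    have e : p₁ * c₀ - p₀ * c₁ + κ' * r / 6 = (p₁ - 1) * c₀ - (p₀ - 1) * c₁ +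
        (c₀ - (κ / 2 + κ' * r / 6)) - (c₁ - (κ / 2 + κ' * r / 3)) := by ring
    have e1 : |(p₁ - 1) * c₀| ≤ M * r ^ 2 * (2 * M) := by
      rw [abs_mul]
      exact mul_le_mul hp1 hu0 (abs_nonneg _) (by positivity)
    have e2 : |(p₀ - 1) * c₁| ≤ M * r ^ 2 * (2 * M) := by
      rw [abs_mul]
      exact mul_le_mul hp0 hu1 (abs_nonneg _) (by positivity)
    rw [e]
    rw [abs_le] at e1 e2 hc0 hc1 ⊢
    constructor <;> linarith
  have hD : |c₀ * c₁ - κ ^ 2 / 4| ≤ 5 * M ^ 2 * r := by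
    have e : c₀ * c₁ - κ ^ 2 / 4 = (c₀ - κ / 2) * c₁ + κ / 2 * (c₁ - κ / 2) := by ring
    have e1 : |(c₀ - κ / 2) * c₁| ≤ 2 * M * r * (2 * M) := by
      rw [abs_mul]
      exact mul_le_mul hd0 hu1 (abs_nonneg _) (by positivity)
    have e2 : |κ / 2 * (c₁ - κ / 2)| ≤ M / 2 * (2 * M * r) := by
      rw [abs_mul, abs_of_pos (by positivity : 0 < κ / 2)]
      exact mul_le_mul (by linarith) hd1 (abs_nonneg _) (by positivity)
    rw [e]
    refine (abs_add_le _ _).trans ?_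
    linarith
  have hEq : B.cotIn φ r - B.cotOut φ r - 2 / 3 * (-κ' / κ ^ 2) =
      (κ ^ 2 * ((p₁ * c₀ - p₀ * c₁ + κ' * r / 6) / r) +
        2 / 3 * κ' * (c₀ * c₁ - κ ^ 2 / 4)) / (c₀ * c₁ * κ ^ 2) := by
    rw [cotIn, cotOut, hA0, hA1, hC0, hC1]
    field_simp
    ring
  rw [hEq, abs_div, abs_of_pos (by positivity : 0 < c₀ * c₁ * κ ^ 2), div_mul_eq_mul_div (_ + _)]
  have hden : κ₀ ^ 4 / 16 ≤ c₀ * c₁ * κ ^ 2 := by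
    calc κ₀ ^ 4 / 16 = κ₀ / 4 * (κ₀ / 4) * κ₀ ^ 2 := by ring
      _ ≤ _ := by gcongr
  have hnum : |κ ^ 2 * ((p₁ * c₀ - p₀ * c₁ + κ' * r / 6) / r) +
      2 / 3 * κ' * (c₀ * c₁ - κ ^ 2 / 4)| ≤
      (M ^ 2 * (2 * M + 4 * M ^ 2) + 2 / 3 * M * (5 * M ^ 2)) * r := by
    refine (abs_add_le _ _).trans ?_
    rw [add_mul]
    refine add_le_add ?_ ?_
    · rw [abs_mul, abs_of_pos (by positivity : 0 < κ ^ 2), mul_assoc]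
      refine mul_le_mul (pow_le_pow_left₀ hκ0.le hκM 2) ?_ (abs_nonneg _) (by positivity)
      rw [abs_div, abs_of_pos hr, div_le_iff₀ hr]
      linarith
    · rw [abs_mul, abs_mul, abs_of_pos (by norm_num : (0 : ℝ) < 2 / 3), mul_assoc (2 / 3 * M)]
      exact mul_le_mul (mul_le_mul_of_nonneg_left hκ' (by norm_num)) hD (abs_nonneg _)
        (by positivity)
  exact div_le_div₀ (by positivity) hnum (by positivity) hden

/-- Far from the ends, short chords ending further ahead meet the boundary so much more steeply
that the passage along the side of the coin reverses their order. -/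
theorem exists_strictAntiOn_add_cotIn {ℓ : ℝ} (hℓ : 0 < ℓ) : ∃ r₀ > 0, ∀ φ : Circ,
    StrictAntiOn (fun r => r + ℓ * B.cotIn φ r) (Set.Ioo 0 r₀) := by
  obtain ⟨κ₀, hκ₀, M, hM, h⟩ := B.exists_chord_scaled
  refine ⟨min 1 (ℓ * κ₀ / 2 / (4 * M ^ 2 + ℓ * (3 * M + 2 * M ^ 2))), by positivity, fun φ => ?_⟩
  have hpi := Real.pi_gt_three
  have hder : ∀ r, 0 < r → r ≤ 1 → HasDerivAt (fun r => r + ℓ * B.cotIn φ r)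
      (1 + ℓ * ((B.normalIn φ r - B.curv (φ + (r : Circ)) *
      (B.tangentIn φ r ^ 2 + B.normalIn φ r ^ 2)) / B.normalIn φ r ^ 2)) r := fun r h0 h1 =>
    (hasDerivAt_id r).add ((B.hasDerivAt_cotIn φ h0 (by linarith)).const_mul ℓ)
  refine strictAntiOn_of_deriv_neg (convex_Ioo _ _) (fun r hr =>
    (hder r hr.1 (hr.2.le.trans (min_le_left _ _))).continuousAt.continuousWithinAt) fun r hr => ?_
  rw [interior_Ioo] at hr
  obtain ⟨hr, hr0⟩ := hr
  have hr1 : r ≤ 1 := hr0.le.trans (min_le_left _ _)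
  have hr2 : r * (4 * M ^ 2 + ℓ * (3 * M + 2 * M ^ 2)) < ℓ * κ₀ / 2 :=
    (lt_div_iff₀ (by positivity)).1 (hr0.trans_le (min_le_right _ _))
  have hpos := B.normalIn_pos φ hr (by linarith : r < 2 * Real.pi)
  have hcb := B.curv_pos (φ + (r : Circ))
  rw [(hder r hr hr1).deriv]
  obtain ⟨p₀, p₁, c₀, c₁, -, hA1, -, hC1, -, hp1, -, hc1, hκ, hκM, hκ', hb⟩ := h φ r hr hr1
  have hκr : |circDeriv B.curv φ * r| ≤ M * r := by
    rw [abs_mul, abs_of_pos hr]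
    exact mul_le_mul_of_nonneg_right hκ' hr.le
  have hMr : M * r ^ 2 ≤ M * r := by nlinarith [mul_pos hM hr]
  have hMM : 0 < M * r := mul_pos hM hr
  have hc : 0 < c₁ := by
    rw [hC1] at hpos
    exact pos_of_mul_pos_right hpos (by positivity)
  have hcu : c₁ ≤ B.curv φ / 2 + 2 * (M * r) := by
    linarith [(abs_le.1 hc1).2, (abs_le.1 hκr).2]
  have hcu2 : c₁ ≤ 2 * M := by
    have : M * r ≤ M := by nlinarith
    linarith [(abs_le.1 hc1).2, (abs_le.1 hκr).2]
  set κ := B.curv φ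
  set β := B.curv (φ + (r : Circ))
  -- To leading order `c₁ = κ / 2` and `β p₁ ^ 2 = κ`, a gap of `ℓ κ / 2`; the choice of `r₀` makes
  -- the errors smaller than this.
  have hmain : r ^ 2 * c₁ ^ 2 + ℓ * c₁ < ℓ * (β * p₁ ^ 2) := by
    have h1 : κ - M * r - 2 * M * (M * r) ≤ β * p₁ ^ 2 := by
      have e1 : 1 - 2 * (M * r) ≤ p₁ ^ 2 := by nlinarith [(abs_le.1 hp1).1, sq_nonneg (p₁ - 1)]
      rcases le_or_gt (1 - 2 * (M * r)) 0 with h0 | h0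
      · have : 0 < β * p₁ ^ 2 ∨ 0 = β * p₁ ^ 2 := (by positivity : 0 ≤ β * p₁ ^ 2).lt_or_eq
        have : 0 ≤ β * p₁ ^ 2 := by positivity
        nlinarith
      · have e2 : (κ - M * r) * (1 - 2 * (M * r)) ≤ β * p₁ ^ 2 :=
          (mul_le_mul_of_nonneg_right (by linarith [(abs_le.1 hb).1]) h0.le).trans
            (mul_le_mul_of_nonneg_left e1 hcb.le)
        nlinarith [sq_nonneg (M * r)]
    have h2 : r ^ 2 * c₁ ^ 2 ≤ 4 * M ^ 2 * r := by
      have : c₁ ^ 2 ≤ (2 * M) ^ 2 := pow_le_pow_left₀ hc.le hcu2 2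
      have h3 : r ^ 2 ≤ r := by nlinarith
      calc r ^ 2 * c₁ ^ 2 ≤ r * (2 * M) ^ 2 := by gcongr
        _ = _ := by ring
    have h3 := mul_le_mul_of_nonneg_left h1 hℓ.le
    have h4 := mul_le_mul_of_nonneg_left hcu hℓ.le
    have h5 := mul_le_mul_of_nonneg_left hκ hℓ.le
    linarith
  have hr4 : 0 < r ^ 2 := by positivity
  have e : 1 + ℓ * ((B.normalIn φ r - β * (B.tangentIn φ r ^ 2 + B.normalIn φ r ^ 2)) /
      B.normalIn φ r ^ 2) =
      ((r ^ 2 * c₁ ^ 2 + ℓ * c₁ - ℓ * (β * p₁ ^ 2)) - ℓ * β * (r ^ 2 * c₁ ^ 2)) /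
        (r ^ 2 * c₁ ^ 2) := by
    rw [hA1, hC1]
    field_simp
    ring
  rw [e]
  refine div_neg_of_neg_of_pos ?_ (by positivity)
  have : 0 < ℓ * β * (r ^ 2 * c₁ ^ 2) := by positivity
  linarith

theorem continuous_normalOut : Continuous fun x : Circ × ℝ => B.normalOut x.1 x.2 := by
  have h1 := B.continuous_tangent
  have h2 := B.continuous_γ
  have h3 : Continuous ((↑) : ℝ → Circ) := AddCircle.continuous_mk' _
  unfold normalOut cross chord
  fun_prop

theorem continuous_tangentOut : Continuous fun x : Circ × ℝ => B.tangentOut x.1 x.2 := by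
  have h1 := B.continuous_tangent
  have h2 := B.continuous_γ
  have h3 : Continuous ((↑) : ℝ → Circ) := AddCircle.continuous_mk' _
  unfold tangentOut dot chord
  fun_prop

theorem continuousAt_cotOut {φ : Circ} {r : ℝ} (h0 : 0 < r) (h1 : r < 2 * Real.pi) :
    ContinuousAt (fun x : Circ × ℝ => B.cotOut x.1 x.2) (φ, r) :=
  B.continuous_tangentOut.continuousAt.div B.continuous_normalOut.continuousAt
    (B.normalOut_pos φ h0 h1).ne'

theorem continuous_cotOut_left {r : ℝ} (h0 : 0 < r) (h1 : r < 2 * Real.pi) :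
    Continuous fun φ => B.cotOut φ r :=
  continuous_iff_continuousAt.2 fun φ => (B.continuousAt_cotOut (φ := φ) h0 h1).comp
    (f := fun φ : Circ => (φ, r)) (by fun_prop)

/-- Chords with a small angle at one of their ends are short. -/
theorem exists_short {r₀ : ℝ} (hr₀ : 0 < r₀) : ∃ k : ℝ, ∀ (φ : Circ) (r : ℝ), 0 < r →
    r < 2 * Real.pi → (k < B.cotOut φ r ∨ k < B.cotIn φ r) → r < r₀ := by
  have hpi := Real.pi_gt_three
  set s := min r₀ 1 with hs
  have hs0 : 0 < s := by positivity
  have hs1 : s ≤ 1 := min_le_right _ _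
  obtain ⟨k₁, -, h1⟩ := exists_bound_circ (B.continuous_cotOut_left hs0 (by linarith))
  obtain ⟨k₂, -, h2⟩ := exists_bound_circ
    (B.continuous_cotOut_left (r := 2 * Real.pi - s) (by linarith) (by linarith))
  refine ⟨max k₁ k₂, fun φ r h0 hr h => ?_⟩
  by_contra! hcon
  have hsr : s ≤ r := (min_le_left _ _).trans hcon
  -- The cotangent at the initial point decreases with the length, so for chords longer than `s` it
  -- is bounded by its values at `s`. The final point is treated through the reversed chord.
  rcases h with h | h
  · have := (B.strictAntiOn_cotOut φ).antitoneOn ⟨hs0, by linarith⟩ ⟨h0, hr⟩ hsr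
    have := (le_abs_self _).trans (h1 φ)
    linarith [le_max_left k₁ k₂]
  · have h3 := B.cotOut_reverse φ r
    have := (B.strictAntiOn_cotOut (φ + (r : Circ))).antitoneOn
      (⟨by linarith, by linarith⟩ : 2 * Real.pi - r ∈ Set.Ioo 0 (2 * Real.pi))
      (⟨by linarith, by linarith⟩ : 2 * Real.pi - s ∈ Set.Ioo 0 (2 * Real.pi)) (by linarith)
    have := (neg_le_abs _).trans (h2 (φ + (r : Circ)))
    linarith [le_max_right k₁ k₂]

/-! ### The billiard map in the cotangent coordinate -/

theorem exists_coe_eq (ψ : Circ) (h : ψ ≠ 0) : ∃ r : ℝ, 0 < r ∧ r < 2 * Real.pi ∧ (r : Circ) = ψ := by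
  have : Fact (0 < 2 * Real.pi) := ⟨Real.two_pi_pos⟩
  obtain ⟨r, hr, rfl⟩ := AddCircle.coe_image_Ico_eq (2 * Real.pi) 0 |>.symm ▸ Set.mem_univ ψ
  refine ⟨r, hr.1.lt_of_ne fun h0 => h ?_, by simpa using hr.2, rfl⟩
  rw [← h0]
  rfl

/-- A billiard step along the chord of parameter length `r`. -/
theorem exists_of_isBilliardStep {x y : Phase} (h : IsBilliardStep B.γ x y) :
    ∃ r : ℝ, 0 < r ∧ r < 2 * Real.pi ∧ y.1 = x.1 + (r : Circ) ∧
      B.cotOut x.1 r = Real.cot x.2 ∧ B.cotIn x.1 r = Real.cot y.2 := by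
  obtain ⟨⟨t, ht, h1⟩, h2⟩ := h
  obtain ⟨φ, θ, hθ⟩ := x
  obtain ⟨ψ, η, hη⟩ := y
  simp only at h1 h2
  have hτ := B.dot_tangent φ
  have hτ' := B.dot_tangent ψ
  have hne : ψ - φ ≠ 0 := by
    intro h
    rw [sub_eq_zero.1 h] at h1
    have h3 : (t : ℂ) * (Complex.exp ((θ : ℝ) * Complex.I) * circDeriv B.γ φ) = 0 := by
      simpa using h1.symm
    have h4 : circDeriv B.γ φ ≠ 0 := fun h0 => by
      have := B.unit_speed φ
      simp [h0] at this
    simp [ht.ne', Complex.exp_ne_zero, h4] at h3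
  obtain ⟨r, h0, hr, hrψ⟩ := exists_coe_eq _ hne
  have hψ : ψ = φ + (r : Circ) := by
    rw [hrψ]
    abel
  have hch : B.chord φ r = t * (Complex.exp ((θ : ℝ) * Complex.I) * B.tangent φ) := by
    rw [chord, ← hψ, h1]
    simp [tangent]
  have hch' : B.chord φ r = t * (Complex.exp (((-η : ℝ) : ℂ) * Complex.I) * B.tangent ψ) := by
    rw [hch]
    congr 1
    exact_mod_cast h2
  rw [Complex.exp_mul_I, ← Complex.ofReal_cos, ← Complex.ofReal_sin] at hch hch'
  refine ⟨r, h0, hr, hψ, ?_, ?_⟩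
  · have hs := (Real.sin_pos_of_mem_Ioo hθ).ne'
    have e1 : B.tangentOut φ r = t * Real.cos θ := by
      rw [tangentOut, hch]
      simp only [dot] at hτ ⊢
      simp [Complex.cos_ofReal_re, Complex.sin_ofReal_re]
      linear_combination t * Real.cos θ * hτ
    have e2 : B.normalOut φ r = t * Real.sin θ := by
      rw [normalOut, hch]
      simp only [dot, cross] at hτ ⊢
      simp [Complex.cos_ofReal_re, Complex.sin_ofReal_re]
      linear_combination t * Real.sin θ * hτ
    simp only
    rw [cotOut, e1, e2, Real.cot_eq_cos_div_sin]
    field_simp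
  · have hs := (Real.sin_pos_of_mem_Ioo hη).ne'
    have e1 : B.tangentIn φ r = t * Real.cos η := by
      rw [tangentIn, ← hψ, hch']
      simp only [dot] at hτ' ⊢
      simp [Complex.cos_ofReal_re, Complex.sin_ofReal_re]
      linear_combination t * Real.cos η * hτ'
    have e2 : B.normalIn φ r = t * Real.sin η := by
      rw [normalIn, ← hψ, hch']
      simp only [dot, cross] at hτ' ⊢
      simp [Complex.cos_ofReal_re, Complex.sin_ofReal_re]
      linear_combination t * Real.sin η * hτ'
    simp only
    rw [cotIn, e1, e2, Real.cot_eq_cos_div_sin]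
    field_simp

end Table

/-- The angle in `(0, π)` with a given cotangent. -/
noncomputable def arccot (u : ℝ) : ℝ := Real.pi / 2 - Real.arctan u

theorem arccot_mem (u : ℝ) : arccot u ∈ Set.Ioo 0 Real.pi :=
  ⟨by linarith [Real.arctan_lt_pi_div_two u, arccot.eq_def u],
    by linarith [Real.neg_pi_div_two_lt_arctan u, arccot.eq_def u]⟩

theorem cot_arccot (u : ℝ) : Real.cot (arccot u) = u := by
  rw [Real.cot_eq_cos_div_sin, arccot, Real.cos_pi_div_two_sub, Real.sin_pi_div_two_sub,
    ← Real.tan_eq_sin_div_cos, Real.tan_arctan]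

theorem arccot_cot {θ : ℝ} (h : θ ∈ Set.Ioo 0 Real.pi) : arccot (Real.cot θ) = θ := by
  have h1 : Real.cot θ = Real.tan (Real.pi / 2 - θ) := by
    rw [Real.tan_eq_sin_div_cos, Real.sin_pi_div_two_sub, Real.cos_pi_div_two_sub,
      Real.cot_eq_cos_div_sin]
  rw [arccot, h1, Real.arctan_tan (by linarith [h.2]) (by linarith [h.1])]
  ring

theorem continuous_arccot : Continuous arccot := continuous_const.sub Real.continuous_arctan

namespace Table

variable (B : Table)

/-- Surjectivity comes from the existence of the billiard step with the initial angle `arccot u`. -/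
theorem exists_cotOut_eq (φ : Circ) (u : ℝ) :
    ∃ r : ℝ, 0 < r ∧ r < 2 * Real.pi ∧ B.cotOut φ r = u := by
  obtain ⟨r, h0, h1, -, h2, -⟩ :=
    B.exists_of_isBilliardStep (B.billiardMap_spec (φ, ⟨arccot u, arccot_mem u⟩))
  exact ⟨r, h0, h1, by simpa [cot_arccot] using h2⟩

/-- The parameter length of the chord which starts with a given cotangent. -/
noncomputable def reach (φ : Circ) (u : ℝ) : ℝ := (B.exists_cotOut_eq φ u).choose

theorem reach_pos (φ : Circ) (u : ℝ) : 0 < B.reach φ u := (B.exists_cotOut_eq φ u).choose_spec.1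

theorem reach_lt (φ : Circ) (u : ℝ) : B.reach φ u < 2 * Real.pi :=
  (B.exists_cotOut_eq φ u).choose_spec.2.1

theorem cotOut_reach (φ : Circ) (u : ℝ) : B.cotOut φ (B.reach φ u) = u :=
  (B.exists_cotOut_eq φ u).choose_spec.2.2

theorem reach_cotOut (φ : Circ) {r : ℝ} (h0 : 0 < r) (h1 : r < 2 * Real.pi) :
    B.reach φ (B.cotOut φ r) = r :=
  (B.strictAntiOn_cotOut φ).injOn ⟨B.reach_pos _ _, B.reach_lt _ _⟩ ⟨h0, h1⟩ (B.cotOut_reach _ _)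

theorem strictAnti_reach (φ : Circ) : StrictAnti (B.reach φ) := by
  intro u v huv
  by_contra! h
  have := (B.strictAntiOn_cotOut φ).antitoneOn ⟨B.reach_pos _ _, B.reach_lt _ _⟩
    ⟨B.reach_pos _ _, B.reach_lt _ _⟩ h
  rw [cotOut_reach, cotOut_reach] at this
  linarith

/-- For a fixed length `s` the sign of `cotOut φ s - u` is stable under small changes of `φ` and `u`
where it is nonzero, and by monotonicity it decides on which side of `s` the reach lies. -/
theorem continuous_reach : Continuous fun x : Circ × ℝ => B.reach x.1 x.2 := by
  rw [continuous_iff_continuousAt]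
  rintro ⟨φ, u⟩
  have key : ∀ s, 0 < s → s < 2 * Real.pi →
      ContinuousAt (fun x : Circ × ℝ => B.cotOut x.1 s - x.2) (φ, u) := fun s h0 h1 =>
    (((B.continuous_cotOut_left h0 h1).comp continuous_fst).sub continuous_snd).continuousAt
  have h0 := B.reach_pos φ u
  have h1 := B.reach_lt φ u
  rw [ContinuousAt, tendsto_order]
  constructor
  · intro a ha
    obtain ⟨s, hs1, hs2⟩ := exists_between (max_lt ha h0)
    have hs0 : 0 < s := (le_max_right _ _).trans_lt hs1
    have h2 : 0 < B.cotOut φ s - u := by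
      have := B.strictAntiOn_cotOut φ ⟨hs0, hs2.trans h1⟩ ⟨h0, h1⟩ hs2
      rw [cotOut_reach] at this
      linarith
    filter_upwards [(key s hs0 (hs2.trans h1)).eventually (lt_mem_nhds h2)] with x hx
    refine ((le_max_left _ _).trans_lt hs1).trans ?_
    by_contra! hcon
    have := (B.strictAntiOn_cotOut x.1).antitoneOn ⟨B.reach_pos _ _, B.reach_lt _ _⟩
      ⟨hs0, hs2.trans h1⟩ hcon
    rw [cotOut_reach] at this
    linarith
  · intro a ha
    obtain ⟨s, hs1, hs2⟩ := exists_between (lt_min ha h1)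
    have hs0 : 0 < s := h0.trans hs1
    have hs3 : s < 2 * Real.pi := hs2.trans_le (min_le_right _ _)
    have h2 : B.cotOut φ s - u < 0 := by
      have := B.strictAntiOn_cotOut φ ⟨h0, h1⟩ ⟨hs0, hs3⟩ hs1
      rw [cotOut_reach] at this
      linarith
    filter_upwards [(key s hs0 hs3).eventually (gt_mem_nhds h2)] with x hx
    refine lt_trans ?_ (hs2.trans_le (min_le_left _ _))
    by_contra! hcon
    have := (B.strictAntiOn_cotOut x.1).antitoneOn ⟨hs0, hs3⟩
      ⟨B.reach_pos _ _, B.reach_lt _ _⟩ hcon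
    rw [cotOut_reach] at this
    linarith

/-- The cotangent of the angle after the billiard step. -/
noncomputable def nextCot (φ : Circ) (u : ℝ) : ℝ := B.cotIn φ (B.reach φ u)

theorem nextCot_eq (φ : Circ) (u : ℝ) :
    B.nextCot φ u = -B.cotOut (φ + (B.reach φ u : Circ)) (2 * Real.pi - B.reach φ u) := by
  rw [cotOut_reverse, neg_neg, nextCot]

theorem continuous_nextCot : Continuous fun x : Circ × ℝ => B.nextCot x.1 x.2 := by
  simp only [nextCot_eq]
  rw [continuous_iff_continuousAt]
  intro x
  have h3 : Continuous ((↑) : ℝ → Circ) := AddCircle.continuous_mk' _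
  have h4 := B.continuous_reach
  refine ((B.continuousAt_cotOut (φ := x.1 + (B.reach x.1 x.2 : Circ))
    (r := 2 * Real.pi - B.reach x.1 x.2) (by linarith [B.reach_lt x.1 x.2])
    (by linarith [B.reach_pos x.1 x.2])).comp (x := x) (f := fun x : Circ × ℝ =>
      (x.1 + (B.reach x.1 x.2 : Circ), 2 * Real.pi - B.reach x.1 x.2)) ?_).neg
  exact Continuous.continuousAt (by fun_prop)

theorem reach_reverse (φ : Circ) (u : ℝ) :
    B.reach (φ + (B.reach φ u : Circ)) (-B.nextCot φ u) = 2 * Real.pi - B.reach φ u := by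
  rw [nextCot_eq, neg_neg]
  exact B.reach_cotOut _ (by linarith [B.reach_lt φ u]) (by linarith [B.reach_pos φ u])

theorem nextCot_reverse (φ : Circ) (u : ℝ) :
    B.nextCot (φ + (B.reach φ u : Circ)) (-B.nextCot φ u) = -u := by
  conv_lhs => rw [nextCot, reach_reverse, cotIn_reverse, cotOut_reach]

/-- The billiard map in the cotangent coordinate. -/
theorem billiardMap_eq (φ : Circ) (u : ℝ) (θ : Set.Ioo (0 : ℝ) Real.pi) (hθ : Real.cot θ = u) :
    (B.billiardMap (φ, θ)).1 = φ + (B.reach φ u : Circ) ∧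
      Real.cot (B.billiardMap (φ, θ)).2 = B.nextCot φ u := by
  obtain ⟨r, h0, h1, h2, h3, h4⟩ := B.exists_of_isBilliardStep (B.billiardMap_spec (φ, θ))
  simp only [hθ] at h2 h3 h4
  have : B.reach φ u = r := by rw [← h3, B.reach_cotOut φ h0 h1]
  rw [nextCot, this]
  exact ⟨h2, h4.symm⟩

end Table

end Coin

namespace Coin

open Filter Topology

/-! ### The turn of a vector under a billiard step and a passage along the side -/

/-- Nonzero vectors with equal real parts can be opposite only if they are vertical. -/
theorem div_mem_slitPlane_of_re_eq {v w : ℂ} (hv : v ≠ 0) (h : w.re = v.re)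
    (h' : v.re = 0 → 0 < v.im * w.im) : w / v ∈ Complex.slitPlane := by
  have hn := Complex.normSq_pos.2 hv
  rw [Complex.mem_slitPlane_iff]
  by_contra! hcon
  obtain ⟨h1, h2⟩ := hcon
  rw [Complex.div_re, ← add_div] at h1
  rw [Complex.div_im, ← sub_div, div_eq_zero_iff, or_iff_left hn.ne'] at h2
  have h3 : w.re * v.re + w.im * v.im ≤ 0 := by
    by_contra! h4
    exact absurd h1 (not_le.2 (div_pos h4 hn))
  rw [h] at h2 h3
  have h5 : v.re * (w.im - v.im) = 0 := by linarith
  rcases mul_eq_zero.1 h5 with h0 | h0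
  · have := h' h0
    rw [h0] at h3
    linarith
  · rw [sub_eq_zero.1 h0] at h3
    rw [Complex.normSq_apply] at hn
    linarith

theorem div_mem_slitPlane_of_im_eq {v w : ℂ} (hv : v ≠ 0) (h : w.im = v.im)
    (h' : v.im = 0 → 0 < v.re * w.re) : w / v ∈ Complex.slitPlane := by
  have hn := Complex.normSq_pos.2 hv
  rw [Complex.mem_slitPlane_iff]
  by_contra! hcon
  obtain ⟨h1, h2⟩ := hcon
  rw [Complex.div_re, ← add_div] at h1
  rw [Complex.div_im, ← sub_div, div_eq_zero_iff, or_iff_left hn.ne'] at h2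
  have h3 : w.re * v.re + w.im * v.im ≤ 0 := by
    by_contra! h4
    exact absurd h1 (not_le.2 (div_pos h4 hn))
  rw [h] at h2 h3
  have h5 : v.im * (w.re - v.re) = 0 := by linarith
  rcases mul_eq_zero.1 h5 with h0 | h0
  · have := h' h0
    rw [h0] at h3
    linarith
  · rw [sub_eq_zero.1 h0] at h3
    rw [Complex.normSq_apply] at hn
    linarith

theorem abs_arg_lt_pi {z : ℂ} (h : z ∈ Complex.slitPlane) : |z.arg| < Real.pi :=
  abs_lt.2 ⟨Complex.neg_pi_lt_arg z,
    (Complex.arg_le_pi z).lt_of_ne (Complex.mem_slitPlane_iff_arg.1 h).1⟩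

/-- The turn from the vector `(a, u)` to the vector `(b + ℓ w, w)`, when `(a, u)` is the difference
of two points and `(b, w)` the difference of their images under a billiard map. -/
noncomputable def stepTurn (ℓ a u b w : ℝ) : ℝ :=
  ((⟨a, -b⟩ / ⟨a, u⟩ : ℂ)).arg + Real.pi / 2 + ((⟨b, w⟩ / ⟨b, a⟩ : ℂ)).arg +
    ((⟨b + ℓ * w, w⟩ / ⟨b, w⟩ : ℂ)).arg

theorem stepTurn_neg (ℓ a u b w : ℝ) : stepTurn ℓ (-a) (-u) (-b) (-w) = stepTurn ℓ a u b w := by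
  have h : ∀ x y : ℝ, (⟨-x, -y⟩ : ℂ) = -⟨x, y⟩ := fun x y => by apply Complex.ext <;> simp
  have h1 : -b + ℓ * -w = -(b + ℓ * w) := by ring
  simp only [stepTurn, h1, h, neg_div_neg_eq]

/-- The sign rules for the differences `(a, u)` of two points and `(b, w)` of their images under
a billiard map. -/
structure StepSigns (a u b w : ℝ) : Prop where
  ne : a ≠ 0 ∨ u ≠ 0
  neg : a = 0 → u * b < 0
  pos : b = 0 → 0 < a * w

namespace StepSigns

variable {a u b w : ℝ}

theorem ne₀ (h : StepSigns a u b w) : (⟨a, u⟩ : ℂ) ≠ 0 := by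
  intro h0
  rcases h.ne with h1 | h1
  · exact h1 (congrArg Complex.re h0)
  · exact h1 (congrArg Complex.im h0)

theorem ne₁ (h : StepSigns a u b w) : (⟨a, -b⟩ : ℂ) ≠ 0 := by
  intro h0
  have h1 := h.neg (congrArg Complex.re h0)
  have h2 : -b = 0 := congrArg Complex.im h0
  rw [neg_eq_zero.1 h2] at h1
  simp at h1

theorem ne₂ (h : StepSigns a u b w) : (⟨b, a⟩ : ℂ) ≠ 0 := by
  intro h0
  have h1 := h.pos (congrArg Complex.re h0)
  have h2 : a = 0 := congrArg Complex.im h0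
  rw [h2] at h1
  simp at h1

theorem ne₃ (h : StepSigns a u b w) : (⟨b, w⟩ : ℂ) ≠ 0 := by
  intro h0
  have h1 := h.pos (congrArg Complex.re h0)
  have h2 : w = 0 := congrArg Complex.im h0
  rw [h2] at h1
  simp at h1

theorem slit₁ (h : StepSigns a u b w) : (⟨a, -b⟩ / ⟨a, u⟩ : ℂ) ∈ Complex.slitPlane :=
  div_mem_slitPlane_of_re_eq h.ne₀ rfl fun h0 => by
    have := h.neg h0
    simp only
    linarith

theorem slit₂ (h : StepSigns a u b w) : (⟨b, w⟩ / ⟨b, a⟩ : ℂ) ∈ Complex.slitPlane :=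
  div_mem_slitPlane_of_re_eq h.ne₂ rfl fun h0 => h.pos h0

theorem slit₃ (h : StepSigns a u b w) (ℓ : ℝ) :
    (⟨b + ℓ * w, w⟩ / ⟨b, w⟩ : ℂ) ∈ Complex.slitPlane :=
  div_mem_slitPlane_of_im_eq h.ne₃ rfl fun h0 => by
    have h1 : w = 0 := h0
    have h2 : b ≠ 0 := fun h2 => h.ne₃ (by rw [h1, h2]; rfl)
    simp only [h1, mul_zero, add_zero]
    exact mul_self_pos.2 h2

/-- The vector passes from `(a, u)` through `(a, -b)`, its quarter turn `(b, a)` and `(b, w)` to the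
final one. Apart from the quarter turn, neighbours share a coordinate and the sign rules keep them
from being opposite, so that each of these turns is smaller than `π`. -/
theorem turn (h : StepSigns a u b w) (ℓ : ℝ) {θ : ℝ} (hθ : IsAngle ⟨a, u⟩ θ) :
    ∃ θ₁ θ₃, IsAngle ⟨a, -b⟩ θ₁ ∧ IsAngle ⟨b, w⟩ θ₃ ∧
      IsAngle ⟨b + ℓ * w, w⟩ (θ + stepTurn ℓ a u b w) ∧ |θ₁ - θ| < Real.pi ∧
      |θ₃ - (θ₁ + Real.pi / 2)| < Real.pi ∧ |θ + stepTurn ℓ a u b w - θ₃| < Real.pi := by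
  have h1 := hθ.add_arg (w := ⟨a, -b⟩) h.ne₀
  have h2 := h1.mul_I
  have e : Complex.I * ⟨a, -b⟩ = ⟨b, a⟩ := by apply Complex.ext <;> simp
  rw [e] at h2
  have h3 := h2.add_arg (w := ⟨b, w⟩) h.ne₂
  have h4 := h3.add_arg (w := ⟨b + ℓ * w, w⟩) h.ne₃
  have e : ∀ x y z t s : ℝ, x + y + z + t + s = x + (y + z + t + s) := fun _ _ _ _ _ => by ring
  rw [e] at h4
  refine ⟨_, _, h1, h3, h4, ?_, ?_, ?_⟩
  · rw [add_sub_cancel_left]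
    exact abs_arg_lt_pi h.slit₁
  · rw [add_sub_cancel_left]
    exact abs_arg_lt_pi h.slit₂
  · rw [stepTurn, ← e, add_sub_cancel_left]
    exact abs_arg_lt_pi (h.slit₃ ℓ)

/-- The angles are located one after the other: each turn is smaller than `π`, so the sign of a
coordinate decides in which half turn the next angle lies. -/
theorem stepTurn_right (h : StepSigns a u b w) {ℓ : ℝ} (ha : 0 < a) (hb : 0 < b)
    (hc : 0 < b + ℓ * w) : |stepTurn ℓ a u b w| < Real.pi := by
  have hθ := IsAngle.arg (⟨a, u⟩ : ℂ)
  have h0 : |(⟨a, u⟩ : ℂ).arg| < Real.pi / 2 := Complex.abs_arg_lt_pi_div_two_iff.2 (Or.inl ha)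
  set θ := (⟨a, u⟩ : ℂ).arg
  obtain ⟨θ₁, θ₃, h1, h3, h4, d1, d2, d3⟩ := h.turn ℓ hθ
  have i1 := half_turn (c := 0) (by simpa using h0.le) d1 (by simpa using h1.cos_pos ha)
  rw [sub_zero] at i1
  have j1 : θ₁ < 0 := by
    by_contra! hcon
    have := Real.sin_nonneg_of_nonneg_of_le_pi hcon (by linarith [(abs_lt.1 i1).2, Real.pi_pos])
    have := h1.sin_neg (by simpa using hb)
    linarith
  have i3 := half_turn (c := 0) (by
    rw [abs_le]
    constructor <;> linarith [(abs_lt.1 i1).1, Real.pi_pos]) d2 (by simpa using h3.cos_pos hb)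
  have i4 := half_turn (c := 0) i3.le d3 (by simpa using h4.cos_pos hc)
  rw [abs_lt] at i4 h0 ⊢
  constructor <;> linarith

theorem stepTurn_left (h : StepSigns a u b w) {ℓ : ℝ} (ha : a < 0) (hb : b < 0)
    (hc : b + ℓ * w < 0) : |stepTurn ℓ a u b w| < Real.pi := by
  rw [← stepTurn_neg]
  refine StepSigns.stepTurn_right ⟨?_, ?_, ?_⟩ (by linarith) (by linarith) (by linarith)
  · simpa using h.ne
  · intro h0
    linarith
  · intro h0
    linarith

/-- The billiard step tilts the upward vector to the left and the shear carries it over to the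
right. The angles on the way are `π/2`, again `π/2`, then `π` after the quarter turn, one in `(π/2,
π)`, and finally one in `(0, π/2)`. -/
theorem stepTurn_vertical (h : StepSigns a u b w) {ℓ : ℝ} (hℓ : 0 < ℓ) (ha : a = 0) (hu : 0 < u)
    (hc : 0 < b + ℓ * w) : -Real.pi < stepTurn ℓ a u b w ∧ stepTurn ℓ a u b w < 0 := by
  have hpi := Real.pi_pos
  have hb : b < 0 := by
    have := h.neg ha
    by_contra! h0
    nlinarith
  have hw : 0 < w := by
    by_contra! h0
    nlinarith
  obtain ⟨θ₁, θ₃, h1, h3, h4, d1, d2, d3⟩ := h.turn ℓ (IsAngle.of_up ha hu)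
  have i1 := half_turn (c := Real.pi / 2) (by simp; positivity) d1 (by
    rw [Real.cos_sub_pi_div_two]
    exact h1.sin_pos (by simpa using hb))
  have j1 : θ₁ = Real.pi / 2 := by
    rw [abs_lt] at i1
    have e := h1.re_eq
    have e1 : (⟨a, -b⟩ : ℂ).re = 0 := ha
    rw [e1, eq_comm, mul_eq_zero, or_iff_right (by simpa using h.ne₁)] at e
    exact Real.injOn_cos ⟨by linarith, by linarith⟩ ⟨by linarith, by linarith⟩
      (e.trans Real.cos_pi_div_two.symm)
  rw [j1] at d2
  have i3 := half_turn (c := Real.pi) (by simp; positivity) d2 (by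
    rw [Real.cos_sub_pi]
    linarith [h3.cos_neg hb])
  rw [abs_lt] at i3
  have j3 : θ₃ < Real.pi := by
    by_contra! hcon
    have := Real.sin_nonneg_of_nonneg_of_le_pi (x := θ₃ - Real.pi) (by linarith) (by linarith)
    rw [Real.sin_sub_pi] at this
    linarith [h3.sin_pos hw]
  have i4 := half_turn (c := Real.pi / 2) (by rw [abs_le]; constructor <;> linarith) d3 (by
    rw [Real.cos_sub_pi_div_two]
    exact h4.sin_pos hw)
  rw [abs_lt] at i4
  constructor
  · linarith
  · by_contra! hcon
    have := Real.cos_nonpos_of_pi_div_two_le_of_le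
      (x := Real.pi / 2 + stepTurn ℓ a u b w) (by linarith) (by linarith)
    linarith [h4.cos_pos hc]

/-- The initial angle lies in `(π/2, 3π/2)`, those of `(a, -b)` and `(b, w)` lie in `(π/2, π)`, and
the last one is exactly `π/2`. -/
theorem stepTurn_to_vertical (h : StepSigns a u b w) {ℓ : ℝ} (hℓ : 0 < ℓ) (hc : b + ℓ * w = 0)
    (hw : 0 < w) (ha : a < 0) : -Real.pi < stepTurn ℓ a u b w ∧ stepTurn ℓ a u b w < 0 := by
  have hpi := Real.pi_pos
  have hb : b < 0 := by
    have := mul_pos hℓ hw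
    linarith
  have hθ' := (IsAngle.arg (⟨-a, u⟩ : ℂ)).reflect
  have e : -(starRingEnd ℂ) ⟨-a, u⟩ = (⟨a, u⟩ : ℂ) := by apply Complex.ext <;> simp
  rw [e] at hθ'
  have h0 : |(⟨-a, u⟩ : ℂ).arg| < Real.pi / 2 :=
    Complex.abs_arg_lt_pi_div_two_iff.2 (Or.inl (by simpa using ha))
  obtain ⟨θ, hθ, h0⟩ : ∃ θ, IsAngle (⟨a, u⟩ : ℂ) θ ∧ |θ - Real.pi| < Real.pi / 2 :=
    ⟨_, hθ', by simpa using h0⟩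
  obtain ⟨θ₁, θ₃, h1, h3, h4, d1, d2, d3⟩ := h.turn ℓ hθ
  have i1 := half_turn h0.le d1 (by
    rw [Real.cos_sub_pi]
    linarith [h1.cos_neg ha])
  rw [abs_lt] at i1 h0
  have j1 : θ₁ < Real.pi := by
    by_contra! hcon
    have := Real.sin_nonneg_of_nonneg_of_le_pi (x := θ₁ - Real.pi) (by linarith) (by linarith)
    rw [Real.sin_sub_pi] at this
    linarith [h1.sin_pos (by simpa using hb)]
  have i3 := half_turn (c := Real.pi) (by rw [abs_le]; constructor <;> linarith) d2 (by
    rw [Real.cos_sub_pi]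
    linarith [h3.cos_neg hb])
  rw [abs_lt] at i3
  have j3 : θ₃ < Real.pi := by
    by_contra! hcon
    have := Real.sin_nonneg_of_nonneg_of_le_pi (x := θ₃ - Real.pi) (by linarith) (by linarith)
    rw [Real.sin_sub_pi] at this
    linarith [h3.sin_pos hw]
  have i4 := half_turn (c := Real.pi / 2) (by rw [abs_le]; constructor <;> linarith) d3 (by
    rw [Real.cos_sub_pi_div_two]
    exact h4.sin_pos hw)
  rw [abs_lt] at i4
  have j4 : θ + stepTurn ℓ a u b w = Real.pi / 2 := by
    have e := h4.re_eq
    have e1 : (⟨b + ℓ * w, w⟩ : ℂ).re = 0 := hc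
    have e2 : (⟨b + ℓ * w, w⟩ : ℂ) ≠ 0 := fun h0 => hw.ne' (congrArg Complex.im h0)
    rw [e1, eq_comm, mul_eq_zero, or_iff_right (by simpa using e2)] at e
    exact Real.injOn_cos ⟨by linarith, by linarith⟩ ⟨by linarith, by linarith⟩
      (e.trans Real.cos_pi_div_two.symm)
  constructor <;> linarith

end StepSigns

/-- The shear of the plane along horizontal lines. -/
noncomputable def shear (ℓ : ℝ) : ℂ ≃ₜ ℂ where
  toFun z := ⟨z.re + ℓ * z.im, z.im⟩
  invFun z := ⟨z.re - ℓ * z.im, z.im⟩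
  left_inv z := by apply Complex.ext <;> simp
  right_inv z := by apply Complex.ext <;> simp
  continuous_toFun := by
    have : (fun z : ℂ => (⟨z.re + ℓ * z.im, z.im⟩ : ℂ)) =
        fun z => ((z.re + ℓ * z.im : ℝ) : ℂ) + (z.im : ℝ) * Complex.I := by
      funext z
      apply Complex.ext <;> simp
    rw [this]
    fun_prop
  continuous_invFun := by
    have : (fun z : ℂ => (⟨z.re - ℓ * z.im, z.im⟩ : ℂ)) =
        fun z => ((z.re - ℓ * z.im : ℝ) : ℂ) + (z.im : ℝ) * Complex.I := by
      funext z
      apply Complex.ext <;> simp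
    rw [this]
    fun_prop

@[simp] theorem shear_re (ℓ : ℝ) (z : ℂ) : (shear ℓ z).re = z.re + ℓ * z.im := rfl

@[simp] theorem shear_im (ℓ : ℝ) (z : ℂ) : (shear ℓ z).im = z.im := rfl

/-- The order properties of a billiard map, lifted to the plane of the coordinates `φ` and
`cot θ`. -/
structure BilliardLift (F : ℂ ≃ₜ ℂ) (k c ℓ : ℝ) : Prop where
  re_lt : ∀ p q, p.re = q.re → p.im < q.im → (F q).re < (F p).re
  im_lt : ∀ p q, (F p).re = (F q).re → p.re < q.re → (F p).im < (F q).im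
  lt : ∀ z, z.re < (F z).re
  lt' : ∀ z, (F z).re < z.re + 2 * Real.pi
  twist : ∀ p q, p.re = q.re → k < p.im → p.im < q.im →
    (F p).re + ℓ * (F p).im < (F q).re + ℓ * (F q).im
  twist' : ∀ p q, (F p).re + ℓ * (F p).im = (F q).re + ℓ * (F q).im → k < (F p).im →
    (F p).im < (F q).im → q.re < p.re
  near : ∀ z, k < z.im ∨ k < (F z).im → |(F z).im - z.im| ≤ c

namespace BilliardLift

variable {F : ℂ ≃ₜ ℂ} {k c ℓ : ℝ}

theorem stepSigns (hF : BilliardLift F k c ℓ) {p q : ℂ} (hpq : p ≠ q) :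
    StepSigns (q.re - p.re) (q.im - p.im) ((F q).re - (F p).re) ((F q).im - (F p).im) := by
  have h1 : q.re - p.re = 0 → q.im - p.im ≠ 0 := fun h h' =>
    hpq (Complex.ext (sub_eq_zero.1 h).symm (sub_eq_zero.1 h').symm)
  have h2 : q.re - p.re = 0 → (q.im - p.im) * ((F q).re - (F p).re) < 0 := by
    intro h
    rcases lt_or_gt_of_ne (h1 h) with h0 | h0
    · have := hF.re_lt q p (sub_eq_zero.1 h) (by linarith)
      exact mul_neg_of_neg_of_pos h0 (by linarith)
    · have := hF.re_lt p q (sub_eq_zero.1 h).symm (by linarith)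
      exact mul_neg_of_pos_of_neg h0 (by linarith)
  refine ⟨?_, h2, ?_⟩
  · by_cases h : q.re - p.re = 0
    · exact Or.inr (h1 h)
    · exact Or.inl h
  · intro h
    rcases lt_trichotomy (q.re - p.re) 0 with h0 | h0 | h0
    · have := hF.im_lt q p (sub_eq_zero.1 h) (by linarith)
      exact mul_pos_of_neg_of_neg h0 (by linarith)
    · have := h2 h0
      rw [h, mul_zero] at this
      exact absurd this (lt_irrefl _)
    · have := hF.im_lt p q (sub_eq_zero.1 h).symm (by linarith)
      exact mul_pos h0 (by linarith)

/-- The billiard map followed by the passage along the side of the coin is a twist map. -/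
theorem twistLift (hF : BilliardLift F k c ℓ) (hℓ : 0 < ℓ) (hc : 0 ≤ c) :
    TwistLift (F.trans (shear ℓ)) (fun p q => stepTurn ℓ (q.re - p.re) (q.im - p.im)
      ((F q).re - (F p).re) ((F q).im - (F p).im)) k (2 * Real.pi + (ℓ + 1) * c) ℓ where
  turn p q θ hpq hθ := by
    have e : ∀ z w : ℂ, z - w = ⟨z.re - w.re, z.im - w.im⟩ := fun z w => by
      apply Complex.ext <;> simp
    rw [e] at hθ
    obtain ⟨-, -, -, -, h, -⟩ := (hF.stepSigns hpq).turn ℓ hθ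
    rw [e]
    convert h using 2
    · simp
      ring
    · simp
  cont p := by
    have e : ∀ f g : ℂ → ℝ, Continuous f → Continuous g →
        Continuous fun z => (⟨f z, g z⟩ : ℂ) := by
      intro f g hf hg
      have : (fun z => (⟨f z, g z⟩ : ℂ)) = fun z => (f z : ℂ) + g z * Complex.I := by
        funext z
        apply Complex.ext <;> simp
      rw [this]
      fun_prop
    have hF1 : Continuous F := F.continuous
    have h0 := e (fun q => q.re - p.re) (fun q => q.im - p.im) (by fun_prop) (by fun_prop)
    have h1 := e (fun q => q.re - p.re) (fun q => -((F q).re - (F p).re)) (by fun_prop)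
      (by fun_prop)
    have h2 := e (fun q => (F q).re - (F p).re) (fun q => q.re - p.re) (by fun_prop) (by fun_prop)
    have h3 := e (fun q => (F q).re - (F p).re) (fun q => (F q).im - (F p).im) (by fun_prop)
      (by fun_prop)
    have h4 := e (fun q => (F q).re - (F p).re + ℓ * ((F q).im - (F p).im))
      (fun q => (F q).im - (F p).im) (by fun_prop) (by fun_prop)
    intro q hq
    have hs := hF.stepSigns (p := p) (q := q) fun h => hq h.symm
    refine ContinuousAt.continuousWithinAt ?_
    unfold stepTurn
    refine (((?_ : ContinuousAt _ _).add continuousAt_const).add ?_).add ?_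
    · exact ContinuousAt.comp (g := Complex.arg) (Complex.continuousAt_arg hs.slit₁)
        (h1.continuousAt.div h0.continuousAt hs.ne₀)
    · exact ContinuousAt.comp (g := Complex.arg) (Complex.continuousAt_arg hs.slit₂)
        (h3.continuousAt.div h2.continuousAt hs.ne₂)
    · exact ContinuousAt.comp (g := Complex.arg) (Complex.continuousAt_arg (hs.slit₃ ℓ))
        (h4.continuousAt.div h3.continuousAt hs.ne₃)
  far_right p q h1 h2 := by
    have hpq : p ≠ q := by
      rintro rfl
      simp at h1
      linarith [Real.pi_pos]
    simp at h1 h2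
    refine (hF.stepSigns hpq).stepTurn_right (by linarith [Real.pi_pos]) ?_
      (by linarith [Real.pi_pos])
    linarith [hF.lt q, hF.lt' p]
  far_left p q h1 h2 := by
    have hpq : p ≠ q := by
      rintro rfl
      simp at h1
      linarith [Real.pi_pos]
    simp at h1 h2
    refine (hF.stepSigns hpq).stepTurn_left (by linarith [Real.pi_pos]) ?_
      (by linarith [Real.pi_pos])
    linarith [hF.lt p, hF.lt' q]
  twist p q hpq h h1 h2 := by
    rcases lt_trichotomy p.im q.im with h0 | h0 | h0
    · exact (hF.stepSigns hpq).stepTurn_vertical hℓ (by linarith) (by linarith)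
        (by linarith [hF.twist p q h h1 h0])
    · exact absurd (Complex.ext h h0) hpq
    · have := (hF.stepSigns hpq.symm).stepTurn_vertical hℓ (by linarith) (by linarith)
        (by linarith [hF.twist q p h.symm h2 h0])
      rw [← stepTurn_neg]
      simpa using this
  twist' p q hpq h h1 h2 := by
    simp at h h1 h2
    rcases lt_trichotomy (F p).im (F q).im with h0 | h0 | h0
    · exact (hF.stepSigns hpq).stepTurn_to_vertical hℓ (by linarith) (by linarith)
        (by linarith [hF.twist' p q h h1 h0])
    · rw [h0] at h
      exact absurd (F.injective (Complex.ext (add_right_cancel h) h0)) hpq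
    · have := (hF.stepSigns hpq.symm).stepTurn_to_vertical hℓ (by linarith) (by linarith)
        (by linarith [hF.twist' q p h.symm h2 h0])
      rw [← stepTurn_neg]
      simpa using this
  near z hz := by
    have h1 := hF.near z (by simpa using hz)
    have h2 := hF.lt z
    have h3 := hF.lt' z
    have h4 := mul_nonneg hℓ.le hc
    have h5 := Real.pi_pos
    -- The horizontal error consists of the billiard displacement, below `2π`, and `ℓ` times the
    -- change of height.
    have h6 : |ℓ * (F z).im - ℓ * z.im| ≤ ℓ * c := by
      rw [← mul_sub, abs_mul, abs_of_pos hℓ]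
      exact mul_le_mul_of_nonneg_left h1 hℓ.le
    simp only [Homeomorph.trans_apply, shear_re, shear_im]
    rw [abs_le] at h1 h6
    refine ⟨abs_le.2 ⟨?_, ?_⟩, abs_le.2 ⟨?_, ?_⟩, abs_le.2 ⟨?_, ?_⟩⟩ <;> linarith

end BilliardLift

end Coin

namespace Coin

open Filter Topology

namespace Table

variable (B : Table)

/-! ### The lift of the billiard map to the plane -/

/-- The billiard map on the plane of the coordinates `φ` and `cot θ`. -/
noncomputable def liftFun (z : ℂ) : ℂ :=
  ⟨z.re + B.reach (z.re : Circ) z.im, B.nextCot (z.re : Circ) z.im⟩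

theorem liftFun_add (z : ℂ) (n : ℤ) :
    B.liftFun (z + n * (2 * Real.pi)) = B.liftFun z + n * (2 * Real.pi) := by
  have h1 : (z + n * (2 * Real.pi) : ℂ).re = z.re + n * (2 * Real.pi) := by
    simp
  have h2 : (z + n * (2 * Real.pi) : ℂ).im = z.im := by
    simp
  have h3 : ((z.re + n * (2 * Real.pi) : ℝ) : Circ) = (z.re : Circ) := by
    have := AddCircle.coe_period (2 * Real.pi)
    rw [AddCircle.coe_add, ← zsmul_eq_mul, AddCircle.coe_zsmul, this, zsmul_zero, add_zero]
  apply Complex.ext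
  · simp only [liftFun, h1, h2, h3]
    simp
    ring
  · simp only [liftFun, h1, h2, h3]
    simp

/-- Conjugation replaces `θ` by `π - θ`, that is, it reverses the motion; the particle runs back
along its chord and arrives at its start, one period further on. The inverse of the lift is built
from this. -/
theorem liftFun_conj (z : ℂ) :
    B.liftFun (starRingEnd ℂ (B.liftFun z)) = starRingEnd ℂ z + 2 * Real.pi := by
  apply Complex.ext
  · simp [liftFun, reach_reverse]
  · simp [liftFun, nextCot_reverse]

theorem continuous_liftFun : Continuous B.liftFun := by
  have h1 := B.continuous_reach
  have h2 := B.continuous_nextCot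
  have h3 : Continuous fun z : ℂ => ((z.re : Circ), z.im) :=
    ((AddCircle.continuous_mk' _).comp Complex.continuous_re).prodMk Complex.continuous_im
  have e : B.liftFun = fun z : ℂ => ((z.re + B.reach (z.re : Circ) z.im : ℝ) : ℂ) +
      (B.nextCot (z.re : Circ) z.im : ℝ) * Complex.I := by
    funext z
    apply Complex.ext <;> simp [liftFun]
  have h4 := h1.comp h3
  have h5 := h2.comp h3
  simp only [Function.comp_def] at h4 h5
  rw [e]
  fun_prop

/-- The billiard map on the plane, with its inverse. -/
noncomputable def lift : ℂ ≃ₜ ℂ where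
  toFun := B.liftFun
  invFun z := starRingEnd ℂ (B.liftFun (starRingEnd ℂ z)) - 2 * Real.pi
  left_inv z := by
    simp only [liftFun_conj]
    apply Complex.ext <;> simp
  right_inv z := by
    have h := B.liftFun_add (starRingEnd ℂ (B.liftFun (starRingEnd ℂ z))) (-1)
    rw [liftFun_conj] at h
    have e : starRingEnd ℂ (B.liftFun (starRingEnd ℂ z)) + ((-1 : ℤ) : ℂ) * (2 * Real.pi) =
        starRingEnd ℂ (B.liftFun (starRingEnd ℂ z)) - 2 * Real.pi := by
      push_cast
      ring
    rw [e] at h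
    simp only [h]
    simp
  continuous_toFun := B.continuous_liftFun
  continuous_invFun := by
    have := B.continuous_liftFun
    fun_prop

theorem lift_re (z : ℂ) : (B.lift z).re = z.re + B.reach (z.re : Circ) z.im := rfl

theorem lift_im (z : ℂ) : (B.lift z).im = B.nextCot (z.re : Circ) z.im := rfl

theorem lift_add (z : ℂ) (n : ℤ) :
    B.lift (z + n * (2 * Real.pi)) = B.lift z + n * (2 * Real.pi) := B.liftFun_add z n

/-- For a fixed end of the chord the angle there grows as the initial point moves ahead. -/
theorem cotIn_lt {a a' r r' : ℝ} (h : a < a') (hr : r < 2 * Real.pi) (hr' : 0 < r')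
    (he : a + r = a' + r') : B.cotIn (a : Circ) r < B.cotIn (a' : Circ) r' := by
  have h1 := B.cotOut_reverse (a : Circ) r
  have h2 := B.cotOut_reverse (a' : Circ) r'
  rw [← AddCircle.coe_add] at h1 h2
  rw [← he] at h2
  have := B.strictAntiOn_cotOut ((a + r : ℝ) : Circ)
    (⟨by linarith, by linarith⟩ : 2 * Real.pi - r ∈ Set.Ioo 0 (2 * Real.pi))
    (⟨by linarith, by linarith⟩ : 2 * Real.pi - r' ∈ Set.Ioo 0 (2 * Real.pi)) (by linarith)
  linarith

theorem continuous_circDeriv_radius : Continuous (circDeriv (radius B.γ)) := by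
  have h1 : Continuous (circDeriv B.curv) :=
    continuous_circ (contDiff_circDeriv (m := 2) (by norm_num) B.contDiff_curv).continuous
  have h2 := B.continuous_curv
  have e : circDeriv (radius B.γ) = fun φ => -circDeriv B.curv φ / B.curv φ ^ 2 :=
    funext B.circDeriv_radius
  rw [e]
  exact h1.neg.div (h2.pow 2) fun φ => (pow_pos (B.curv_pos φ) 2).ne'

/-- High up, the lift of the billiard map has the order properties of a billiard map, and the sum
of the images of a vertical line under the lifts of the coin map and of its inverse is close to a
function given by the radius of curvature. -/
theorem exists_billiardLift {ℓ ε : ℝ} (hℓ : 0 < ℓ) (hε : 0 < ε) : ∃ k c : ℝ, 0 ≤ c ∧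
    BilliardLift B.lift k c ℓ ∧ ∀ p : ℂ, k < p.im →
      |((B.lift.trans (shear ℓ)) p).re + ((B.lift.trans (shear ℓ)).symm p).re -
        (2 * p.re + 2 / 3 * ℓ * circDeriv (radius B.γ) (p.re : Circ))| ≤ ε := by
  obtain ⟨r₁, hr₁, h1⟩ := B.exists_strictAntiOn_add_cotIn hℓ
  obtain ⟨K, hK, r₂, hr₂, h2⟩ := B.exists_cotIn_sub_cotOut
  obtain ⟨M, hM, h3⟩ := exists_bound_circ B.continuous_circDeriv_radius
  -- In the sum of the two images the two chord lengths contribute an error of at most `r₀`, and the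
  -- change of height one of at most `ℓ K r₀`.
  set r₀ := min (min r₁ r₂) (ε / (1 + ℓ * K)) with hr₀
  have hr₀0 : 0 < r₀ := by positivity
  have hr₀1 : r₀ ≤ r₁ := (min_le_left _ _).trans (min_le_left _ _)
  have hr₀2 : r₀ ≤ r₂ := (min_le_left _ _).trans (min_le_right _ _)
  have hr₀3 : r₀ * (1 + ℓ * K) ≤ ε := (le_div_iff₀ (by positivity)).1 (min_le_right _ _)
  obtain ⟨k, hk⟩ := B.exists_short hr₀0
  have hshort : ∀ z : ℂ, k < z.im ∨ k < (B.lift z).im → B.reach (z.re : Circ) z.im < r₀ := by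
    intro z hz
    refine hk (z.re : Circ) _ (B.reach_pos _ _) (B.reach_lt _ _) ?_
    rw [cotOut_reach]
    exact hz
  have hdiff : ∀ z : ℂ, k < z.im ∨ k < (B.lift z).im → |(B.lift z).im - z.im -
      2 / 3 * circDeriv (radius B.γ) (z.re : Circ)| ≤ K * r₀ := by
    intro z hz
    have h4 := hshort z hz
    have h5 := h2 (z.re : Circ) _ (B.reach_pos _ _) (h4.le.trans hr₀2)
    rw [cotOut_reach] at h5
    exact h5.trans (mul_le_mul_of_nonneg_left h4.le hK.le)
  refine ⟨k, K * r₀ + M, by positivity, ⟨?_, ?_, ?_, ?_, ?_, ?_, ?_⟩, ?_⟩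
  · intro p q h h'
    rw [lift_re, lift_re, h]
    linarith [B.strictAnti_reach (q.re : Circ) h']
  · intro p q h h'
    exact B.cotIn_lt h' (B.reach_lt _ _) (B.reach_pos _ _) h
  · intro z
    rw [lift_re]
    linarith [B.reach_pos (z.re : Circ) z.im]
  · intro z
    rw [lift_re]
    linarith [B.reach_lt (z.re : Circ) z.im]
  · intro p q h hkp hpq
    have h4 := B.strictAnti_reach (q.re : Circ) hpq
    have h5 := hshort p (Or.inl hkp)
    rw [h] at h5
    have := h1 (q.re : Circ) ⟨B.reach_pos _ _, by linarith⟩ ⟨B.reach_pos _ _, by linarith⟩ h4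
    rw [lift_re, lift_re, lift_im, lift_im, h, nextCot, nextCot]
    simp only at this
    linarith
  · intro p q h hkp hpq
    have hb : (B.lift q).re < (B.lift p).re := by
      have := mul_lt_mul_of_pos_left hpq hℓ
      linarith
    -- If `q` did not start to the left of `p`, the chord from `p` to the end of the chord of `q`
    -- would be shorter than that of `p`, so the passage along the side would bring it further
    -- right; by `cotIn_lt` the chord of `q` gets at least as far, against `h`.
    by_contra! hcon
    have h5 := hshort p (Or.inr hkp)
    rw [lift_re, lift_re] at h hb
    have hq := B.reach_pos (q.re : Circ) q.im
    have h6 := h1 (p.re : Circ)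
      (⟨by linarith, by linarith⟩ : q.re + B.reach (q.re : Circ) q.im - p.re ∈ Set.Ioo 0 r₁)
      ⟨B.reach_pos (p.re : Circ) p.im, by linarith⟩ (by linarith)
    simp only at h6
    have h7 : B.cotIn (p.re : Circ) (q.re + B.reach (q.re : Circ) q.im - p.re) ≤
        (B.lift q).im := by
      rcases hcon.lt_or_eq with h0 | h0
      · exact (B.cotIn_lt h0 (by linarith [B.reach_lt (p.re : Circ) p.im]) hq (by ring)).le
      · rw [h0, add_sub_cancel_left]
        exact le_rfl
    have h8 := mul_le_mul_of_nonneg_left h7 hℓ.le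
    have h9 : B.cotIn (p.re : Circ) (B.reach (p.re : Circ) p.im) = (B.lift p).im := rfl
    rw [h9] at h6
    linarith
  · intro z hz
    have h4 := hdiff z hz
    have h5 := h3 (z.re : Circ)
    rw [Real.norm_eq_abs] at h5
    rw [abs_le] at h4 h5 ⊢
    constructor <;> linarith
  · intro p hp
    -- The backward image is shifted by `-ℓ p.im`, the forward one by `ℓ` times the height after the
    -- step. In the sum only the change of height survives, besides the two chord lengths.
    set p' := (B.lift.trans (shear ℓ)).symm p with hp'
    have h4 : B.lift p' = (shear ℓ).symm p := by simp [hp']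
    have h5 : (B.lift p').im = p.im := by
      rw [h4]
      rfl
    have h6 : (B.lift p').re = p.re - ℓ * p.im := by
      rw [h4]
      rfl
    have h7 := hshort p' (Or.inr (by rwa [h5]))
    have h8 := hshort p (Or.inl hp)
    have h9 := hdiff p (Or.inl hp)
    have h10 := B.reach_pos (p'.re : Circ) p'.im
    have h11 := B.reach_pos (p.re : Circ) p.im
    rw [lift_re] at h6
    have h12 : |ℓ * ((B.lift p).im - p.im - 2 / 3 * circDeriv (radius B.γ) (p.re : Circ))| ≤
        ℓ * (K * r₀) := by
      rw [abs_mul, abs_of_pos hℓ]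
      exact mul_le_mul_of_nonneg_left h9 hℓ.le
    simp only [Homeomorph.trans_apply, shear_re, lift_re]
    rw [abs_le] at h12 ⊢
    constructor <;> linarith

end Table

end Coin

namespace Coin

open Filter Topology MeasureTheory

instance : Fact (0 < 2 * Real.pi) := ⟨Real.two_pi_pos⟩

/-! ### The invariant measure -/

/-- The density of the measure `sin θ dθ` in the coordinate `cot θ`. -/
noncomputable def cotDensity (u : ℝ) : ℝ := (√(1 + u ^ 2) ^ 3)⁻¹

theorem cotDensity_pos (u : ℝ) : 0 < cotDensity u := by
  have : 0 < 1 + u ^ 2 := by positivity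
  unfold cotDensity
  positivity

theorem continuous_cotDensity : Continuous cotDensity := by
  unfold cotDensity
  refine Continuous.inv₀ (by fun_prop) fun u => ?_
  have : 0 < 1 + u ^ 2 := by positivity
  positivity

/-- The measure `sin θ dθ` in the coordinate `cot θ`. -/
noncomputable def cotMeasure : Measure ℝ :=
  volume.withDensity fun u => ENNReal.ofReal (cotDensity u)

theorem lintegral_cotMeasure {f : ℝ → ENNReal} (hf : Measurable f) :
    ∫⁻ u, f u ∂cotMeasure = ∫⁻ u, ENNReal.ofReal (cotDensity u) * f u :=
  lintegral_withDensity_eq_lintegral_mul _ continuous_cotDensity.measurable.ennreal_ofReal hf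

instance : IsFiniteMeasure cotMeasure := by
  refine isFiniteMeasure_withDensity_ofReal (Integrable.mono' integrable_inv_one_add_sq
    continuous_cotDensity.aestronglyMeasurable (Eventually.of_forall fun u => ?_)).2
  rw [Real.norm_of_nonneg (cotDensity_pos u).le, cotDensity]
  have h1 : 1 ≤ √(1 + u ^ 2) := Real.one_le_sqrt.2 (by nlinarith [sq_nonneg u])
  have h2 : √(1 + u ^ 2) ^ 2 = 1 + u ^ 2 := Real.sq_sqrt (by positivity)
  exact inv_anti₀ (by positivity) (h2.symm.le.trans (pow_le_pow_right₀ h1 (by norm_num)))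

instance : cotMeasure.IsOpenPosMeasure :=
  (withDensity_absolutelyContinuous' continuous_cotDensity.measurable.ennreal_ofReal.aemeasurable
    (Eventually.of_forall fun u => by simpa using cotDensity_pos u)).isOpenPosMeasure

theorem lintegral_cotMeasure_neg {f : ℝ → ENNReal} (hf : Measurable f) :
    ∫⁻ u, f (-u) ∂cotMeasure = ∫⁻ u, f u ∂cotMeasure := by
  rw [lintegral_cotMeasure hf, lintegral_cotMeasure (f := fun u => f (-u)) (hf.comp measurable_neg),
    ← lintegral_neg_eq_self]
  simp [cotDensity]

/-- The invariant measure of the billiard map. -/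
noncomputable def phaseMeasure : Measure (Circ × ℝ) := volume.prod cotMeasure

instance : IsFiniteMeasure phaseMeasure := by
  unfold phaseMeasure
  infer_instance

instance : phaseMeasure.IsOpenPosMeasure := by
  unfold phaseMeasure
  infer_instance

theorem measurePreserving_phaseMeasure {T : Circ × ℝ → Circ × ℝ} (hT : Measurable T)
    (h : ∀ f : Circ × ℝ → ENNReal, Measurable f →
      ∫⁻ φ, ∫⁻ u, f (T (φ, u)) ∂cotMeasure = ∫⁻ φ, ∫⁻ u, f (φ, u) ∂cotMeasure) :
    MeasurePreserving T phaseMeasure phaseMeasure := by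
  refine ⟨hT, Measure.ext_of_lintegral _ fun f hf => ?_⟩
  rw [lintegral_map hf hT, phaseMeasure, lintegral_prod (fun x => f (T x)) (hf.comp hT).aemeasurable,
    lintegral_prod _ hf.aemeasurable]
  exact h f hf

/-- The passage along the side of the coin preserves the measure. -/
theorem measurePreserving_side (ℓ : ℝ) :
    MeasurePreserving (fun x : Circ × ℝ => (x.1 + ((ℓ * x.2 : ℝ) : Circ), x.2))
      phaseMeasure phaseMeasure := by
  have h3 : Continuous ((↑) : ℝ → Circ) := AddCircle.continuous_mk' _
  have hT : Measurable fun x : Circ × ℝ => (x.1 + ((ℓ * x.2 : ℝ) : Circ), x.2) :=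
    Continuous.measurable (by fun_prop)
  refine measurePreserving_phaseMeasure hT fun f hf => ?_
  rw [lintegral_lintegral_swap (f := fun φ u => f (φ + ((ℓ * u : ℝ) : Circ), u))
    (hf.comp hT).aemeasurable, lintegral_lintegral_swap (f := fun φ u => f (φ, u)) hf.aemeasurable]
  exact lintegral_congr fun u => lintegral_add_right_eq_self (fun φ => f (φ, u)) _

theorem setLIntegral_Ioo_reflect (f : ℝ → ENNReal) (a : ℝ) :
    ∫⁻ r in Set.Ioo 0 a, f (a - r) = ∫⁻ r in Set.Ioo 0 a, f r := by
  rw [← lintegral_indicator measurableSet_Ioo, ← lintegral_indicator measurableSet_Ioo,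
    ← lintegral_sub_left_eq_self _ a]
  refine lintegral_congr fun r => ?_
  simp only [Set.indicator, Set.mem_Ioo]
  congr 1
  · rw [eq_iff_iff]
    constructor <;> rintro ⟨h1, h2⟩ <;> constructor <;> linarith
  · rw [sub_sub_cancel]

namespace Table

variable (B : Table)

/-- The density of the invariant measure in the coordinates of the chords. -/
noncomputable def chordDensity (φ : Circ) (r : ℝ) : ℝ :=
  B.normalOut φ r * B.normalIn φ r / ‖B.chord φ r‖ ^ 3

/-- This symmetry makes the measure invariant: in chord coordinates the billiard map is the reversal
of chords, up to the change of sign of `u`. -/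
theorem chordDensity_reverse (φ : Circ) (r : ℝ) :
    B.chordDensity (φ + (r : Circ)) (2 * Real.pi - r) = B.chordDensity φ r := by
  rw [chordDensity, normalOut_reverse, normalIn_reverse, chord_reverse, norm_neg, mul_comm,
    chordDensity]

theorem continuous_chord : Continuous fun x : Circ × ℝ => B.chord x.1 x.2 := by
  have h2 := B.continuous_γ
  have h3 : Continuous ((↑) : ℝ → Circ) := AddCircle.continuous_mk' _
  unfold chord
  fun_prop

theorem continuous_normalIn : Continuous fun x : Circ × ℝ => B.normalIn x.1 x.2 := by
  have h1 := B.continuous_tangent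
  have h2 := B.continuous_γ
  have h3 : Continuous ((↑) : ℝ → Circ) := AddCircle.continuous_mk' _
  unfold normalIn cross chord
  fun_prop

theorem measurable_chordDensity : Measurable fun x : Circ × ℝ => B.chordDensity x.1 x.2 :=
  (B.continuous_normalOut.measurable.mul B.continuous_normalIn.measurable).div
    (B.continuous_chord.norm.pow 3).measurable

theorem measurable_cotOut : Measurable fun x : Circ × ℝ => B.cotOut x.1 x.2 :=
  B.continuous_tangentOut.measurable.div B.continuous_normalOut.measurable

/-- `1 / √(1 + u ^ 2)` is the sine of the angle, `normalOut / ‖chord‖`; its cube times the Jacobian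
`normalIn / normalOut ^ 2` is symmetric in the two ends. -/
theorem chordDensity_eq (φ : Circ) {r : ℝ} (h0 : 0 < r) (h1 : r < 2 * Real.pi) :
    |-B.normalIn φ r / B.normalOut φ r ^ 2| * cotDensity (B.cotOut φ r) = B.chordDensity φ r := by
  have hC := B.normalOut_pos φ h0 h1
  have hC' := B.normalIn_pos φ h0 h1
  have hsq : √(1 + B.cotOut φ r ^ 2) = ‖B.chord φ r‖ / B.normalOut φ r := by
    rw [Real.sqrt_eq_iff_mul_self_eq (by positivity) (by positivity), div_mul_div_comm,
      Complex.norm_mul_self_eq_normSq, cotOut, div_pow, ← pow_two, one_add_div (by positivity)]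
    congr 1
    have h2 := B.dot_tangent φ
    simp only [normalOut, tangentOut, cross, dot, Complex.normSq_apply] at h2 ⊢
    linear_combination ((B.chord φ r).re ^ 2 + (B.chord φ r).im ^ 2) * h2
  have hn : 0 < ‖B.chord φ r‖ := norm_pos_iff.2 (B.chord_ne_zero φ h0 h1)
  rw [abs_div, abs_neg, abs_of_pos hC', abs_of_pos (by positivity : 0 < B.normalOut φ r ^ 2),
    cotDensity, hsq, chordDensity]
  field_simp

theorem image_cotOut (φ : Circ) : B.cotOut φ '' Set.Ioo 0 (2 * Real.pi) = Set.univ :=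
  Set.eq_univ_of_forall fun u =>
    ⟨B.reach φ u, ⟨B.reach_pos _ _, B.reach_lt _ _⟩, B.cotOut_reach _ _⟩

theorem lintegral_cotMeasure_eq (φ : Circ) {f : ℝ → ENNReal} (hf : Measurable f) :
    ∫⁻ u, f u ∂cotMeasure = ∫⁻ r in Set.Ioo 0 (2 * Real.pi),
      ENNReal.ofReal (B.chordDensity φ r) * f (B.cotOut φ r) := by
  rw [lintegral_cotMeasure hf, ← setLIntegral_univ, ← B.image_cotOut φ,
    lintegral_image_eq_lintegral_abs_deriv_mul measurableSet_Ioo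
      (fun r hr => (B.hasDerivAt_cotOut φ hr.1 hr.2).hasDerivWithinAt)
      (B.strictAntiOn_cotOut φ).injOn]
  refine setLIntegral_congr_fun measurableSet_Ioo fun r hr => ?_
  rw [← mul_assoc, ← ENNReal.ofReal_mul (abs_nonneg _), B.chordDensity_eq φ hr.1 hr.2]

theorem measurePreserving_billiard :
    MeasurePreserving (fun x : Circ × ℝ => (x.1 + (B.reach x.1 x.2 : Circ), B.nextCot x.1 x.2))
      phaseMeasure phaseMeasure := by
  have h3 : Continuous ((↑) : ℝ → Circ) := AddCircle.continuous_mk' _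
  have hT : Measurable fun x : Circ × ℝ =>
      (x.1 + (B.reach x.1 x.2 : Circ), B.nextCot x.1 x.2) := by
    have h1 := B.continuous_reach
    have h2 := B.continuous_nextCot
    exact Continuous.measurable (by fun_prop)
  have hTφ : ∀ φ, Measurable fun u => (φ + (B.reach φ u : Circ), B.nextCot φ u) := by
    intro φ
    have h1 := B.continuous_reach.comp (Continuous.prodMk_right φ)
    have h2 := B.continuous_nextCot.comp (Continuous.prodMk_right φ)
    simp only [Function.comp_def] at h1 h2
    exact Continuous.measurable (by fun_prop)
  refine measurePreserving_phaseMeasure hT fun f hf => ?_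
  obtain ⟨G, hG⟩ : ∃ G : Circ → ℝ → ENNReal, G = fun φ r =>
    ENNReal.ofReal (B.chordDensity φ r) * f (φ + (r : Circ), B.cotIn φ r) := ⟨_, rfl⟩
  obtain ⟨H, hH⟩ : ∃ H : Circ → ℝ → ENNReal, H = fun φ r =>
    ENNReal.ofReal (B.chordDensity φ r) * f (φ, -B.cotOut φ r) := ⟨_, rfl⟩
  have hcotIn : Measurable fun x : Circ × ℝ => B.cotIn x.1 x.2 := by
    have e : (fun x : Circ × ℝ => B.cotIn x.1 x.2) =
        fun x => -B.cotOut (x.1 + (x.2 : Circ)) (2 * Real.pi - x.2) := by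
      funext x
      rw [cotOut_reverse, neg_neg]
    rw [e]
    exact (B.measurable_cotOut.comp (g := fun x : Circ × ℝ => B.cotOut x.1 x.2)
      (f := fun x : Circ × ℝ => (x.1 + (x.2 : Circ), 2 * Real.pi - x.2))
      (Continuous.measurable (by fun_prop))).neg
  have hGm : Measurable (Function.uncurry G) := by
    rw [hG]
    exact B.measurable_chordDensity.ennreal_ofReal.mul (hf.comp
      (Measurable.prodMk (Continuous.measurable (by fun_prop)) hcotIn))
  have hHm : Measurable (Function.uncurry H) := by
    rw [hH]
    exact B.measurable_chordDensity.ennreal_ofReal.mul (hf.comp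
      (measurable_fst.prodMk B.measurable_cotOut.neg))
  calc ∫⁻ φ, ∫⁻ u, f (φ + (B.reach φ u : Circ), B.nextCot φ u) ∂cotMeasure
      = ∫⁻ φ, ∫⁻ r in Set.Ioo 0 (2 * Real.pi), G φ r := by
        refine lintegral_congr fun φ => ?_
        rw [B.lintegral_cotMeasure_eq φ
          (f := fun u => f (φ + (B.reach φ u : Circ), B.nextCot φ u)) (hf.comp (hTφ φ))]
        refine setLIntegral_congr_fun measurableSet_Ioo fun r hr => ?_
        simp only [hG, nextCot, B.reach_cotOut φ hr.1 hr.2]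
    _ = ∫⁻ r in Set.Ioo 0 (2 * Real.pi), ∫⁻ φ, G φ r := lintegral_lintegral_swap (f := G) hGm.aemeasurable
    -- The substitution of `2π - r` for `r`, followed by the translation of `φ` by `r`, reverses all
    -- chords.
    _ = ∫⁻ r in Set.Ioo 0 (2 * Real.pi), ∫⁻ φ, G φ (2 * Real.pi - r) :=
        (setLIntegral_Ioo_reflect (fun r => ∫⁻ φ, G φ r) (2 * Real.pi)).symm
    _ = ∫⁻ r in Set.Ioo 0 (2 * Real.pi), ∫⁻ φ, H φ r := by
        refine lintegral_congr fun r => ?_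
        rw [← lintegral_add_right_eq_self (μ := (volume : Measure Circ))
          (fun φ : Circ => G φ (2 * Real.pi - r)) (r : Circ)]
        refine lintegral_congr fun φ => ?_
        simp only [hG, hH]
        rw [chordDensity_reverse, cotIn_reverse, add_reverse]
    _ = ∫⁻ φ, ∫⁻ r in Set.Ioo 0 (2 * Real.pi), H φ r :=
        (lintegral_lintegral_swap (f := H) hHm.aemeasurable).symm
    _ = ∫⁻ φ, ∫⁻ u, f (φ, u) ∂cotMeasure := by
        refine lintegral_congr fun φ => ?_
        have hfφ : Measurable fun u => f (φ, u) := hf.comp measurable_prodMk_left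
        rw [← lintegral_cotMeasure_neg hfφ, hH]
        exact (B.lintegral_cotMeasure_eq φ (hfφ.comp measurable_neg)).symm

/-! ### Bands of the lifted coin map -/

/-- The coin map in the coordinates `φ` and `cot θ`. -/
noncomputable def cotMap (ℓ : ℝ) (x : Circ × ℝ) : Circ × ℝ :=
  (x.1 + (B.reach x.1 x.2 : Circ) + ((ℓ * B.nextCot x.1 x.2 : ℝ) : Circ), B.nextCot x.1 x.2)

theorem measurePreserving_cotMap (ℓ : ℝ) :
    MeasurePreserving (B.cotMap ℓ) phaseMeasure phaseMeasure :=
  (measurePreserving_side ℓ).comp B.measurePreserving_billiard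

/-- The lift of the coin map. -/
noncomputable def coinLift (ℓ : ℝ) : ℂ ≃ₜ ℂ := B.lift.trans (shear ℓ)

theorem coinLift_re (ℓ : ℝ) (z : ℂ) : (B.coinLift ℓ z).re =
    z.re + B.reach (z.re : Circ) z.im + ℓ * B.nextCot (z.re : Circ) z.im := rfl

theorem coinLift_im (ℓ : ℝ) (z : ℂ) : (B.coinLift ℓ z).im = B.nextCot (z.re : Circ) z.im := rfl

theorem coinLift_add (ℓ : ℝ) (n : ℤ) (z : ℂ) :
    B.coinLift ℓ (z + n * (2 * Real.pi)) = B.coinLift ℓ z + n * (2 * Real.pi) := by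
  have h := B.lift_add z n
  apply Complex.ext
  · change (B.lift _).re + ℓ * (B.lift _).im = _
    rw [h]
    simp [coinLift]
    ring
  · change (B.lift _).im = _
    rw [h]
    simp [coinLift]

end Table

/-- The projection of the plane to the cylinder. -/
noncomputable def toCylinder (z : ℂ) : Circ × ℝ := ((z.re : Circ), z.im)

theorem toCylinder_surjective (x : Circ × ℝ) : ∃ z, toCylinder z = x := by
  obtain ⟨φ, u⟩ := x
  obtain ⟨a, rfl⟩ := QuotientAddGroup.mk_surjective φ
  exact ⟨⟨a, u⟩, rfl⟩

theorem toCylinder_eq_iff {z w : ℂ} :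
    toCylinder z = toCylinder w ↔ ∃ n : ℤ, w = z + n * (2 * Real.pi) := by
  constructor
  · intro h
    obtain ⟨h1, h2⟩ := Prod.ext_iff.1 h
    simp only [toCylinder] at h1 h2
    have h3 : ((w.re - z.re : ℝ) : Circ) = 0 := by
      rw [AddCircle.coe_sub, h1, sub_self]
    obtain ⟨n, hn⟩ := (AddCircle.coe_eq_zero_iff _).1 h3
    refine ⟨n, ?_⟩
    rw [zsmul_eq_mul] at hn
    apply Complex.ext
    · simp
      linarith
    · simp [h2]
  · rintro ⟨n, rfl⟩
    have := AddCircle.coe_period (2 * Real.pi)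
    refine Prod.ext ?_ (by simp [toCylinder])
    simp only [toCylinder]
    have e : (z + n * (2 * Real.pi) : ℂ).re = z.re + n * (2 * Real.pi) := by simp
    rw [e, AddCircle.coe_add, ← zsmul_eq_mul, AddCircle.coe_zsmul, this, zsmul_zero, add_zero]

theorem isOpenMap_toCylinder : IsOpenMap toCylinder :=
  (QuotientAddGroup.isOpenMap_coe.prodMap IsOpenMap.id).comp
    Complex.equivRealProdCLM.toHomeomorph.isOpenMap

namespace Table

variable (B : Table)

theorem cotMap_toCylinder (ℓ : ℝ) (z : ℂ) :
    B.cotMap ℓ (toCylinder z) = toCylinder (B.coinLift ℓ z) := by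
  simp [cotMap, toCylinder, coinLift_re, coinLift_im]

theorem cotMap_iterate (ℓ : ℝ) (n : ℕ) (z : ℂ) :
    (B.cotMap ℓ)^[n] (toCylinder z) = toCylinder ((B.coinLift ℓ)^[n] z) := by
  induction n with
  | zero => rfl
  | succ n ih => rw [Function.iterate_succ_apply', Function.iterate_succ_apply', ih,
      cotMap_toCylinder]

theorem free_add {T : ℂ ≃ₜ ℂ} {K : Set ℂ} {N D : ℝ} (hK : InvariantBand T K N D) {z : ℂ}
    (hz : Free K z) (n : ℤ) : Free K (z + n * (2 * Real.pi)) := by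
  intro w hw h
  have h1 := hz (w + ((-n : ℤ) : ℂ) * (2 * Real.pi)) ((hK.periodic _ _).2 hw) (by simp [h])
  simpa using h1

/-- Invariant bands of the coin map do not reach far up, when the sum of the images of a vertical
line under the coin map and its inverse is not monotone. -/
theorem exists_height_bound {ℓ : ℝ} (hℓ : 0 < ℓ) {x y : ℝ} (hxy : x < y)
    (hS : 2 * y + 2 / 3 * ℓ * circDeriv (radius B.γ) (y : Circ) <
      2 * x + 2 / 3 * ℓ * circDeriv (radius B.γ) (x : Circ)) :
    ∃ N₀ : ℝ, ∀ K N D, InvariantBand (B.coinLift ℓ) K N D → (∃ p ∈ K, p.im = N) → N ≤ N₀ := by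
  set S : ℝ → ℝ := fun x => 2 * x + 2 / 3 * ℓ * circDeriv (radius B.γ) (x : Circ) with hSdef
  change S y < S x at hS
  -- An error of a third of the drop of `S` leaves the sums over `x` and `y` in the wrong order.
  obtain ⟨k, c₀, hc₀, hB, hsum⟩ := B.exists_billiardLift hℓ
    (by linarith : 0 < (S x - S y) / 3)
  have hT : TwistLift (B.coinLift ℓ) _ k _ ℓ := hB.twistLift hℓ hc₀
  set c := 2 * Real.pi + (ℓ + 1) * c₀ with hcdef
  have hpi := Real.pi_pos
  have hc : 0 ≤ c := by positivity
  have hpl : 0 < 8 * Real.pi / ℓ := by positivity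
  have hpc : 0 < (Real.pi + 2 * c) / ℓ := by positivity
  -- Free points lie above `M = N - 2c - 8π/ℓ`. The bound leaves a further `c` for one step above
  -- `k`, and `(π + 2c)/ℓ + 1` for the strip between `m` and `M` in the dichotomy.
  refine ⟨k + 3 * c + 8 * Real.pi / ℓ + (Real.pi + 2 * c) / ℓ + 1, fun K N D hK ⟨p, hp, hpN⟩ => ?_⟩
  by_contra! hN
  have hglob : ∀ z, z.re + ℓ * (B.coinLift ℓ z).im ≤ (B.coinLift ℓ z).re ∧
      (B.coinLift ℓ z).re ≤ z.re + ℓ * (B.coinLift ℓ z).im + 2 * Real.pi := by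
    intro z
    rw [coinLift_re, coinLift_im]
    constructor <;> linarith [B.reach_pos (z.re : Circ) z.im, B.reach_lt (z.re : Circ) z.im]
  have hM : ∀ z, Free K z → N - 2 * c - 8 * Real.pi / ℓ < z.im := fun z hz =>
    Free.height_lt hT hK hℓ hglob hp hpN (by linarith) hc hz
  obtain ⟨O, hO, hOne, hfold⟩ := exists_fold_of_sum hT hK hℓ hc ⟨p, hp⟩ hM (by linarith) hxy (by
    intro p q hpx hqy hkp hkq
    have h1 := hsum p hkp
    have h2 := hsum q hkq
    rw [hpx] at h1
    rw [hqy] at h2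
    change |(B.coinLift ℓ p).re + ((B.coinLift ℓ).symm p).re - S x| ≤ _ at h1
    change |(B.coinLift ℓ q).re + ((B.coinLift ℓ).symm q).re - S y| ≤ _ at h2
    linarith [(abs_le.1 h1).1, (abs_le.1 h2).2])
  have hdich := free_iterate_dichotomy hT hK hℓ (m := N - 2 * c - 8 * Real.pi / ℓ -
    (Real.pi + 2 * c) / ℓ - 1) (by linarith) (by linarith) hM (by
      have e : ℓ * (N - 2 * c - 8 * Real.pi / ℓ - (N - 2 * c - 8 * Real.pi / ℓ -
        (Real.pi + 2 * c) / ℓ - 1)) = Real.pi + 2 * c + ℓ := by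
        field_simp
        ring
      rw [e]
      linarith)
  set V : Set (Circ × ℝ) := toCylinder '' {z | Free K z} with hV
  have hVopen : IsOpen V := isOpenMap_toCylinder _ (isOpen_free hK.closed hK.le)
  have hmem : ∀ z, toCylinder z ∈ V ↔ Free K z := by
    intro z
    constructor
    · rintro ⟨w, hw, h⟩
      obtain ⟨n, rfl⟩ := toCylinder_eq_iff.1 h
      exact free_add hK hw n
    · intro h
      exact ⟨z, h, rfl⟩
  obtain ⟨h1, h2⟩ := measure_fold_eq_zero (B.measurePreserving_cotMap ℓ) hVopen.measurableSet (by
    rcases hdich with h | h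
    · left
      intro n x hx hx'
      obtain ⟨z, rfl⟩ := toCylinder_surjective x
      rw [cotMap_iterate] at hx' ⊢
      rw [cotMap_toCylinder] at hx'
      rw [hmem] at hx hx' ⊢
      exact h n z hx hx'
    -- In the backward alternative the orbit is read from its last point `T^[n + 1] z` back to `T
    -- z`.
    · right
      intro n x hx hx'
      obtain ⟨z, rfl⟩ := toCylinder_surjective x
      rw [cotMap_iterate] at hx'
      rw [cotMap_toCylinder]
      rw [hmem] at hx hx' ⊢
      have e : ∀ (n : ℕ) (w : ℂ), (B.coinLift ℓ).symm^[n] ((B.coinLift ℓ)^[n] w) = w := fun n =>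
        Function.LeftInverse.iterate (B.coinLift ℓ).symm_apply_apply n
      have e1 : (B.coinLift ℓ).symm^[n] ((B.coinLift ℓ)^[n + 1] z) = B.coinLift ℓ z := by
        rw [Function.iterate_succ_apply, e]
      have h3 := h n _ hx' (by
        rw [e1, Homeomorph.symm_apply_apply]
        exact hx)
      rwa [e1] at h3)
  have hpos := (isOpenMap_toCylinder _ hO).measure_pos phaseMeasure (hOne.image _)
  rcases hfold with h | h
  · refine hpos.ne' (measure_mono_null ?_ h2)
    rintro _ ⟨z, hz, rfl⟩
    rw [Set.mem_sdiff, Set.mem_preimage, cotMap_toCylinder, hmem, hmem]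
    exact h z hz
  · refine hpos.ne' (measure_mono_null ?_ h1)
    rintro _ ⟨z, hz, rfl⟩
    rw [Set.mem_sdiff, Set.mem_preimage, cotMap_toCylinder, hmem, hmem]
    exact h z hz

end Table

end Coin

namespace Coin

open Filter Topology

/-! ### Essential invariant curves give invariant bands -/

/-- The projection of the plane of the coordinates `φ` and `cot θ` to the phase annulus. -/
noncomputable def toPhase (z : ℂ) : Phase := ((z.re : Circ), ⟨arccot z.im, arccot_mem z.im⟩)

theorem continuous_toPhase : Continuous toPhase :=
  ((AddCircle.continuous_mk' _).comp Complex.continuous_re).prodMk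
    ((continuous_arccot.comp Complex.continuous_im).subtype_mk _)

/-- The cotangent of the second coordinate of a phase point. -/
noncomputable def phaseCot (x : Phase) : ℝ := Real.cot (x.2 : ℝ)

theorem phaseCot_toPhase (z : ℂ) : phaseCot (toPhase z) = z.im := cot_arccot _

theorem continuous_phaseCot : Continuous phaseCot := by
  have e : phaseCot = fun x : Phase => Real.cos (x.2 : ℝ) / Real.sin (x.2 : ℝ) :=
    funext fun x => Real.cot_eq_cos_div_sin _
  rw [e]
  exact Continuous.div (by fun_prop) (by fun_prop) fun x => (Real.sin_pos_of_mem_Ioo x.2.2).ne'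

theorem phase_ext {x y : Phase} (h1 : x.1 = y.1) (h2 : phaseCot x = phaseCot y) : x = y := by
  refine Prod.ext h1 (Subtype.ext ?_)
  have := congrArg arccot h2
  rwa [phaseCot, phaseCot, arccot_cot x.2.2, arccot_cot y.2.2] at this

theorem toPhase_eq_iff {z w : ℂ} :
    toPhase z = toPhase w ↔ ∃ n : ℤ, w = z + n * (2 * Real.pi) := by
  rw [← toCylinder_eq_iff]
  constructor
  · intro h
    have h1 := congrArg phaseCot h
    rw [phaseCot_toPhase, phaseCot_toPhase] at h1
    exact Prod.ext (Prod.ext_iff.1 h).1 h1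
  · intro h
    have h1 : (toPhase z).1 = (toPhase w).1 := (Prod.ext_iff.1 h).1
    refine phase_ext h1 ?_
    rw [phaseCot_toPhase, phaseCot_toPhase]
    exact (Prod.ext_iff.1 h).2

theorem exists_toPhase_eq (x : Phase) : ∃ z, toPhase z = x := by
  obtain ⟨z, hz⟩ := toCylinder_surjective (x.1, phaseCot x)
  have h1 : (toPhase z).1 = x.1 := (Prod.ext_iff.1 hz).1
  refine ⟨z, phase_ext h1 ?_⟩
  rw [phaseCot_toPhase]
  exact (Prod.ext_iff.1 hz).2

theorem coinMap_toPhase (B : Table) (ℓ : ℝ) (z : ℂ) :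
    coinMap B ℓ (toPhase z) = toPhase (B.coinLift ℓ z) := by
  obtain ⟨h1, h2⟩ := B.billiardMap_eq (z.re : Circ) z.im ⟨arccot z.im, arccot_mem z.im⟩
    (cot_arccot _)
  refine phase_ext ?_ ?_
  · simp only [coinMap, Function.comp_apply, sideMap, toPhase, h1, h2, B.coinLift_re,
      AddCircle.coe_add]
  · rw [phaseCot_toPhase, B.coinLift_im]
    exact h2

theorem coinMap_injective (B : Table) (ℓ : ℝ) : Function.Injective (coinMap B ℓ) := by
  intro x y h
  obtain ⟨z, rfl⟩ := exists_toPhase_eq x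
  obtain ⟨w, rfl⟩ := exists_toPhase_eq y
  rw [coinMap_toPhase, coinMap_toPhase, toPhase_eq_iff] at h
  obtain ⟨n, hn⟩ := h
  rw [← B.coinLift_add] at hn
  exact toPhase_eq_iff.2 ⟨n, (B.coinLift ℓ).injective hn⟩

/-- The degree of a closed curve on the circle. -/
theorem exists_lift_circ {f : Circ → Circ} (hf : Continuous f) :
    ∃ (F : ℝ → ℝ) (d : ℤ), Continuous F ∧ (∀ s : ℝ, (F s : Circ) = f (s : Circ)) ∧
      ∀ s, F (s + 2 * Real.pi) = F s + d * (2 * Real.pi) := by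
  have hcov := AddCircle.isCoveringMap_coe (2 * Real.pi)
  have hc : Continuous fun s : ℝ => f (s : Circ) := hf.comp (AddCircle.continuous_mk' _)
  obtain ⟨x₀, hx₀⟩ := QuotientAddGroup.mk_surjective (f ((0 : ℝ) : Circ))
  obtain ⟨F, ⟨-, hF⟩, -⟩ := hcov.existsUnique_continuousMap_lifts
    (⟨_, hc⟩ : C(ℝ, Circ)) 0 x₀ hx₀
  have hF' : ∀ s : ℝ, (F s : Circ) = f (s : Circ) := fun s => congrFun hF s
  have hpi := Real.two_pi_pos
  have hint : ∀ s, ∃ n : ℤ, F (s + 2 * Real.pi) - F s = n * (2 * Real.pi) := by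
    intro s
    have h1 : ((F (s + 2 * Real.pi) - F s : ℝ) : Circ) = 0 := by
      rw [AddCircle.coe_sub, hF', hF', AddCircle.coe_add_period, sub_self]
    obtain ⟨n, hn⟩ := (AddCircle.coe_eq_zero_iff _).1 h1
    exact ⟨n, by rw [← hn, zsmul_eq_mul]⟩
  obtain ⟨d, hd⟩ := hint 0
  refine ⟨F, d, F.continuous, hF', fun s => ?_⟩
  have hcont : Continuous fun s => (F (s + 2 * Real.pi) - F s) / (2 * Real.pi) := by fun_prop
  have hval : ∀ s, ∃ n : ℤ, (n : ℝ) = (F (s + 2 * Real.pi) - F s) / (2 * Real.pi) := fun s => by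
    obtain ⟨n, hn⟩ := hint s
    exact ⟨n, by rw [hn]; field_simp⟩
  choose g hg using hval
  have hg' : Continuous g := by
    rw [Int.isClosedEmbedding_coe_real.isEmbedding.continuous_iff]
    have : (Int.cast ∘ g : ℝ → ℝ) = _ := funext hg
    rw [this]
    exact hcont
  have h1 : g s = g 0 := PreconnectedSpace.constant inferInstance hg'
  have h2 := hg s
  have h3 := hg 0
  rw [hd, mul_div_cancel_right₀ _ hpi.ne'] at h3
  rw [h1, h3, eq_div_iff hpi.ne'] at h2
  linarith

/-- `F s - d * s` is continuous and periodic, hence bounded. -/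
theorem tendsto_of_add_period {F : ℝ → ℝ} (hF : Continuous F) {d : ℝ} (hd : 0 < d)
    (h : ∀ s, F (s + 2 * Real.pi) = F s + d * (2 * Real.pi)) :
    Tendsto F atBot atBot ∧ Tendsto F atTop atTop := by
  have hper : Function.Periodic (fun s => F s - d * s) (2 * Real.pi) := fun s => by
    simp only [h]
    ring
  obtain ⟨M, hM⟩ := (isCompact_Icc (a := (0 : ℝ)) (b := 0 + 2 * Real.pi)).exists_bound_of_continuousOn
    (f := fun s => F s - d * s) (by fun_prop)
  have hb : ∀ s, |F s - d * s| ≤ M := by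
    intro s
    obtain ⟨t, ht, hst⟩ := hper.exists_mem_Ico₀ Real.two_pi_pos s
    have := hM t ⟨ht.1, by linarith [ht.2]⟩
    rw [Real.norm_eq_abs] at this
    rwa [hst]
  constructor
  · refine tendsto_atBot_mono (fun s => ?_)
      (tendsto_atBot_add_const_right _ M (tendsto_id.const_mul_atBot hd))
    have := (abs_le.1 (hb s)).2
    simp only [id]
    linarith
  · refine tendsto_atTop_mono (fun s => ?_)
      (tendsto_atTop_add_const_right _ (-M) (tendsto_id.const_mul_atTop hd))
    have := (abs_le.1 (hb s)).1
    simp only [id]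
    linarith

/-- A curve of degree zero factors through the plane, which is contractible. -/
theorem nullhomotopic_of_lift {c : C(Circ, Phase)} {F : ℝ → ℝ} (hF : Continuous F)
    (hFc : ∀ s : ℝ, (F s : Circ) = (c (s : Circ)).1) (hper : Function.Periodic F (2 * Real.pi)) :
    c.Nullhomotopic := by
  obtain ⟨f, hf⟩ : ∃ f : Circ → ℝ, ∀ s : ℝ, f (s : Circ) = F s := ⟨hper.lift, fun s => rfl⟩
  have hf1 : Continuous f := continuous_circ (by simpa only [hf] using hF)
  have hh : Continuous fun φ => ((f φ : ℂ) + (phaseCot (c φ) : ℂ) * Complex.I) := by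
    have := continuous_phaseCot.comp c.continuous
    simp only [Function.comp_def] at this
    fun_prop
  have e : c = (⟨toPhase, continuous_toPhase⟩ : C(ℂ, Phase)).comp
      ((ContinuousMap.id ℂ).comp ⟨_, hh⟩) := by
    ext1 φ
    obtain ⟨s, rfl⟩ := QuotientAddGroup.mk_surjective φ
    refine phase_ext ?_ ?_
    · simp only [ContinuousMap.comp_apply, ContinuousMap.coe_mk, ContinuousMap.id_apply, toPhase]
      rw [← hFc s, ← hf]
      simp
    · simp only [ContinuousMap.comp_apply, ContinuousMap.coe_mk, ContinuousMap.id_apply]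
      rw [phaseCot_toPhase]
      simp
  rw [e]
  exact ((id_nullhomotopic ℂ).comp_left _).comp_right _

/-- The degree of an essential curve is not zero, so its lift connects the two ends of the plane;
for negative degree it is run backwards. A translate by periods passes through the given point. -/
theorem IsEssentialCurve.exists_crossing {C : Set Phase} (hC : IsEssentialCurve C) {z : ℂ}
    (hz : toPhase z ∈ C) : ∃ e ∈ Crossing (toPhase ⁻¹' C), ∃ t, e t = z := by
  obtain ⟨c, -, hnull, rfl⟩ := hC
  obtain ⟨F, d, hF, hFc, hFd⟩ := exists_lift_circ (f := fun φ => (c φ).1) (by fun_prop)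
  have hd : d ≠ 0 := by
    rintro rfl
    exact hnull (nullhomotopic_of_lift hF hFc fun s => by simpa using hFd s)
  set E : ℝ → ℂ := fun s => (F s : ℂ) + (phaseCot (c (s : Circ)) : ℂ) * Complex.I with hE
  have hEc : Continuous E := by
    have := continuous_phaseCot.comp (c.continuous.comp (AddCircle.continuous_mk' (2 * Real.pi)))
    simp only [Function.comp_def] at this
    fun_prop
  have hEre : ∀ s, (E s).re = F s := fun s => by simp [hE]
  have hEp : ∀ s, toPhase (E s) = c (s : Circ) := by
    intro s
    refine phase_ext ?_ ?_
    · rw [← hFc s, ← hEre s]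
      rfl
    · rw [phaseCot_toPhase]
      simp [hE]
  obtain ⟨φ, hφ⟩ := hz
  obtain ⟨s, rfl⟩ := QuotientAddGroup.mk_surjective φ
  obtain ⟨n, hn⟩ := toPhase_eq_iff.1 ((hEp s).trans hφ)
  have hmem : ∀ t, E t + n * (2 * Real.pi) ∈ toPhase ⁻¹' Set.range c := fun t =>
    ⟨(t : Circ), by rw [← hEp]; exact toPhase_eq_iff.2 ⟨n, rfl⟩⟩
  have hre : ∀ t, (E t + n * (2 * Real.pi) : ℂ).re = F t + n * (2 * Real.pi) := fun t => by
    rw [Complex.add_re, hEre]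
    simp
  rcases lt_or_gt_of_ne hd with h | h
  · obtain ⟨h1, h2⟩ := tendsto_of_add_period (F := fun s => F (-s)) (d := -d) (by fun_prop)
      (by simpa using h) (fun s => by
        have := hFd (-(s + 2 * Real.pi))
        have e : -(s + 2 * Real.pi) + 2 * Real.pi = -s := by ring
        rw [e] at this
        linarith)
    refine ⟨fun t => E (-t) + n * (2 * Real.pi), ⟨by fun_prop, fun t => hmem _, ?_, ?_⟩, -s, ?_⟩
    · simp only [hre]
      exact tendsto_atBot_add_const_right _ _ h1
    · simp only [hre]
      exact tendsto_atTop_add_const_right _ _ h2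
    · simp only [neg_neg]
      exact hn.symm
  · obtain ⟨h1, h2⟩ := tendsto_of_add_period hF (d := d) (by exact_mod_cast h) hFd
    refine ⟨fun t => E t + n * (2 * Real.pi), ⟨by fun_prop, fun t => hmem _, ?_, ?_⟩, s, hn.symm⟩
    · simp only [hre]
      exact tendsto_atBot_add_const_right _ _ h1
    · simp only [hre]
      exact tendsto_atTop_add_const_right _ _ h2

/-- The lift of an essential invariant curve is an invariant band. -/
theorem IsEssentialInvariantCurve.exists_band {B : Table} {ℓ : ℝ} (hℓ : 0 < ℓ) {C : Set Phase}
    (hC : IsEssentialInvariantCurve B ℓ C) : ∃ N D, InvariantBand (B.coinLift ℓ) (toPhase ⁻¹' C) N D ∧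
      ∃ p ∈ toPhase ⁻¹' C, p.im = N := by
  obtain ⟨hCe, hCi⟩ := hC
  have hcomp : IsCompact C := by
    obtain ⟨c, -, -, rfl⟩ := hCe
    exact isCompact_range c.continuous
  have hne : C.Nonempty := by
    obtain ⟨c, -, -, rfl⟩ := hCe
    exact Set.range_nonempty c
  obtain ⟨x, hx, hmax⟩ := hcomp.exists_isMaxOn hne continuous_phaseCot.continuousOn
  obtain ⟨D, hD⟩ := hcomp.exists_bound_of_continuousOn continuous_phaseCot.continuousOn
  have hinv : ∀ z, B.coinLift ℓ z ∈ toPhase ⁻¹' C ↔ z ∈ toPhase ⁻¹' C := by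
    intro z
    rw [Set.mem_preimage, Set.mem_preimage, ← coinMap_toPhase]
    constructor
    · intro h
      rw [← hCi] at h
      obtain ⟨y, hy, h⟩ := h
      rwa [← coinMap_injective B ℓ h]
    · intro h
      rw [← hCi]
      exact Set.mem_image_of_mem _ h
  refine ⟨phaseCot x, 2 * Real.pi + ℓ * D, ⟨hcomp.isClosed.preimage continuous_toPhase, hinv, ?_, ?_,
    B.coinLift_add ℓ, ?_, fun z hz => hCe.exists_crossing hz⟩, ?_⟩
  · intro z hz
    have : phaseCot (toPhase z) ≤ phaseCot x := hmax hz
    rwa [phaseCot_toPhase] at this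
  · intro n z
    rw [Set.mem_preimage, Set.mem_preimage, ← toPhase_eq_iff.2 ⟨n, rfl⟩]
  · intro z hz
    have h1 := hD _ ((hinv z).2 hz)
    rw [phaseCot_toPhase, Real.norm_eq_abs, B.coinLift_im] at h1
    have h2 := B.reach_pos (z.re : Circ) z.im
    have h3 := B.reach_lt (z.re : Circ) z.im
    have h4 : |ℓ * B.nextCot (z.re : Circ) z.im| ≤ ℓ * D := by
      rw [abs_mul, abs_of_pos hℓ]
      exact mul_le_mul_of_nonneg_left h1 hℓ.le
    rw [B.coinLift_re]
    rw [abs_le] at h4 ⊢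
    constructor <;> linarith
  · obtain ⟨p, rfl⟩ := exists_toPhase_eq x
    exact ⟨p, hx, (phaseCot_toPhase p).symm⟩

/-! ### The exchange of the ends of the annulus -/

/-- The reversal of the coin map on the plane. -/
noncomputable def reversal (ℓ : ℝ) (z : ℂ) : ℂ := ⟨z.re - ℓ * z.im, -z.im⟩

theorem reversal_reversal (ℓ : ℝ) (z : ℂ) : reversal ℓ (reversal ℓ z) = z := by
  apply Complex.ext <;> simp [reversal]

/-- After a coin step the reversal cancels the shear and leaves the conjugate of the billiard image,
to which `liftFun_conj` applies. -/
theorem coinLift_reversal (B : Table) (ℓ : ℝ) (z : ℂ) :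
    B.coinLift ℓ (reversal ℓ (B.coinLift ℓ z)) = reversal ℓ z + 2 * Real.pi := by
  have h1 : reversal ℓ (B.coinLift ℓ z) = starRingEnd ℂ (B.liftFun z) := by
    apply Complex.ext
    · simp [reversal, B.coinLift_re, B.coinLift_im, Table.liftFun]
    · simp [reversal, B.coinLift_im, Table.liftFun]
  have h2 : B.coinLift ℓ (starRingEnd ℂ (B.liftFun z)) =
      shear ℓ (B.liftFun (starRingEnd ℂ (B.liftFun z))) := rfl
  rw [h1, h2, B.liftFun_conj]
  apply Complex.ext
  · simp [reversal]
    ring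
  · simp [reversal]

/-- The reversal of the coin map on the phase annulus. -/
noncomputable def phaseReversal (ℓ : ℝ) (x : Phase) : Phase :=
  (x.1 - ((ℓ * phaseCot x : ℝ) : Circ), ⟨Real.pi - x.2, by linarith [x.2.2.2], by
    linarith [x.2.2.1]⟩)

theorem continuous_phaseReversal (ℓ : ℝ) : Continuous (phaseReversal ℓ) := by
  have h1 := continuous_phaseCot
  have h3 : Continuous ((↑) : ℝ → Circ) := AddCircle.continuous_mk' _
  refine Continuous.prodMk (by fun_prop) (Continuous.subtype_mk (by fun_prop) _)

theorem phaseReversal_toPhase (ℓ : ℝ) (z : ℂ) :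
    phaseReversal ℓ (toPhase z) = toPhase (reversal ℓ z) := by
  refine Prod.ext ?_ (Subtype.ext ?_)
  · simp only [phaseReversal, phaseCot_toPhase]
    simp only [toPhase, reversal, AddCircle.coe_sub]
  · simp only [phaseReversal, toPhase, reversal, arccot, Real.arctan_neg]
    ring

theorem phaseReversal_phaseReversal (ℓ : ℝ) (x : Phase) :
    phaseReversal ℓ (phaseReversal ℓ x) = x := by
  obtain ⟨z, rfl⟩ := exists_toPhase_eq x
  rw [phaseReversal_toPhase, phaseReversal_toPhase, reversal_reversal]

theorem coinMap_phaseReversal (B : Table) (ℓ : ℝ) (x : Phase) :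
    coinMap B ℓ (phaseReversal ℓ (coinMap B ℓ x)) = phaseReversal ℓ x := by
  obtain ⟨z, rfl⟩ := exists_toPhase_eq x
  rw [coinMap_toPhase, phaseReversal_toPhase, coinMap_toPhase, coinLift_reversal,
    phaseReversal_toPhase]
  exact (toPhase_eq_iff.2 ⟨1, by simp⟩).symm

/-- The reversal exchanges the ends of the annulus, so the height bound near `θ = 0` also serves
near `θ = π`. -/
theorem IsEssentialInvariantCurve.reversal {B : Table} {ℓ : ℝ} {C : Set Phase}
    (hC : IsEssentialInvariantCurve B ℓ C) :
    IsEssentialInvariantCurve B ℓ (phaseReversal ℓ '' C) := by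
  obtain ⟨⟨c, hinj, hnull, rfl⟩, hCi⟩ := hC
  set Q : C(Phase, Phase) := ⟨phaseReversal ℓ, continuous_phaseReversal ℓ⟩ with hQ
  have hQQ : Q.comp (Q.comp c) = c := by
    ext1 φ
    exact phaseReversal_phaseReversal ℓ (c φ)
  refine ⟨⟨Q.comp c, ?_, fun h => hnull ?_, ?_⟩, ?_⟩
  · exact (Function.Involutive.injective (phaseReversal_phaseReversal ℓ)).comp hinj
  · rw [← hQQ]
    exact h.comp_right Q
  · exact Set.range_comp (phaseReversal ℓ) c
  · conv_lhs => rw [← hCi]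
    rw [Set.image_image, Set.image_image]
    exact Set.image_congr fun x _ => coinMap_phaseReversal B ℓ x

/-- Essential invariant curves avoid the two ends of the annulus, when the sum of the images of a
vertical line under the coin map and its inverse is not monotone. -/
theorem exists_disjoint_boundaryStrips (B : Table) {ℓ : ℝ} (hℓ : 0 < ℓ) {x y : ℝ} (hxy : x < y)
    (hS : 2 * y + 2 / 3 * ℓ * circDeriv (radius B.γ) (y : Circ) <
      2 * x + 2 / 3 * ℓ * circDeriv (radius B.γ) (x : Circ)) :
    ∃ δ : ℝ, 0 < δ ∧ ∀ C : Set Phase, IsEssentialInvariantCurve B ℓ C →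
      Disjoint C (boundaryStrips δ) := by
  obtain ⟨N₀, hN₀⟩ := B.exists_height_bound hℓ hxy hS
  have key : ∀ C, IsEssentialInvariantCurve B ℓ C → ∀ x ∈ C, arccot N₀ ≤ (x.2 : ℝ) := by
    intro C hC x hx
    obtain ⟨N, D, hK, hp⟩ := hC.exists_band hℓ
    have h1 := hN₀ _ _ _ hK hp
    obtain ⟨z, rfl⟩ := exists_toPhase_eq x
    have h2 := hK.le z hx
    have h3 := Real.arctan_mono (h2.trans h1)
    simp only [toPhase, arccot]
    linarith
  refine ⟨arccot N₀, (arccot_mem N₀).1, fun C hC => Set.disjoint_left.2 fun x hx hx' => ?_⟩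
  rcases hx' with h | h
  · exact absurd (key C hC x hx) (not_le.2 h)
  · have := key _ hC.reversal _ (Set.mem_image_of_mem _ hx)
    simp only [phaseReversal] at this
    linarith

end Coin

namespace Coin

open Filter Topology

namespace Table

variable (B : Table)

/-! ### The second derivative of the radius of curvature -/

theorem contDiff_radius : ContDiff ℝ 3 fun s : ℝ => radius B.γ (s : Circ) :=
  B.contDiff_curv.inv fun s => (B.curv_pos (s : Circ)).ne'

theorem contDiff_circDeriv_radius : ContDiff ℝ 2 fun s : ℝ => circDeriv (radius B.γ) (s : Circ) :=
  contDiff_circDeriv (by norm_num) B.contDiff_radius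

theorem hasDerivAt_radius (s : ℝ) : HasDerivAt (fun s : ℝ => radius B.γ (s : Circ))
    (circDeriv (radius B.γ) (s : Circ)) s := by
  simpa using hasDerivAt_circ (by norm_num) B.contDiff_radius 0 s

theorem hasDerivAt_circDeriv_radius (s : ℝ) :
    HasDerivAt (fun s : ℝ => circDeriv (radius B.γ) (s : Circ))
      (circDeriv (circDeriv (radius B.γ)) (s : Circ)) s := by
  simpa using hasDerivAt_circ (by norm_num) B.contDiff_circDeriv_radius 0 s

theorem exists_isLeast : ∃ m, IsLeast (Set.range (circDeriv (circDeriv (radius B.γ)))) m := by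
  have hc : Continuous (circDeriv (circDeriv (radius B.γ))) := continuous_circ
    (contDiff_circDeriv (m := 1) (by norm_num) B.contDiff_circDeriv_radius).continuous
  obtain ⟨φ, -, h⟩ := (isCompact_univ (X := Circ)).exists_isMinOn ⟨0, trivial⟩ hc.continuousOn
  refine ⟨_, ⟨φ, rfl⟩, ?_⟩
  rintro _ ⟨ψ, rfl⟩
  exact h (Set.mem_univ ψ)

/-- The radius of curvature is constant if its second derivative is nowhere negative. -/
theorem circDeriv_radius_eq_zero (h : ∀ φ, 0 ≤ circDeriv (circDeriv (radius B.γ)) φ) (φ : Circ) :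
    circDeriv (radius B.γ) φ = 0 := by
  have hpi := Real.two_pi_pos
  have hcoe := AddCircle.coe_period (2 * Real.pi)
  have hmono : Monotone fun s : ℝ => circDeriv (radius B.γ) (s : Circ) :=
    monotone_of_deriv_nonneg (fun s => (B.hasDerivAt_circDeriv_radius s).differentiableAt)
      fun s => by
        rw [(B.hasDerivAt_circDeriv_radius s).deriv]
        exact h _
  have hper : ∀ (s : ℝ) (n : ℤ), circDeriv (radius B.γ) ((s + n * (2 * Real.pi) : ℝ) : Circ) =
      circDeriv (radius B.γ) (s : Circ) := by
    intro s n
    rw [AddCircle.coe_add, ← zsmul_eq_mul, AddCircle.coe_zsmul, hcoe, zsmul_zero, add_zero]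
  have hconst : ∀ s t : ℝ, circDeriv (radius B.γ) (s : Circ) ≤ circDeriv (radius B.γ) (t : Circ) := by
    intro s t
    -- A translate of `t` by enough periods lies to the right of `s`, and `ρ'` is monotone as well
    -- as periodic.
    obtain ⟨n, hn⟩ := exists_nat_gt ((s - t) / (2 * Real.pi))
    rw [div_lt_iff₀ hpi] at hn
    have h1 := hmono (by linarith : s ≤ t + n * (2 * Real.pi))
    have h2 := hper t n
    push_cast at h2
    simp only at h1
    rwa [h2] at h1
  obtain ⟨s₀, -, hs₀⟩ := exists_hasDerivAt_eq_zero hpi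
    (fun s _ => (B.hasDerivAt_radius s).continuousAt.continuousWithinAt) (by rw [hcoe]; rfl)
    (fun s _ => B.hasDerivAt_radius s)
  obtain ⟨s, rfl⟩ := QuotientAddGroup.mk_surjective φ
  exact le_antisymm (hs₀ ▸ hconst s s₀) (hs₀ ▸ hconst s₀ s)

/-- A table of constant curvature is a disc. -/
theorem frontier_eq_sphere (h : ∀ φ, circDeriv (radius B.γ) φ = 0) :
    ∃ (c : ℂ) (r : ℝ), frontier B.Γ = Metric.sphere c r := by
  have hρ : ∀ s : ℝ, radius B.γ (s : Circ) = radius B.γ ((0 : ℝ) : Circ) := fun s =>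
    is_const_of_deriv_eq_zero (fun s => (B.hasDerivAt_radius s).differentiableAt)
      (fun s => by rw [(B.hasDerivAt_radius s).deriv, h]) s 0
  set κ := B.curv ((0 : ℝ) : Circ) with hκ
  have hκ0 : 0 < κ := B.curv_pos _
  have hcurv : ∀ s : ℝ, B.curv (s : Circ) = κ := fun s => inv_injective (hρ s)
  have hτ : ∀ s : ℝ, HasDerivAt (fun s : ℝ => B.tangent (s : Circ))
      (κ * (Complex.I * B.tangent (s : Circ))) s := fun s => by
    simpa [hcurv] using B.hasDerivAt_tangent_shift 0 s
  have hγ : ∀ s : ℝ, HasDerivAt (fun s : ℝ => B.γ (s : Circ)) (B.tangent (s : Circ)) s := fun s => by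
    simpa using B.hasDerivAt_γ 0 s
  have hκc : (κ : ℂ) ≠ 0 := by exact_mod_cast hκ0.ne'
  have hexp : ∀ s : ℝ, HasDerivAt (fun s : ℝ => Complex.exp (-(κ * s) * Complex.I))
      (Complex.exp (-(κ * s) * Complex.I) * (-κ * Complex.I)) s := by
    intro s
    have h1 : HasDerivAt (fun s : ℝ => (-(κ * s) * Complex.I : ℂ)) (-κ * Complex.I) s := by
      have := ((Complex.ofRealCLM.hasDerivAt (x := s)).const_mul (κ : ℂ)).neg.mul_const Complex.I
      simpa using this
    exact h1.cexp
  set τ₀ := B.tangent ((0 : ℝ) : Circ) with hτ₀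
  have htan : ∀ s : ℝ, B.tangent (s : Circ) = Complex.exp ((κ * s : ℝ) * Complex.I) * τ₀ := by
    intro s
    have h1 : ∀ t : ℝ, HasDerivAt
        (fun s : ℝ => B.tangent (s : Circ) * Complex.exp (-(κ * s) * Complex.I)) 0 t := fun t => by
      refine ((hτ t).mul (hexp t)).congr_deriv ?_
      ring
    have h2 := is_const_of_deriv_eq_zero (fun t => (h1 t).differentiableAt)
      (fun t => (h1 t).deriv) s 0
    simp only [Complex.ofReal_zero, mul_zero, neg_zero, zero_mul, Complex.exp_zero, mul_one] at h2
    rw [← hτ₀] at h2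
    rw [← h2, mul_left_comm, ← Complex.exp_add]
    push_cast
    simp
  -- The centre of curvature `γ + i γ' / κ` does not move.
  obtain ⟨c, hc⟩ : ∃ c : ℂ, ∀ s : ℝ, B.γ (s : Circ) = c - Complex.I / κ * B.tangent (s : Circ) := by
    have h1 : ∀ t : ℝ, HasDerivAt
        (fun s : ℝ => B.γ (s : Circ) + Complex.I / κ * B.tangent (s : Circ)) 0 t := fun t => by
      refine ((hγ t).add ((hτ t).const_mul (Complex.I / κ))).congr_deriv ?_
      field_simp
      rw [Complex.I_sq]
      ring
    refine ⟨_, fun s => eq_sub_of_add_eq (is_const_of_deriv_eq_zero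
      (fun t => (h1 t).differentiableAt) (fun t => (h1 t).deriv) s 0)⟩
  have hn₀ : ‖τ₀‖ = 1 := B.norm_tangent _
  refine ⟨c, κ⁻¹, ?_⟩
  rw [B.frontier_eq]
  apply Set.Subset.antisymm
  · rintro _ ⟨φ, rfl⟩
    obtain ⟨s, rfl⟩ := QuotientAddGroup.mk_surjective φ
    rw [mem_sphere_iff_norm, hc, sub_sub_cancel_left, norm_neg, norm_mul, B.norm_tangent, norm_div,
      Complex.norm_I, Complex.norm_real, Real.norm_of_nonneg hκ0.le]
    simp
  -- The tangent angle is `κ s` plus a constant and takes all real values, so no point of the circle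
  -- is missed.
  · intro z hz
    rw [mem_sphere_iff_norm] at hz
    have hτ0 : τ₀ ≠ 0 := norm_ne_zero_iff.1 (by rw [hn₀]; norm_num)
    set w := (z - c) * κ / (-Complex.I * τ₀) with hw
    have hwn : ‖w‖ = 1 := by
      rw [hw, norm_div, norm_mul, norm_mul, hz, hn₀, norm_neg, Complex.norm_I, Complex.norm_real,
        Real.norm_of_nonneg hκ0.le]
      field_simp
    have hwa : w = Complex.exp (w.arg * Complex.I) := by
      have := Complex.norm_mul_exp_arg_mul_I w
      rw [hwn] at this
      simpa using this.symm
    refine ⟨((w.arg / κ : ℝ) : Circ), ?_⟩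
    have e : κ * (w.arg / κ) = w.arg := by field_simp
    rw [hc, htan, e, ← hwa, hw]
    have hI := Complex.I_ne_zero
    field_simp
    ring

end Table

end Coin

/-! ### The main theorem -/

theorem theoremB (B : Coin.Table)
    (hB : ¬ ∃ (c : ℂ) (r : ℝ), frontier B.Γ = Metric.sphere c r) :
    ∃ m ℓ₀ : ℝ,
      IsLeast (Set.range (Coin.circDeriv (Coin.circDeriv (Coin.radius B.γ)))) m ∧
      ℓ₀ = -3 / m ∧ 0 < ℓ₀ ∧
      ∀ ℓ : ℝ, ℓ₀ < ℓ → ∃ δ : ℝ, 0 < δ ∧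
        ∀ C : Set Coin.Phase, Coin.IsEssentialInvariantCurve B ℓ C →
          Disjoint C (Coin.boundaryStrips δ) := by
  obtain ⟨m, hm⟩ := B.exists_isLeast
  have hm0 : m < 0 := by
    by_contra! h
    exact hB (B.frontier_eq_sphere (B.circDeriv_radius_eq_zero fun φ => h.trans (hm.2 ⟨φ, rfl⟩)))
  have hℓ₀ : 0 < -3 / m := div_pos_of_neg_of_neg (by norm_num) hm0
  refine ⟨m, -3 / m, hm, rfl, hℓ₀, fun ℓ hℓ => ?_⟩
  have hℓ0 : 0 < ℓ := hℓ₀.trans hℓ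
  obtain ⟨φ, hφ⟩ := hm.1
  obtain ⟨s, rfl⟩ := QuotientAddGroup.mk_surjective φ
  have hd := ((hasDerivAt_id s).const_mul 2).add
    ((B.hasDerivAt_circDeriv_radius s).const_mul (2 / 3 * ℓ))
  obtain ⟨x, y, hxy, hS⟩ : ∃ x y : ℝ, x < y ∧
      2 * y + 2 / 3 * ℓ * Coin.circDeriv (Coin.radius B.γ) (y : Coin.Circ) <
        2 * x + 2 / 3 * ℓ * Coin.circDeriv (Coin.radius B.γ) (x : Coin.Circ) := by
    by_contra! h
    -- If `S` were monotone, its derivative `2 + 2/3 ℓ m` at a minimum of `ρ''` would be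
    -- nonnegative, against `ℓ m < -3`.
    have hmono := hd.nonneg_of_monotone (monotone_iff_forall_lt.2 fun x y hxy => h x y hxy)
    have h1 : ℓ * m < -3 := by
      rw [div_lt_iff_of_neg hm0] at hℓ
      exact hℓ
    have h2 : Coin.circDeriv (Coin.circDeriv (Coin.radius B.γ)) (s : Coin.Circ) = m := hφ
    rw [h2] at hmono
    linarith
  exact Coin.exists_disjoint_boundaryStrips B hℓ0 hxy hS
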